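/- Write octonions as pairs of quaternions with product $(\alpha_1,\alpha_2)(\beta_1,\beta_2)=(\alpha_1\beta_1-\bar\beta_2\alpha_2,\ \beta_2\alpha_1+\alpha_2\bar\beta_1)$ and basis $e_0=(1,0)$, $e_1=(i,0)$, $e_2=(j,0)$, $e_3=(k,0)$, $e_4=(0,1)$, $e_5=(0,i)$, $e_6=(0,j)$, $e_7=(0,k)$. Let $G_2$ be the group of automorphisms of the octonions, written as $7\times7$ real matrices in the basis $e_1,\dots,e_7$ of the imaginary octonions, and let $SO(4)\subset G_2$ be the stabilizer of the subalgebra spanned by $e_0,e_1,e_2,e_3$. With $E_{ij}$ the skew-symmetric matrix having entry $1$ at $(i,j)$ and $-1$ at $(j,i)$, put $C_{1}=-E_{47}-E_{56}$, $C_{2}=E_{46}-E_{57}$, $C_{3}=-E_{45}-E_{67}$, $C_{4}=E_{27}+E_{36}$, $C_{5}=-E_{26}+E_{37}$, $C_{6}=E_{25}-E_{34}$, $C_{7}=-E_{24}-E_{35}$, $C_{8}=\tfrac1{\sqrt3}(-2E_{23}+E_{45}-E_{67})$, $C_{9}=\tfrac1{\sqrt3}(-2E_{12}+E_{47}-E_{56})$,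 $C_{10}=\tfrac1{\sqrt3}(-2E_{13}-E_{46}-E_{57})$, $C_{11}=\tfrac1{\sqrt3}(-2E_{14}-E_{27}+E_{36})$, $C_{12}=\tfrac1{\sqrt3}(-2E_{15}+E_{26}+E_{37})$, $C_{13}=\tfrac1{\sqrt3}(-2E_{16}-E_{25}-E_{34})$, $C_{14}=\tfrac1{\sqrt3}(-2E_{17}+E_{24}-E_{35})$. These matrices are a basis of $\mathrm{Lie}(G_2)$ (the derivations of the octonions), orthonormal for $-\tfrac1{16}$ times the Killing form. For $a\in\mathbb R^{14}$ put $g(a)=h(a_1,\dots,a_8)\,u(a_9,\dots,a_{14})$, which lies in $G_2$, where $$h(a_1,\dots,a_8)=\sigma(a_1,a_2,a_3)\,s(a_4,a_5,a_6)\,e^{\sqrt3 a_7C_{11}}e^{a_8C_5},\qquad u(x,y,z;x',y',z')=s(x,y,z)\,\sigma(x',y',z')\in SO(4),$$ $$s(x,y,z)=e^{xC_3}e^{yC_2}e^{zC_3},\qquad \sigma(x,y,z)=e^{\sqrt3xC_8}e^{\sqrt3yC_9}e^{\sqrt3zC_8}.$$ For a smooth $\varphi$ with values in $G_2$ write $\varphi^{-1}d\varphi=\sum_{I,K}J^I{}_K\,dw^K\,C_I$;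 for $\varphi=g$ let $\underline J(a)$ be the resulting $14\times14$ matrix. Let $\tilde J_h$ be the $8\times8$ matrix of the components $I\in\{4,5,6,7,11,12,13,14\}$ of $h^{-1}dh=\sum_I J_h^I C_I$. The forms $du\,u^{-1}$, $ds\,s^{-1}$, $d\sigma\,\sigma^{-1}$ take values in the spans of the $C_I$ with $I\in\{1,2,3,8,9,10\}$, $\{1,2,3\}$, $\{8,9,10\}$ respectively; let $J_u$ ($6\times6$), $J_s$, $J_\sigma$ ($3\times3$) be their component matrices. All indices are in increasing order. Then for every $a\in\mathbb R^{14}$ the Jacobian determinant factors into a base part and a fiber part from $SO(4)$, $$\det\underline J=\det\tilde J_h\cdot\det J_u,\qquad \det J_u=\det J_s\cdot\det J_\sigma,$$ with $\tilde J_h$ evaluated at $(a_1,\dots,a_8)$, $J_u$ at $(a_9,\dots,a_{14})$, $J_s$ at $(a_9,a_{10},a_{11})$ and $J_\sigma$ at $(a_{12},a_{13},a_{14})$, and its value is $$\det\underline J=-\rho(a),\qquad \rho(a)=27\sqrt3\,f(2a_7,2a_8)\sin(2a_2)\sin(2a_5)\sin(2a_{10})\sin(2a_{13}),$$ where $$f(\alpha,\beta)=\sin\tfrac{\beta-\alpha}2\sin\tfrac{\beta+\alpha}2\sin\tfrac{\beta-3\alpha}2\sin\tfrac{\beta+3\alpha}2\sin\alpha\sin\beta=\tfrac14(\cos\alpha-\cos\beta)(\cos3\alpha-\cos\beta)\sin\alpha\sin\beta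 .$$ Moreover, there is exactly one Haar measure $\mu$ on $G_2$ that is the volume measure of the left-invariant $14$-bein, i.e. such that $d\mu=|\det(J^I{}_K)|\,dw^1\cdots dw^{14}$ in every coordinate patch (every injective $C^1$ map $\varphi$ from an open subset of $\mathbb R^{14}$ to $G_2$ with $\det(J^I{}_K)\neq0$ everywhere). In the coordinates above it is $d\mu=|\rho(a)|\prod_{i=1}^{14}da_i$: for every Borel set $E\subseteq\mathbb R^{14}$ on which $a\mapsto g(a)$ is injective, $\mu(g(E))=\int_E|\rho(a)|\,da$. -/

import Mathlib

/-! The compact group `G₂` as the automorphism group of the octonions, a basis of its Lie algebra,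
Euler coordinates, and the volume measure of the associated left-invariant frame. -/

open scoped Quaternion

noncomputable section

namespace G2Euler

attribute [local instance] LieRing.ofAssociativeRing

/-- Real `7 × 7` matrices, acting on the imaginary octonions in the basis `e₁, …, e₇`. -/
abbrev Mat7 : Type := Matrix (Fin 7) (Fin 7) ℝ

/-- Octonions as pairs of quaternions. The product is `octMul`, not the componentwise one. -/
abbrev Oct : Type := ℍ[ℝ] × ℍ[ℝ]

/-- Octonion multiplication:
`(α₁, α₂) (β₁, β₂) = (α₁ β₁ - β̄₂ α₂, β₂ α₁ + α₂ β̄₁)`. -/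
def octMul (x y : Oct) : Oct :=
  (x.1 * y.1 - star y.2 * x.2, y.2 * x.1 + x.2 * star y.1)

/-- The octonion `r e₀ + v₁ e₁ + … + v₇ e₇`, where
`e₀ = (1,0), e₁ = (i,0), e₂ = (j,0), e₃ = (k,0), e₄ = (0,1), e₅ = (0,i), e₆ = (0,j), e₇ = (0,k)`.
The coordinate of `eₘ` is `v (m - 1)`, since `Fin 7` starts at `0`. -/
def octOf (r : ℝ) (v : Fin 7 → ℝ) : Oct :=
  (⟨r, v 0, v 1, v 2⟩, ⟨v 3, v 4, v 5, v 6⟩)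

/-- The coordinates of the imaginary part of an octonion. -/
def octIm (x : Oct) : Fin 7 → ℝ :=
  ![x.1.imI, x.1.imJ, x.1.imK, x.2.re, x.2.imI, x.2.imJ, x.2.imK]

/-- The linear map of the octonions that is `A` on imaginary octonions and fixes `1`. -/
def octAut (A : Mat7) (x : Oct) : Oct := octOf x.1.re (A.mulVec (octIm x))

/-- The linear map of the octonions that is `A` on imaginary octonions and sends `1` to `0`. -/
def octDer (A : Mat7) (x : Oct) : Oct := octOf 0 (A.mulVec (octIm x))

theorem octIm_octOf (r : ℝ) (v : Fin 7 → ℝ) : octIm (octOf r v) = v := by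
  funext i
  fin_cases i <;> rfl

theorem octOf_octIm (x : Oct) : octOf x.1.re (octIm x) = x := rfl

theorem octAut_one (x : Oct) : octAut 1 x = x := by
  simp [octAut, octOf_octIm]

theorem octAut_mul (A B : Mat7) (x : Oct) : octAut (A * B) x = octAut A (octAut B x) := by
  simp only [octAut, octIm_octOf, ← Matrix.mulVec_mulVec]
  rfl

/-- The group `G₂` of automorphisms of the octonions. An automorphism fixes `1` and preserves the
imaginary octonions, so it is given by its `7 × 7` matrix there. -/
def G2 : Subgroup (GL (Fin 7) ℝ) where
  carrier := {A | ∀ x y : Oct,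
    octAut (A : Mat7) (octMul x y) = octMul (octAut (A : Mat7) x) (octAut (A : Mat7) y)}
  one_mem' := by
    intro x y
    simp [octAut_one]
  mul_mem' := by
    intro A B hA hB x y
    simp only [Units.val_mul, octAut_mul]
    rw [hB, hA]
  inv_mem' := by
    intro A hA x y
    have h1 : ∀ z, octAut (A : Mat7) (octAut ((A⁻¹ : GL (Fin 7) ℝ) : Mat7) z) = z := by
      intro z
      rw [← octAut_mul, Units.mul_inv, octAut_one]
    have h2 : ∀ z, octAut ((A⁻¹ : GL (Fin 7) ℝ) : Mat7) (octAut (A : Mat7) z) = z := by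
      intro z
      rw [← octAut_mul, Units.inv_mul, octAut_one]
    have h3 := hA (octAut ((A⁻¹ : GL (Fin 7) ℝ) : Mat7) x) (octAut ((A⁻¹ : GL (Fin 7) ℝ) : Mat7) y)
    rw [h1, h1] at h3
    rw [← h3, h2]

/-- `G₂` carries its Borel `σ`-algebra. -/
instance : MeasurableSpace G2 := borel G2

instance : BorelSpace G2 := ⟨rfl⟩

/-- The underlying `7 × 7` matrix of an element of `G₂`. -/
def G2.mat (x : G2) : Mat7 := ((x : GL (Fin 7) ℝ) : Mat7)

theorem octDer_zero (x : Oct) : octDer 0 x = 0 := by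
  simp only [octDer, Matrix.zero_mulVec]
  rfl

theorem octOf_add (v w : Fin 7 → ℝ) : octOf 0 (v + w) = octOf 0 v + octOf 0 w := by
  refine Prod.ext ?_ ?_
  · refine QuaternionAlgebra.ext (add_zero 0).symm ?_ ?_ ?_ <;> rfl
  · refine QuaternionAlgebra.ext ?_ ?_ ?_ ?_ <;> rfl

theorem octOf_sub (v w : Fin 7 → ℝ) : octOf 0 (v - w) = octOf 0 v - octOf 0 w := by
  refine Prod.ext ?_ ?_
  · refine QuaternionAlgebra.ext (sub_zero 0).symm ?_ ?_ ?_ <;> rfl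
  · refine QuaternionAlgebra.ext ?_ ?_ ?_ ?_ <;> rfl

theorem octOf_smul (c : ℝ) (v : Fin 7 → ℝ) : octOf 0 (c • v) = c • octOf 0 v := by
  refine Prod.ext ?_ ?_
  · refine QuaternionAlgebra.ext (mul_zero c).symm ?_ ?_ ?_ <;> rfl
  · refine QuaternionAlgebra.ext ?_ ?_ ?_ ?_ <;> rfl

theorem octDer_add (A B : Mat7) (x : Oct) : octDer (A + B) x = octDer A x + octDer B x := by
  simp only [octDer, Matrix.add_mulVec, octOf_add]

theorem octDer_sub (A B : Mat7) (x : Oct) : octDer (A - B) x = octDer A x - octDer B x := by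
  simp only [octDer, Matrix.sub_mulVec, octOf_sub]

theorem octDer_smul (c : ℝ) (A : Mat7) (x : Oct) : octDer (c • A) x = c • octDer A x := by
  simp only [octDer, Matrix.smul_mulVec, octOf_smul]

theorem octDer_mul (A B : Mat7) (x : Oct) : octDer (A * B) x = octDer A (octDer B x) := by
  simp only [octDer, octIm_octOf, ← Matrix.mulVec_mulVec]

theorem octDer_arg_add (A : Mat7) (x y : Oct) : octDer A (x + y) = octDer A x + octDer A y := by
  have h : octIm (x + y) = octIm x + octIm y := by
    funext i
    fin_cases i <;> rfl
  simp only [octDer, h, Matrix.mulVec_add, octOf_add]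

theorem octMul_add_left (x y z : Oct) : octMul (x + y) z = octMul x z + octMul y z := by
  ext1 <;> simp only [octMul, Prod.fst_add, Prod.snd_add, add_mul, mul_add] <;> abel

theorem octMul_add_right (x y z : Oct) : octMul x (y + z) = octMul x y + octMul x z := by
  ext1 <;> simp only [octMul, Prod.fst_add, Prod.snd_add, add_mul, mul_add, star_add] <;> abel

theorem octMul_smul_left (c : ℝ) (x y : Oct) : octMul (c • x) y = c • octMul x y := by
  ext1 <;> simp only [octMul, Prod.smul_fst, Prod.smul_snd, smul_mul_assoc, mul_smul_comm,
    smul_sub, smul_add]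

theorem octMul_smul_right (c : ℝ) (x y : Oct) : octMul x (c • y) = c • octMul x y := by
  ext1 <;> simp only [octMul, Prod.smul_fst, Prod.smul_snd, smul_mul_assoc, mul_smul_comm,
    smul_sub, smul_add, Quaternion.star_smul]

theorem octMul_zero_left (x : Oct) : octMul 0 x = 0 := by
  simp [octMul]

theorem octMul_zero_right (x : Oct) : octMul x 0 = 0 := by
  simp [octMul]

/-- The Lie algebra of `G₂`: the derivations of the octonions (with the commutator bracket). A
derivation kills `1` and preserves the imaginary octonions. -/
def g2Lie : LieSubalgebra ℝ Mat7 where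
  carrier := {D | ∀ x y : Oct,
    octDer D (octMul x y) = octMul (octDer D x) y + octMul x (octDer D y)}
  zero_mem' := by
    intro x y
    simp [octDer_zero, octMul_zero_left, octMul_zero_right]
  add_mem' := by
    intro A B hA hB x y
    simp only [octDer_add, octMul_add_left, octMul_add_right]
    rw [hA, hB]
    abel
  smul_mem' := by
    intro c A hA x y
    simp only [octDer_smul, octMul_smul_left, octMul_smul_right]
    rw [hA, smul_add]
  lie_mem' := by
    intro A B hA hB x y
    have e1 : octMul (octDer (A * B) x - octDer (B * A) x) y =
        octMul (octDer (A * B) x) y - octMul (octDer (B * A) x) y := by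
      rw [eq_sub_iff_add_eq, ← octMul_add_left, sub_add_cancel]
    have e2 : octMul x (octDer (A * B) y - octDer (B * A) y) =
        octMul x (octDer (A * B) y) - octMul x (octDer (B * A) y) := by
      rw [eq_sub_iff_add_eq, ← octMul_add_right, sub_add_cancel]
    simp only [Ring.lie_def, octDer_sub, e1, e2]
    simp only [octDer_mul]
    rw [hA x y, hB x y, octDer_arg_add, octDer_arg_add, hA, hA, hB, hB]
    abel

/-- The matrices `C₁, …, C₁₄`; `C_I` is `gen (I - 1)`, since `Fin 14` starts at `0`. -/
def gen : Fin 14 → Mat7 :=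
  ![
  !![0, 0, 0, 0, 0, 0, 0;
     0, 0, 0, 0, 0, 0, 0;
     0, 0, 0, 0, 0, 0, 0;
     0, 0, 0, 0, 0, 0, -1;
     0, 0, 0, 0, 0, -1, 0;
     0, 0, 0, 0, 1, 0, 0;
     0, 0, 0, 1, 0, 0, 0],
  !![0, 0, 0, 0, 0, 0, 0;
     0, 0, 0, 0, 0, 0, 0;
     0, 0, 0, 0, 0, 0, 0;
     0, 0, 0, 0, 0, 1, 0;
     0, 0, 0, 0, 0, 0, -1;
     0, 0, 0, -1, 0, 0, 0;
     0, 0, 0, 0, 1, 0, 0],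
  !![0, 0, 0, 0, 0, 0, 0;
     0, 0, 0, 0, 0, 0, 0;
     0, 0, 0, 0, 0, 0, 0;
     0, 0, 0, 0, -1, 0, 0;
     0, 0, 0, 1, 0, 0, 0;
     0, 0, 0, 0, 0, 0, -1;
     0, 0, 0, 0, 0, 1, 0],
  !![0, 0, 0, 0, 0, 0, 0;
     0, 0, 0, 0, 0, 0, 1;
     0, 0, 0, 0, 0, 1, 0;
     0, 0, 0, 0, 0, 0, 0;
     0, 0, 0, 0, 0, 0, 0;
     0, 0, -1, 0, 0, 0, 0;
     0, -1, 0, 0, 0, 0, 0],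
  !![0, 0, 0, 0, 0, 0, 0;
     0, 0, 0, 0, 0, -1, 0;
     0, 0, 0, 0, 0, 0, 1;
     0, 0, 0, 0, 0, 0, 0;
     0, 0, 0, 0, 0, 0, 0;
     0, 1, 0, 0, 0, 0, 0;
     0, 0, -1, 0, 0, 0, 0],
  !![0, 0, 0, 0, 0, 0, 0;
     0, 0, 0, 0, 1, 0, 0;
     0, 0, 0, -1, 0, 0, 0;
     0, 0, 1, 0, 0, 0, 0;
     0, -1, 0, 0, 0, 0, 0;
     0, 0, 0, 0, 0, 0, 0;
     0, 0, 0, 0, 0, 0, 0],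
  !![0, 0, 0, 0, 0, 0, 0;
     0, 0, 0, -1, 0, 0, 0;
     0, 0, 0, 0, -1, 0, 0;
     0, 1, 0, 0, 0, 0, 0;
     0, 0, 1, 0, 0, 0, 0;
     0, 0, 0, 0, 0, 0, 0;
     0, 0, 0, 0, 0, 0, 0],
  (1 / √3 : ℝ) •
   !![0, 0, 0, 0, 0, 0, 0;
     0, 0, -2, 0, 0, 0, 0;
     0, 2, 0, 0, 0, 0, 0;
     0, 0, 0, 0, 1, 0, 0;
     0, 0, 0, -1, 0, 0, 0;
     0, 0, 0, 0, 0, 0, -1;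
     0, 0, 0, 0, 0, 1, 0],
  (1 / √3 : ℝ) •
   !![0, -2, 0, 0, 0, 0, 0;
     2, 0, 0, 0, 0, 0, 0;
     0, 0, 0, 0, 0, 0, 0;
     0, 0, 0, 0, 0, 0, 1;
     0, 0, 0, 0, 0, -1, 0;
     0, 0, 0, 0, 1, 0, 0;
     0, 0, 0, -1, 0, 0, 0],
  (1 / √3 : ℝ) •
   !![0, 0, -2, 0, 0, 0, 0;
     0, 0, 0, 0, 0, 0, 0;
     2, 0, 0, 0, 0, 0, 0;
     0, 0, 0, 0, 0, -1, 0;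
     0, 0, 0, 0, 0, 0, -1;
     0, 0, 0, 1, 0, 0, 0;
     0, 0, 0, 0, 1, 0, 0],
  (1 / √3 : ℝ) •
   !![0, 0, 0, -2, 0, 0, 0;
     0, 0, 0, 0, 0, 0, -1;
     0, 0, 0, 0, 0, 1, 0;
     2, 0, 0, 0, 0, 0, 0;
     0, 0, 0, 0, 0, 0, 0;
     0, 0, -1, 0, 0, 0, 0;
     0, 1, 0, 0, 0, 0, 0],
  (1 / √3 : ℝ) •
   !![0, 0, 0, 0, -2, 0, 0;
     0, 0, 0, 0, 0, 1, 0;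
     0, 0, 0, 0, 0, 0, 1;
     0, 0, 0, 0, 0, 0, 0;
     2, 0, 0, 0, 0, 0, 0;
     0, -1, 0, 0, 0, 0, 0;
     0, 0, -1, 0, 0, 0, 0],
  (1 / √3 : ℝ) •
   !![0, 0, 0, 0, 0, -2, 0;
     0, 0, 0, 0, -1, 0, 0;
     0, 0, 0, -1, 0, 0, 0;
     0, 0, 1, 0, 0, 0, 0;
     0, 1, 0, 0, 0, 0, 0;
     2, 0, 0, 0, 0, 0, 0;
     0, 0, 0, 0, 0, 0, 0],
  (1 / √3 : ℝ) •
   !![0, 0, 0, 0, 0, 0, -2;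
     0, 0, 0, 1, 0, 0, 0;
     0, 0, 0, 0, -1, 0, 0;
     0, -1, 0, 0, 0, 0, 0;
     0, 0, 1, 0, 0, 0, 0;
     0, 0, 0, 0, 0, 0, 0;
     2, 0, 0, 0, 0, 0, 0]]

/-- The coefficient of `gen I` in an element of the span of the generators, which satisfy
`Tr (C_I C_J) = -4 δ_IJ`. -/
def coord (I : Fin 14) (X : Mat7) : ℝ := -(1 / 4) * (gen I * X).trace

/-- The partial derivative `∂φ/∂w^K` of a matrix-valued function, entry by entry. -/
def pderiv {n : ℕ} (φ : (Fin n → ℝ) → Mat7) (K : Fin n) (w : Fin n → ℝ) : Mat7 :=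
  Matrix.of fun i j => fderiv ℝ (fun v => φ v i j) w (Pi.single K 1)

/-- The coefficients `J^I_K` of the left-invariant form `φ⁻¹ dφ = J^I_K dw^K C_I`. -/
def leftCurrent {n : ℕ} (φ : (Fin n → ℝ) → Mat7) (w : Fin n → ℝ) :
    Matrix (Fin 14) (Fin n) ℝ :=
  Matrix.of fun I K => coord I ((φ w)⁻¹ * pderiv φ K w)

/-- The coefficients of the form `dφ φ⁻¹`. -/
def rightCurrent {n : ℕ} (φ : (Fin n → ℝ) → Mat7) (w : Fin n → ℝ) :
    Matrix (Fin 14) (Fin n) ℝ :=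
  Matrix.of fun I K => coord I (pderiv φ K w * (φ w)⁻¹)

/-- `s(x,y,z) = e^{x C₃} e^{y C₂} e^{z C₃}`. -/
def sMap (x : Fin 3 → ℝ) : Mat7 :=
  NormedSpace.exp (x 0 • gen 2) * NormedSpace.exp (x 1 • gen 1) * NormedSpace.exp (x 2 • gen 2)

/-- `σ(x,y,z) = e^{√3 x C₈} e^{√3 y C₉} e^{√3 z C₈}`. -/
def sigmaMap (x : Fin 3 → ℝ) : Mat7 :=
  NormedSpace.exp ((√3 * x 0) • gen 7) * NormedSpace.exp ((√3 * x 1) • gen 8) *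
    NormedSpace.exp ((√3 * x 2) • gen 7)

/-- `h = σ(a₁,a₂,a₃) s(a₄,a₅,a₆) e^{√3 a₇ C₁₁} e^{a₈ C₅}`. -/
def hMap (a : Fin 8 → ℝ) : Mat7 :=
  sigmaMap ![a 0, a 1, a 2] * sMap ![a 3, a 4, a 5] *
    NormedSpace.exp ((√3 * a 6) • gen 10) * NormedSpace.exp (a 7 • gen 4)

/-- The coordinates `a₁, …, a₈` on the base. -/
def baseCoords (a : Fin 14 → ℝ) : Fin 8 → ℝ :=
  ![a 0, a 1, a 2, a 3, a 4, a 5, a 6, a 7]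

/-- The coordinates `a₉, …, a₁₄` on the fiber. -/
def fiberCoords (a : Fin 14 → ℝ) : Fin 6 → ℝ :=
  ![a 8, a 9, a 10, a 11, a 12, a 13]

/-- `u(x,y,z;x',y',z') = s(x,y,z) σ(x',y',z')`. -/
def uMap (c : Fin 6 → ℝ) : Mat7 :=
  sMap ![c 0, c 1, c 2] * sigmaMap ![c 3, c 4, c 5]

/-- The Euler coordinates `g = h(a₁,…,a₈) u(a₉,…,a₁₄)` on `G₂`. -/
def eulerMap (a : Fin 14 → ℝ) : Mat7 :=
  hMap (baseCoords a) * uMap (fiberCoords a)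

/-- The subgroup `SO(4)` of `G₂`: the stabilizer of the quaternion subalgebra spanned by
`1, e₁, e₂, e₃`. -/
def SO4 : Set Mat7 :=
  {A | (∃ x : G2, G2.mat x = A) ∧ ∀ y : Oct, y.2 = 0 → (octAut A y).2 = 0}

/-- The rows `4,5,6,7,11,12,13,14`, orthogonal to the Lie algebra of `SO(4)`. -/
def baseRows : Fin 8 → Fin 14 := ![3, 4, 5, 6, 10, 11, 12, 13]

/-- The rows `1,2,3` of the factor `S`. -/
def sRows : Fin 3 → Fin 14 := ![0, 1, 2]

/-- The rows `8,9,10` of the factor `Σ`. -/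
def sigmaRows : Fin 3 → Fin 14 := ![7, 8, 9]

/-- The rows `1,2,3,8,9,10` of the Lie algebra of `SO(4)`. -/
def fiberRows : Fin 6 → Fin 14 := ![0, 1, 2, 7, 8, 9]

/-- The `8`-bein `J̃_h`: the part of `h⁻¹ dh` orthogonal to the fiber. -/
def baseBein (a : Fin 8 → ℝ) : Matrix (Fin 8) (Fin 8) ℝ :=
  (leftCurrent hMap a).submatrix baseRows id

/-- The `6`-bein of `du u⁻¹` on the fiber `SO(4)`. -/
def fiberBein (c : Fin 6 → ℝ) : Matrix (Fin 6) (Fin 6) ℝ :=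
  (rightCurrent uMap c).submatrix fiberRows id

/-- The `3`-bein of `ds s⁻¹`. -/
def sBein (x : Fin 3 → ℝ) : Matrix (Fin 3) (Fin 3) ℝ :=
  (rightCurrent sMap x).submatrix sRows id

/-- The `3`-bein of `dσ σ⁻¹`. -/
def sigmaBein (x : Fin 3 → ℝ) : Matrix (Fin 3) (Fin 3) ℝ :=
  (rightCurrent sigmaMap x).submatrix sigmaRows id

/-- `f(α,β) = sin((β-α)/2) sin((β+α)/2) sin((β-3α)/2) sin((β+3α)/2) sin α sin β`. -/
def fFun (α β : ℝ) : ℝ :=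
  Real.sin ((β - α) / 2) * Real.sin ((β + α) / 2) * Real.sin ((β - 3 * α) / 2) *
    Real.sin ((β + 3 * α) / 2) * Real.sin α * Real.sin β

/-- `27 √3 f(2a₇, 2a₈) sin(2a₂) sin(2a₅) sin(2a₁₀) sin(2a₁₃)`. -/
def eulerDensity (a : Fin 14 → ℝ) : ℝ :=
  27 * √3 * fFun (2 * a 6) (2 * a 7) * Real.sin (2 * a 1) * Real.sin (2 * a 4) *
    Real.sin (2 * a 9) * Real.sin (2 * a 12)

/-- `μ` is the volume measure of the left-invariant `14`-bein on `G₂`: in every coordinate patch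
`w ↦ φ w` it is `|det J| dw¹ … dw¹⁴`, where `φ⁻¹ dφ = J^I_K dw^K C_I`. -/
def IsBeinVolume (μ : MeasureTheory.Measure G2) : Prop :=
  ∀ (U : Set (Fin 14 → ℝ)) (φ : (Fin 14 → ℝ) → Mat7), IsOpen U →
    (∀ i j, ContDiffOn ℝ 1 (fun w => φ w i j) U) →
    (∀ w ∈ U, ∃ x : G2, G2.mat x = φ w) → Set.InjOn φ U →
    (∀ w ∈ U, (leftCurrent φ w).det ≠ 0) →
    ∀ E ⊆ U, MeasurableSet E →
      μ {x : G2 | G2.mat x ∈ φ '' E} =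
        ∫⁻ w in E, ENNReal.ofReal |(leftCurrent φ w).det|

end G2Euler

end

open scoped Quaternion

noncomputable section

namespace G2Euler

attribute [local instance] LieRing.ofAssociativeRing

/-! The determinant. For `g = h u` one has `g⁻¹ dg = u⁻¹ (h⁻¹ dh + du u⁻¹) u`. Conjugation by `u` is
orthogonal for the trace form and has determinant `1`, so only the bracket matters. Its second term
lies in the Lie algebra of SO(4), so the matrix is block triangular and its determinant is that of
the base block times that of the fiber block (`det_leftCurrent_eulerMap`). The factors `s` and `σ`
of `u` commute, which splits the fiber block into two classical Euler-angle Jacobians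
(`det_fiberBein`).

The base. G₂/SO(4) is a symmetric space of rank two, and `h = v e^T` with `v = σ s` in SO(4) and `T`
in the abelian plane spanned by `C₁₁` and `C₅`. Each of the six positive restricted roots `α` has
multiplicity one: there are `X` in the Lie algebra of SO(4) and `Y` orthogonal to it with `[T,X] =
α(T) Y` and `[T,Y] = -α(T) X`. Hence `e^{-T} X e^T = cos α(T) X - sin α(T) Y`, and the base
determinant is the product of the six `sin α(T)`, times the Euler-angle Jacobians of `v`, times a
constant (`det_rootBlock`, `det_baseBein`). For `T = a √3 C₁₁ + b C₅` the roots are `2b`, `2a`, `b ±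
a`, `b ± 3a`, which produces `f(2a, 2b)`. Rescaled by `√3` where necessary, the generators have
integer entries, so the structural identities are decided over `ℤ`.

The measure. Let `ν` be a Haar measure and `λ` Lebesgue measure in a chart near `1`. As G₂ is
compact, `ν` is also right-invariant, so `∫ λ(x⁻¹A) dν(x) = λ(G₂) ν(A)`. For a patch `A = φ(E)` the
change of variables gives `λ(x⁻¹A) = ∫_E D(x⁻¹ φ(w)) |det J(w)| dw` with a fixed density `D`; after
exchanging the integrals, left invariance makes the integral over `x` independent of `w`. Thus
`ν(φ(E))` is a constant times `∫_E |det J|`, with a constant that does not depend on the patch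
(`haar_patch`). One Euler patch of finite positive volume fixes the normalization, which gives
existence, uniqueness and the formula in Euler coordinates. -/

/-! ### Integral form of the generators. -/

/-- Integer multiples of the generators: `gen I` for `I < 7` and `√3 • gen I` for `7 ≤ I`. -/
def zmat : Fin 14 → Matrix (Fin 7) (Fin 7) ℤ :=
  ![
  !![0, 0, 0, 0, 0, 0, 0; 0, 0, 0, 0, 0, 0, 0; 0, 0, 0, 0, 0, 0, 0; 0, 0, 0, 0, 0, 0, -1;
     0, 0, 0, 0, 0, -1, 0; 0, 0, 0, 0, 1, 0, 0; 0, 0, 0, 1, 0, 0, 0],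
  !![0, 0, 0, 0, 0, 0, 0; 0, 0, 0, 0, 0, 0, 0; 0, 0, 0, 0, 0, 0, 0; 0, 0, 0, 0, 0, 1, 0;
     0, 0, 0, 0, 0, 0, -1; 0, 0, 0, -1, 0, 0, 0; 0, 0, 0, 0, 1, 0, 0],
  !![0, 0, 0, 0, 0, 0, 0; 0, 0, 0, 0, 0, 0, 0; 0, 0, 0, 0, 0, 0, 0; 0, 0, 0, 0, -1, 0, 0;
     0, 0, 0, 1, 0, 0, 0; 0, 0, 0, 0, 0, 0, -1; 0, 0, 0, 0, 0, 1, 0],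
  !![0, 0, 0, 0, 0, 0, 0; 0, 0, 0, 0, 0, 0, 1; 0, 0, 0, 0, 0, 1, 0; 0, 0, 0, 0, 0, 0, 0;
     0, 0, 0, 0, 0, 0, 0; 0, 0, -1, 0, 0, 0, 0; 0, -1, 0, 0, 0, 0, 0],
  !![0, 0, 0, 0, 0, 0, 0; 0, 0, 0, 0, 0, -1, 0; 0, 0, 0, 0, 0, 0, 1; 0, 0, 0, 0, 0, 0, 0;
     0, 0, 0, 0, 0, 0, 0; 0, 1, 0, 0, 0, 0, 0; 0, 0, -1, 0, 0, 0, 0],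
  !![0, 0, 0, 0, 0, 0, 0; 0, 0, 0, 0, 1, 0, 0; 0, 0, 0, -1, 0, 0, 0; 0, 0, 1, 0, 0, 0, 0;
     0, -1, 0, 0, 0, 0, 0; 0, 0, 0, 0, 0, 0, 0; 0, 0, 0, 0, 0, 0, 0],
  !![0, 0, 0, 0, 0, 0, 0; 0, 0, 0, -1, 0, 0, 0; 0, 0, 0, 0, -1, 0, 0; 0, 1, 0, 0, 0, 0, 0;
     0, 0, 1, 0, 0, 0, 0; 0, 0, 0, 0, 0, 0, 0; 0, 0, 0, 0, 0, 0, 0],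
  !![0, 0, 0, 0, 0, 0, 0; 0, 0, -2, 0, 0, 0, 0; 0, 2, 0, 0, 0, 0, 0; 0, 0, 0, 0, 1, 0, 0;
     0, 0, 0, -1, 0, 0, 0; 0, 0, 0, 0, 0, 0, -1; 0, 0, 0, 0, 0, 1, 0],
  !![0, -2, 0, 0, 0, 0, 0; 2, 0, 0, 0, 0, 0, 0; 0, 0, 0, 0, 0, 0, 0; 0, 0, 0, 0, 0, 0, 1;
     0, 0, 0, 0, 0, -1, 0; 0, 0, 0, 0, 1, 0, 0; 0, 0, 0, -1, 0, 0, 0],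
  !![0, 0, -2, 0, 0, 0, 0; 0, 0, 0, 0, 0, 0, 0; 2, 0, 0, 0, 0, 0, 0; 0, 0, 0, 0, 0, -1, 0;
     0, 0, 0, 0, 0, 0, -1; 0, 0, 0, 1, 0, 0, 0; 0, 0, 0, 0, 1, 0, 0],
  !![0, 0, 0, -2, 0, 0, 0; 0, 0, 0, 0, 0, 0, -1; 0, 0, 0, 0, 0, 1, 0; 2, 0, 0, 0, 0, 0, 0;
     0, 0, 0, 0, 0, 0, 0; 0, 0, -1, 0, 0, 0, 0; 0, 1, 0, 0, 0, 0, 0],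
  !![0, 0, 0, 0, -2, 0, 0; 0, 0, 0, 0, 0, 1, 0; 0, 0, 0, 0, 0, 0, 1; 0, 0, 0, 0, 0, 0, 0;
     2, 0, 0, 0, 0, 0, 0; 0, -1, 0, 0, 0, 0, 0; 0, 0, -1, 0, 0, 0, 0],
  !![0, 0, 0, 0, 0, -2, 0; 0, 0, 0, 0, -1, 0, 0; 0, 0, 0, -1, 0, 0, 0; 0, 0, 1, 0, 0, 0, 0;
     0, 1, 0, 0, 0, 0, 0; 2, 0, 0, 0, 0, 0, 0; 0, 0, 0, 0, 0, 0, 0],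
  !![0, 0, 0, 0, 0, 0, -2; 0, 0, 0, 1, 0, 0, 0; 0, 0, 0, 0, -1, 0, 0; 0, -1, 0, 0, 0, 0, 0;
     0, 0, 1, 0, 0, 0, 0; 0, 0, 0, 0, 0, 0, 0; 2, 0, 0, 0, 0, 0, 0]]

/-- The square norm of `zmat I`, in units of that of `gen I`. -/
def zwt : Fin 14 → ℤ := ![1, 1, 1, 1, 1, 1, 1, 3, 3, 3, 3, 3, 3, 3]

/-- Cast of an integer matrix. -/
def castMat : Matrix (Fin 7) (Fin 7) ℤ →+* Mat7 := (Int.castRingHom ℝ).mapMatrix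

/-- The combination of the matrices `zmat I` with integer coefficients. -/
def zint (p : Fin 14 → ℤ) : Matrix (Fin 7) (Fin 7) ℤ := ∑ I, p I • zmat I

/-- The scale between `gen I` and `zmat I`. -/
def scal (I : Fin 14) : ℝ := √(zwt I)

theorem scal_of_lt {I : Fin 14} (h : I < 7) : scal I = 1 := by
  fin_cases I <;> simp [scal, zwt] at h ⊢

theorem scal_of_ge {I : Fin 14} (h : 7 ≤ I) : scal I = √3 := by
  fin_cases I <;> simp [scal, zwt] at h ⊢

theorem castMat_apply (M : Matrix (Fin 7) (Fin 7) ℤ) (i j : Fin 7) : castMat M i j = M i j := rfl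

set_option maxHeartbeats 1000000 in
theorem castMat_zmat (I : Fin 14) : castMat (zmat I) = scal I • gen I := by
  have h3 : √(3 : ℝ) * (√3)⁻¹ = 1 := mul_inv_cancel₀ (by positivity)
  by_cases h : I < 7
  · rw [scal_of_lt h, one_smul]
    fin_cases I <;> first
    | exact absurd h (by decide)
    | simp only [zmat, gen, Fin.reduceFinMk, Matrix.cons_val, castMat, RingHom.mapMatrix_apply]
      ext i j
      fin_cases i <;> fin_cases j <;> simp
  · rw [scal_of_ge (not_lt.1 h)]
    fin_cases I <;> first
    | exact absurd (by decide) h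
    | simp only [zmat, gen, Fin.reduceFinMk, Matrix.cons_val, castMat, RingHom.mapMatrix_apply]
      rw [smul_smul, one_div, h3, one_smul]
      ext i j
      fin_cases i <;> fin_cases j <;> simp

theorem zmat_trace (I J : Fin 14) :
    (zmat I * zmat J).trace = if I = J then -4 * zwt I else 0 := by
  revert I J
  decide +kernel

theorem zmat_transpose (I : Fin 14) : (zmat I).transpose = - zmat I := by
  revert I
  decide +kernel

theorem scal_pos (I : Fin 14) : 0 < scal I := by
  by_cases h : I < 7
  · simp [scal_of_lt h]
  · simp [scal_of_ge (not_lt.1 h)]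

theorem scal_sq (I : Fin 14) : scal I * scal I = zwt I :=
  Real.mul_self_sqrt (by
    have : ∀ I, 0 ≤ zwt I := by decide
    exact_mod_cast this I)

theorem gen_eq_smul_castMat (I : Fin 14) : gen I = (scal I)⁻¹ • castMat (zmat I) := by
  rw [castMat_zmat, smul_smul, inv_mul_cancel₀ (scal_pos I).ne', one_smul]

theorem gen_trace (I J : Fin 14) : (gen I * gen J).trace = if I = J then -4 else 0 := by
  have h := congrArg (Int.cast : ℤ → ℝ) (zmat_trace I J)
  have h2 : ((zmat I * zmat J).trace : ℝ) = (castMat (zmat I) * castMat (zmat J)).trace := by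
    rw [← map_mul]
    simp only [Matrix.trace, Int.cast_sum]
    rfl
  rw [gen_eq_smul_castMat, gen_eq_smul_castMat, smul_mul_smul_comm, Matrix.trace_smul, ← h2, h]
  split_ifs with hIJ
  · subst hIJ
    push_cast
    rw [← scal_sq, smul_eq_mul]
    have := (scal_pos I).ne'
    field_simp
  · simp

theorem gen_transpose (I : Fin 14) : (gen I).transpose = - gen I := by
  have h : ∀ M, (castMat M).transpose = castMat M.transpose := fun _ => rfl
  rw [gen_eq_smul_castMat, Matrix.transpose_smul, h, zmat_transpose, map_neg, smul_neg]

theorem coord_gen (I J : Fin 14) : coord I (gen J) = if I = J then 1 else 0 := by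
  rw [coord, gen_trace]
  split_ifs <;> norm_num

/-- The coordinates of a matrix in the family of generators, as a linear map. -/
def coordL : Mat7 →ₗ[ℝ] (Fin 14 → ℝ) where
  toFun X I := coord I X
  map_add' X Y := by
    ext I
    simp [coord, mul_add]
  map_smul' c X := by
    ext I
    simp [coord]
    ring

theorem coord_add (I : Fin 14) (X Y : Mat7) : coord I (X + Y) = coord I X + coord I Y :=
  congrFun (coordL.map_add X Y) I

theorem coord_smul (I : Fin 14) (c : ℝ) (X : Mat7) : coord I (c • X) = c * coord I X :=
  congrFun (coordL.map_smul c X) I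

theorem coord_sub (I : Fin 14) (X Y : Mat7) : coord I (X - Y) = coord I X - coord I Y :=
  congrFun (coordL.map_sub X Y) I

theorem coord_sum {ι : Type*} (s : Finset ι) (I : Fin 14) (f : ι → Mat7) :
    coord I (∑ k ∈ s, f k) = ∑ k ∈ s, coord I (f k) := by
  have := congrFun (map_sum coordL f s) I
  rwa [Finset.sum_apply] at this

/-! ### Octonions through the dot and cross products; the generators as a basis. -/

/-- The cross product of imaginary octonions. -/
def cross {R : Type*} [CommRing R] (v w : Fin 7 → R) : Fin 7 → R :=
  ![(v 1 * w 2 - v 2 * w 1) + (v 3 * w 4 - v 4 * w 3) - (v 5 * w 6 - v 6 * w 5),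
    -(v 0 * w 2 - v 2 * w 0) + (v 3 * w 5 - v 5 * w 3) + (v 4 * w 6 - v 6 * w 4),
    (v 0 * w 1 - v 1 * w 0) + (v 3 * w 6 - v 6 * w 3) - (v 4 * w 5 - v 5 * w 4),
    -(v 0 * w 4 - v 4 * w 0) - (v 1 * w 5 - v 5 * w 1) - (v 2 * w 6 - v 6 * w 2),
    (v 0 * w 3 - v 3 * w 0) - (v 1 * w 6 - v 6 * w 1) + (v 2 * w 5 - v 5 * w 2),
    (v 0 * w 6 - v 6 * w 0) + (v 1 * w 3 - v 3 * w 1) - (v 2 * w 4 - v 4 * w 2),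
    -(v 0 * w 5 - v 5 * w 0) + (v 1 * w 4 - v 4 * w 1) + (v 2 * w 3 - v 3 * w 2)]

/-- `cross` makes sense over any commutative ring so that its identities can be decided over `ℤ` on
basis vectors and then carried to `ℝ` by this lemma. -/
theorem cross_map {R S : Type*} [CommRing R] [CommRing S] (f : R →+* S) (v w : Fin 7 → R) :
    cross (f ∘ v) (f ∘ w) = f ∘ cross v w := by
  ext c
  fin_cases c <;> simp [cross]

theorem zmat_cross (I : Fin 14) (a b : Fin 7) :
    (zmat I).mulVec (cross (Pi.single a 1) (Pi.single b 1)) =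
      cross ((zmat I).mulVec (Pi.single a 1)) (Pi.single b 1) +
        cross (Pi.single a 1) ((zmat I).mulVec (Pi.single b 1)) := by
  revert I a b
  decide +kernel

/-- The cross product of imaginary octonions, as a bilinear map. -/
def crossL : (Fin 7 → ℝ) →ₗ[ℝ] (Fin 7 → ℝ) →ₗ[ℝ] (Fin 7 → ℝ) :=
  LinearMap.mk₂ ℝ cross
    (fun v v' w => by ext c; fin_cases c <;> simp [cross] <;> ring)
    (fun r v w => by ext c; fin_cases c <;> simp [cross] <;> ring)
    (fun v w w' => by ext c; fin_cases c <;> simp [cross] <;> ring)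
    (fun r v w => by ext c; fin_cases c <;> simp [cross] <;> ring)

theorem castMat_zmat_cross (I : Fin 14) (v w : Fin 7 → ℝ) :
    (castMat (zmat I)).mulVec (cross v w) =
      cross ((castMat (zmat I)).mulVec v) w + cross v ((castMat (zmat I)).mulVec w) := by
  have h : crossL.compr₂ (castMat (zmat I)).mulVecLin =
      crossL.comp (castMat (zmat I)).mulVecLin +
        (crossL.compl₂ (castMat (zmat I)).mulVecLin) := by
    refine LinearMap.pi_ext' fun a => LinearMap.ext_ring (LinearMap.pi_ext' fun b =>
      LinearMap.ext_ring ?_)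
    have hs : ∀ a : Fin 7, (Pi.single a 1 : Fin 7 → ℝ) =
        (Int.castRingHom ℝ) ∘ (Pi.single a 1 : Fin 7 → ℤ) := fun a => by
      ext i
      simp [Pi.single_apply, apply_ite]
    have hm : ∀ u : Fin 7 → ℤ, (castMat (zmat I)).mulVec (Int.castRingHom ℝ ∘ u) =
        Int.castRingHom ℝ ∘ (zmat I).mulVec u := fun u => by
      ext i
      exact (RingHom.map_mulVec _ _ _ _).symm
    change (castMat (zmat I)).mulVec (cross (Pi.single a 1) (Pi.single b 1)) =
      cross ((castMat (zmat I)).mulVec (Pi.single a 1)) (Pi.single b 1) +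
        cross (Pi.single a 1) ((castMat (zmat I)).mulVec (Pi.single b 1))
    rw [hs a, hs b, cross_map, hm, hm, hm, cross_map, cross_map, zmat_cross]
    ext i
    simp
  exact congrFun (congrArg DFunLike.coe (congrFun (congrArg DFunLike.coe h) v)) w

/-- From here on quaternion arithmetic is no longer needed: conditions on the octonion product
become conditions on the dot and cross products of `ℝ⁷`. -/
theorem octMul_octOf (r s : ℝ) (v w : Fin 7 → ℝ) :
    octMul (octOf r v) (octOf s w) = octOf (r * s - v ⬝ᵥ w) (r • w + s • v + cross v w) := by
  have h (a b c d : ℍ[ℝ]) : octMul (a, b) (c, d) =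
      (⟨a.re * c.re - a.imI * c.imI - a.imJ * c.imJ - a.imK * c.imK -
          (d.re * b.re + d.imI * b.imI + d.imJ * b.imJ + d.imK * b.imK),
        a.re * c.imI + a.imI * c.re + a.imJ * c.imK - a.imK * c.imJ -
          (d.re * b.imI - d.imI * b.re - d.imJ * b.imK + d.imK * b.imJ),
        a.re * c.imJ - a.imI * c.imK + a.imJ * c.re + a.imK * c.imI -
          (d.re * b.imJ + d.imI * b.imK - d.imJ * b.re - d.imK * b.imI),
        a.re * c.imK + a.imI * c.imJ - a.imJ * c.imI + a.imK * c.re -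
          (d.re * b.imK - d.imI * b.imJ + d.imJ * b.imI - d.imK * b.re)⟩,
       ⟨d.re * a.re - d.imI * a.imI - d.imJ * a.imJ - d.imK * a.imK +
          (b.re * c.re + b.imI * c.imI + b.imJ * c.imJ + b.imK * c.imK),
        d.re * a.imI + d.imI * a.re + d.imJ * a.imK - d.imK * a.imJ +
          (-b.re * c.imI + b.imI * c.re - b.imJ * c.imK + b.imK * c.imJ),
        d.re * a.imJ - d.imI * a.imK + d.imJ * a.re + d.imK * a.imI +
          (-b.re * c.imJ + b.imI * c.imK + b.imJ * c.re - b.imK * c.imI),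
        d.re * a.imK + d.imI * a.imJ - d.imJ * a.imI + d.imK * a.re +
          (-b.re * c.imK - b.imI * c.imJ + b.imJ * c.imI + b.imK * c.re)⟩) := by
    refine Prod.ext ?_ ?_ <;> refine QuaternionAlgebra.ext ?_ ?_ ?_ ?_ <;>
    · simp [octMul, Quaternion.re_mul, Quaternion.imI_mul, Quaternion.imJ_mul,
        Quaternion.imK_mul]
      try ring
  refine (h _ _ _ _).trans ?_
  refine Prod.ext ?_ ?_ <;> refine QuaternionAlgebra.ext ?_ ?_ ?_ ?_ <;>
  · simp [octOf, cross, dotProduct, Fin.sum_univ_seven]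
    ring

theorem octDer_octOf (D : Mat7) (r : ℝ) (v : Fin 7 → ℝ) :
    octDer D (octOf r v) = octOf 0 (D.mulVec v) := by
  simp only [octDer, octIm_octOf]

theorem octOf_re (r : ℝ) (v : Fin 7 → ℝ) : (octOf r v).1.re = r := rfl

theorem octAut_octOf (A : Mat7) (r : ℝ) (v : Fin 7 → ℝ) :
    octAut A (octOf r v) = octOf r (A.mulVec v) := by
  simp only [octAut, octIm_octOf, octOf_re]

theorem octOf_inj {r s : ℝ} {v w : Fin 7 → ℝ} : octOf r v = octOf s w ↔ r = s ∧ v = w := by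
  refine ⟨fun h => ⟨congrArg (fun x : Oct => x.1.re) h, ?_⟩, fun h => by rw [h.1, h.2]⟩
  simpa only [octIm_octOf] using congrArg octIm h

theorem octOf_add' (r s : ℝ) (v w : Fin 7 → ℝ) :
    octOf r v + octOf s w = octOf (r + s) (v + w) := by
  refine Prod.ext ?_ ?_ <;> refine QuaternionAlgebra.ext ?_ ?_ ?_ ?_ <;> rfl

theorem mem_g2Lie_iff {D : Mat7} : D ∈ g2Lie ↔
    (∀ v w, D.mulVec v ⬝ᵥ w + v ⬝ᵥ D.mulVec w = 0) ∧
    ∀ v w, D.mulVec (cross v w) = cross (D.mulVec v) w + cross v (D.mulVec w) := by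
  constructor
  · intro h
    have key : ∀ v w, octDer D (octMul (octOf 0 v) (octOf 0 w)) =
        octMul (octDer D (octOf 0 v)) (octOf 0 w) + octMul (octOf 0 v) (octDer D (octOf 0 w)) :=
      fun v w => h _ _
    simp only [octMul_octOf, octDer_octOf, octOf_add', octOf_inj, zero_smul, zero_add] at key
    refine ⟨fun v w => ?_, fun v w => (key v w).2⟩
    have := (key v w).1
    linarith
  · rintro ⟨h1, h2⟩ x y
    rw [← octOf_octIm x, ← octOf_octIm y]
    simp only [octMul_octOf, octDer_octOf, octOf_add', octOf_inj]
    refine ⟨?_, ?_⟩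
    · have := h1 (octIm x) (octIm y)
      linarith
    · rw [Matrix.mulVec_add, Matrix.mulVec_add, Matrix.mulVec_smul, Matrix.mulVec_smul, h2]
      simp only [zero_smul]
      abel

theorem skew_of_mem_g2Lie {D : Mat7} (h : D ∈ g2Lie) (i j : Fin 7) : D i j = - D j i := by
  have := (mem_g2Lie_iff.1 h).1 (Pi.single i 1) (Pi.single j 1)
  simp at this
  linarith

/-- The 21 entries of a skew matrix split into seven triples, two pairs of indices being together
when the corresponding units have the same product up to sign. On each triple, one component of the
derivation identity and two of the vanishing coordinates form an invertible system. This is what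
bounds the dimension of the Lie algebra by 14. -/
theorem eq_zero_of_coord_eq_zero {D : Mat7} (h : D ∈ g2Lie) (h0 : ∀ I, coord I D = 0) :
    D = 0 := by
  have hs := skew_of_mem_g2Lie h
  have hc : ∀ I, (castMat (zmat I) * D).trace = 0 := by
    intro I
    have h1 := h0 I
    rw [coord] at h1
    rw [castMat_zmat, Matrix.smul_mul, Matrix.trace_smul]
    have : (gen I * D).trace = 0 := by linarith
    simp [this]
  have h2 := fun a b => (mem_g2Lie_iff.1 h).2 (Pi.single a 1) (Pi.single b 1)
  have e1 := congrFun (h2 0 1) 3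
  have e2 := congrFun (h2 0 1) 4
  have e3 := congrFun (h2 0 1) 5
  have e4 := congrFun (h2 0 1) 6
  have e5 := congrFun (h2 0 3) 5
  have e6 := congrFun (h2 0 3) 6
  have e7 := congrFun (h2 1 3) 6
  simp [cross, Matrix.mulVec, dotProduct, Fin.sum_univ_seven, Pi.single_apply] at e1 e2 e3 e4 e5 e6 e7
  have c := fun I => hc I
  simp only [Matrix.trace, Matrix.diag_apply, Matrix.mul_apply, Fin.sum_univ_seven,
    castMat_apply] at c
  have c0 := c 0
  have c1 := c 1
  have c2 := c 2
  have c3 := c 3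
  have c4 := c 4
  have c5 := c 5
  have c6 := c 6
  have c7 := c 7
  have c8 := c 8
  have c9 := c 9
  have c10 := c 10
  have c11 := c 11
  have c12 := c 12
  have c13 := c 13
  simp [zmat] at c0 c1 c2 c3 c4 c5 c6 c7 c8 c9 c10 c11 c12 c13
  have s01 := hs 0 1
  have s02 := hs 0 2
  have s03 := hs 0 3
  have s04 := hs 0 4
  have s05 := hs 0 5
  have s06 := hs 0 6
  have s12 := hs 1 2
  have s13 := hs 1 3
  have s14 := hs 1 4
  have s15 := hs 1 5
  have s16 := hs 1 6
  have s23 := hs 2 3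
  have s24 := hs 2 4
  have s25 := hs 2 5
  have s26 := hs 2 6
  have s34 := hs 3 4
  have s35 := hs 3 5
  have s36 := hs 3 6
  have s45 := hs 4 5
  have s46 := hs 4 6
  have s56 := hs 5 6
  have d0 : D 0 0 = 0 := by linarith [hs 0 0]
  have d1 : D 1 1 = 0 := by linarith [hs 1 1]
  have d2 : D 2 2 = 0 := by linarith [hs 2 2]
  have d3 : D 3 3 = 0 := by linarith [hs 3 3]
  have d4 : D 4 4 = 0 := by linarith [hs 4 4]
  have d5 : D 5 5 = 0 := by linarith [hs 5 5]
  have d6 : D 6 6 = 0 := by linarith [hs 6 6]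
  have z50 : D 5 0 = 0 := by linarith only [e1, s05, s14, s23, c12]
  have z41 : D 4 1 = 0 := by linarith only [e1, s05, s14, s23, c5, c12]
  have z32 : D 3 2 = 0 := by linarith only [e1, s05, s14, s23, c5, c12]
  have z60 : D 6 0 = 0 := by linarith only [e2, s06, s13, s24, c13]
  have z31 : D 3 1 = 0 := by linarith only [e2, s06, s13, s24, c6, c13]
  have z42 : D 4 2 = 0 := by linarith only [e2, s06, s13, s24, c6, c13]
  have z30 : D 3 0 = 0 := by linarith only [e3, s03, s16, s25, c10]
  have z61 : D 6 1 = 0 := by linarith only [e3, s03, s16, s25, c3, c10]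
  have z52 : D 5 2 = 0 := by linarith only [e3, s03, s16, s25, c3, c10]
  have z40 : D 4 0 = 0 := by linarith only [e4, s04, s15, s26, c11]
  have z51 : D 5 1 = 0 := by linarith only [e4, s04, s15, s26, c4, c11]
  have z62 : D 6 2 = 0 := by linarith only [e4, s04, s15, s26, c4, c11]
  have z10 : D 1 0 = 0 := by linarith only [e5, s01, s36, s45, c8]
  have z63 : D 6 3 = 0 := by linarith only [e5, s01, s36, s45, c0, c8]
  have z54 : D 5 4 = 0 := by linarith only [e5, s01, s36, s45, c0, c8]
  have z20 : D 2 0 = 0 := by linarith only [e6, s02, s35, s46, c9]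
  have z53 : D 5 3 = 0 := by linarith only [e6, s02, s35, s46, c1, c9]
  have z64 : D 6 4 = 0 := by linarith only [e6, s02, s35, s46, c1, c9]
  have z21 : D 2 1 = 0 := by linarith only [e7, s12, s34, s56, c7]
  have z43 : D 4 3 = 0 := by linarith only [e7, s12, s34, s56, c2, c7]
  have z65 : D 6 5 = 0 := by linarith only [e7, s12, s34, s56, c2, c7]
  ext i j
  rw [Matrix.zero_apply]
  fin_cases i <;> fin_cases j <;> first
  | assumption
  | exact (hs _ _).trans (neg_eq_zero.2 (by assumption))

theorem gen_mem_g2Lie (I : Fin 14) : gen I ∈ g2Lie := by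
  have hz : castMat (zmat I) ∈ g2Lie := by
    refine mem_g2Lie_iff.2 ⟨fun v w => ?_, ?_⟩
    · have h : (castMat (zmat I)).transpose = - castMat (zmat I) := by
        rw [castMat_zmat, Matrix.transpose_smul, gen_transpose, smul_neg]
      rw [Matrix.dotProduct_mulVec, ← Matrix.mulVec_transpose, h, Matrix.neg_mulVec,
        neg_dotProduct, add_neg_cancel]
    · exact castMat_zmat_cross I
  rw [gen_eq_smul_castMat]
  exact g2Lie.smul_mem _ hz

theorem eq_sum_coord {D : Mat7} (h : D ∈ g2Lie) : D = ∑ I, coord I D • gen I := by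
  rw [← sub_eq_zero]
  refine eq_zero_of_coord_eq_zero (sub_mem h (sum_mem fun I _ => ?_)) fun I => ?_
  · exact g2Lie.smul_mem _ (gen_mem_g2Lie I)
  · rw [coord_sub, coord_sum]
    simp [coord_smul, coord_gen]

/-! ### Casimir identities and the Killing form. -/

theorem zmat_sum_sq : ∑ K, (if K < 7 then (3 : ℤ) else 1) • (zmat K * zmat K) = (-24 : ℤ) • 1 := by
  decide +kernel

theorem zmat_sum_conj (J : Fin 14) :
    ∑ K, (if K < 7 then (3 : ℤ) else 1) • (zmat K * zmat J * zmat K) = 0 := by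
  revert J
  decide +kernel

/-- The inverse square norms are `1` and `1/3`; taking out `1/3` leaves the integer weights `3` and
`1` of the decided identities. -/
theorem zwt_inv (K : Fin 14) : ((scal K)⁻¹ * (scal K)⁻¹) =
    (1 / 3 : ℝ) * ((if K < 7 then (3 : ℤ) else 1 : ℤ) : ℝ) := by
  split_ifs with h
  · simp [scal_of_lt h]
  · rw [← mul_inv, scal_of_ge (not_lt.1 h), Real.mul_self_sqrt (by norm_num)]
    norm_num

/-- The Casimir element is scalar on the seven-dimensional representation; the trace fixes the
scalar, since `14 · (-4) = 7 · (-8)`. -/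
theorem gen_sum_sq : ∑ K, gen K * gen K = (-8 : ℝ) • (1 : Mat7) := by
  have h := congrArg castMat zmat_sum_sq
  simp only [map_sum, map_zsmul, map_mul, map_one] at h
  have h2 : ∀ K, gen K * gen K = (1 / 3 : ℝ) •
      ((if K < 7 then (3 : ℤ) else 1) • (castMat (zmat K) * castMat (zmat K))) := by
    intro K
    rw [gen_eq_smul_castMat, smul_mul_smul_comm, zwt_inv, ← smul_smul, Int.cast_smul_eq_zsmul]
  rw [Finset.sum_congr rfl fun K _ => h2 K, ← Finset.smul_sum, h, ← Int.cast_smul_eq_zsmul ℝ,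
    smul_smul]
  norm_num

theorem gen_sum_conj (J : Fin 14) : ∑ K, gen K * gen J * gen K = 0 := by
  have h := congrArg castMat (zmat_sum_conj J)
  simp only [map_sum, map_zsmul, map_mul, map_zero] at h
  have h2 : ∀ K, gen K * gen J * gen K = ((1 / 3 : ℝ) * (scal J)⁻¹) •
      ((if K < 7 then (3 : ℤ) else 1) •
        (castMat (zmat K) * castMat (zmat J) * castMat (zmat K))) := by
    intro K
    rw [gen_eq_smul_castMat, gen_eq_smul_castMat J, smul_mul_smul_comm, smul_mul_smul_comm,
      mul_right_comm, zwt_inv, mul_right_comm, ← smul_smul _ _ (castMat _ * _ * _),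
      Int.cast_smul_eq_zsmul]
  rw [Finset.sum_congr rfl fun K _ => h2 K, ← Finset.smul_sum, h, smul_zero]

/-- The left side is the trace of `ad ∘ ad`. In the expanded double commutator, cyclicity of the
trace turns two terms into Casimir sums and the other two into sums that vanish by `gen_sum_conj`;
the factor is `-(1/4) · 2 · (-8)`. -/
theorem sum_coord_lie_lie (I J : Fin 14) :
    ∑ K, coord K (⁅gen I, ⁅gen J, gen K⁆⁆) = 4 * (gen I * gen J).trace := by
  have h1 : ∀ K, (gen K * ⁅gen I, ⁅gen J, gen K⁆⁆).trace =
      (gen K * gen K * (gen I * gen J)).trace + (gen K * gen K * (gen J * gen I)).trace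
        - (gen K * gen I * gen K * gen J).trace - (gen K * gen J * gen K * gen I).trace := by
    intro K
    have e : gen K * ⁅gen I, ⁅gen J, gen K⁆⁆ =
      gen K * (gen I * gen J * gen K) + gen K * gen K * (gen J * gen I)
        - gen K * gen I * gen K * gen J - gen K * gen J * gen K * gen I := by
      simp only [Ring.lie_def]
      noncomm_ring
    rw [e, Matrix.trace_sub, Matrix.trace_sub, Matrix.trace_add,
      Matrix.trace_mul_comm (gen K) (gen I * gen J * gen K), Matrix.mul_assoc (gen I * gen J),
      Matrix.trace_mul_comm (gen I * gen J)]
  simp only [coord, h1, ← Finset.mul_sum, Finset.sum_add_distrib, Finset.sum_sub_distrib,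
    ← Matrix.trace_sum, ← Finset.sum_mul, gen_sum_sq, gen_sum_conj]
  rw [Matrix.smul_mul, Matrix.smul_mul, one_mul, one_mul, Matrix.trace_smul, Matrix.trace_smul,
    Matrix.trace_mul_comm (gen J)]
  simp
  ring

/-- The generators, as a basis of the Lie algebra. -/
def genBasis : Module.Basis (Fin 14) ℝ g2Lie :=
  Module.Basis.ofEquivFun
    { toFun := fun X I => coord I X
      map_add' := fun X Y => by
        ext I
        exact coord_add I X Y
      map_smul' := fun c X => by
        ext I
        exact coord_smul I c X
      invFun := fun c => ∑ I, c I • (⟨gen I, gen_mem_g2Lie I⟩ : g2Lie)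
      left_inv := fun X => by
        apply Subtype.ext
        conv_rhs => rw [eq_sum_coord X.2]
        simp
      right_inv := fun c => by
        ext I
        simp [coord_sum, coord_smul, coord_gen] }

theorem genBasis_coe (I : Fin 14) : (genBasis I : Mat7) = gen I := by
  simp [genBasis, Pi.single_apply]

theorem genBasis_repr (X : g2Lie) (I : Fin 14) : genBasis.repr X I = coord I X := rfl

theorem killingForm_genBasis (I J : Fin 14) :
    -(1 / 16 : ℝ) * killingForm ℝ g2Lie (genBasis I) (genBasis J) = if I = J then 1 else 0 := by
  have h : killingForm ℝ g2Lie (genBasis I) (genBasis J) = 4 * (gen I * gen J).trace := by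
    rw [killingForm_apply_apply, LinearMap.trace_eq_matrix_trace ℝ genBasis,
      ← sum_coord_lie_lie, Matrix.trace]
    refine Finset.sum_congr rfl fun K _ => ?_
    rw [Matrix.diag_apply, LinearMap.toMatrix_apply, genBasis_repr]
    simp [genBasis_coe]
  rw [h, gen_trace]
  split_ifs <;> norm_num

/-! ### Automorphisms and their tangent vectors. -/

/-- The matrices of automorphisms of the octonions, in terms of the cross product. -/
def IsAut (A : Mat7) : Prop :=
  (∀ v w, A.mulVec v ⬝ᵥ A.mulVec w = v ⬝ᵥ w) ∧
    ∀ v w, A.mulVec (cross v w) = cross (A.mulVec v) (A.mulVec w)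

namespace IsAut

variable {A B : Mat7}

theorem transpose_mul (h : IsAut A) : A.transpose * A = 1 := by
  ext i j
  have := h.1 (Pi.single i 1) (Pi.single j 1)
  rw [Matrix.mulVec_single_one, Matrix.mulVec_single_one, single_one_dotProduct] at this
  rw [Matrix.mul_apply, Matrix.one_apply]
  refine Eq.trans ?_ (this.trans ?_)
  · rfl
  · rw [Pi.single_apply]

theorem mul_transpose (h : IsAut A) : A * A.transpose = 1 :=
  mul_eq_one_comm.1 h.transpose_mul

theorem inv_eq (h : IsAut A) : A⁻¹ = A.transpose :=
  Matrix.inv_eq_left_inv h.transpose_mul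

theorem inv_mul (h : IsAut A) : A⁻¹ * A = 1 := by
  rw [h.inv_eq, h.transpose_mul]

theorem mul_inv (h : IsAut A) : A * A⁻¹ = 1 := by
  rw [h.inv_eq, h.mul_transpose]

theorem mulVec_inv (h : IsAut A) (v : Fin 7 → ℝ) : A.mulVec (A⁻¹.mulVec v) = v := by
  rw [Matrix.mulVec_mulVec, h.mul_inv, Matrix.one_mulVec]

theorem inv_mulVec (h : IsAut A) (v : Fin 7 → ℝ) : A⁻¹.mulVec (A.mulVec v) = v := by
  rw [Matrix.mulVec_mulVec, h.inv_mul, Matrix.one_mulVec]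

theorem mul (hA : IsAut A) (hB : IsAut B) : IsAut (A * B) := by
  simp only [IsAut, ← Matrix.mulVec_mulVec]
  exact ⟨fun v w => by rw [hA.1, hB.1], fun v w => by rw [hB.2, hA.2]⟩

theorem inv (h : IsAut A) : IsAut A⁻¹ := by
  refine ⟨fun v w => ?_, fun v w => ?_⟩
  · rw [← h.1, h.mulVec_inv, h.mulVec_inv]
  · rw [← h.inv_mulVec (cross (A⁻¹.mulVec v) _), h.2, h.mulVec_inv, h.mulVec_inv]

theorem iff_forall : IsAut A ↔
    ∀ x y : Oct, octAut A (octMul x y) = octMul (octAut A x) (octAut A y) := by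
  constructor
  · rintro ⟨h1, h2⟩ x y
    rw [← octOf_octIm x, ← octOf_octIm y]
    simp only [octMul_octOf, octAut_octOf, h1, Matrix.mulVec_add, Matrix.mulVec_smul, h2]
  · intro h
    have key := fun v w => h (octOf 0 v) (octOf 0 w)
    simp only [octMul_octOf, octAut_octOf, octOf_inj, zero_smul, zero_add] at key
    refine ⟨fun v w => ?_, fun v w => (key v w).2⟩
    have := (key v w).1
    linarith

theorem mat (x : G2) : IsAut (G2.mat x) := iff_forall.2 x.2

theorem exists_mat (h : IsAut A) : ∃ x : G2, G2.mat x = A :=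
  ⟨⟨⟨A, A⁻¹, h.mul_inv, h.inv_mul⟩, iff_forall.1 h⟩, rfl⟩

theorem iff_exists : IsAut A ↔ ∃ x : G2, G2.mat x = A :=
  ⟨exists_mat, fun ⟨x, hx⟩ => hx ▸ mat x⟩

/-- The first-order variation of a family of automorphisms is a derivation. -/
theorem inv_mul_mem (h : IsAut A)
    (h1 : ∀ v w, B.mulVec v ⬝ᵥ A.mulVec w + A.mulVec v ⬝ᵥ B.mulVec w = 0)
    (h2 : ∀ v w, B.mulVec (cross v w) =
      cross (B.mulVec v) (A.mulVec w) + cross (A.mulVec v) (B.mulVec w)) :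
    A⁻¹ * B ∈ g2Lie := by
  refine mem_g2Lie_iff.2 ⟨fun v w => ?_, fun v w => ?_⟩
  · rw [← h.1, ← h.1 v, ← Matrix.mulVec_mulVec, ← Matrix.mulVec_mulVec, h.mulVec_inv,
      h.mulVec_inv, h1]
  · simp only [← Matrix.mulVec_mulVec]
    rw [h2, Matrix.mulVec_add, h.inv.2, h.inv.2, h.inv_mulVec, h.inv_mulVec]

theorem conj_mem (h : IsAut A) (hB : B ∈ g2Lie) : A⁻¹ * B * A ∈ g2Lie := by
  rw [Matrix.mul_assoc]
  obtain ⟨h1, h2⟩ := mem_g2Lie_iff.1 hB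
  refine h.inv_mul_mem (fun v w => ?_) fun v w => ?_
  · rw [← Matrix.mulVec_mulVec, ← Matrix.mulVec_mulVec, h1]
  · simp only [← Matrix.mulVec_mulVec]
    rw [h.2, h2]

theorem inv_inv (h : IsAut A) : A⁻¹⁻¹ = A := by
  rw [h.inv.inv_eq, h.inv_eq, Matrix.transpose_transpose]

end IsAut

/-- The cross product, as a continuous bilinear map. -/
def crossC : (Fin 7 → ℝ) →L[ℝ] (Fin 7 → ℝ) →L[ℝ] (Fin 7 → ℝ) := crossL.toContinuousBilinearMap

theorem hasDerivAt_cross {a b : ℝ → Fin 7 → ℝ} {a' b' : Fin 7 → ℝ} {t : ℝ}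
    (ha : HasDerivAt a a' t) (hb : HasDerivAt b b' t) :
    HasDerivAt (fun s => cross (a s) (b s)) (cross a' (b t) + cross (a t) b') t :=
  (crossC.hasFDerivAt.comp_hasDerivAt t ha).clm_apply hb

theorem hasDerivAt_dotProduct {a b : ℝ → Fin 7 → ℝ} {a' b' : Fin 7 → ℝ} {t : ℝ}
    (ha : HasDerivAt a a' t) (hb : HasDerivAt b b' t) :
    HasDerivAt (fun s => a s ⬝ᵥ b s) (a' ⬝ᵥ b t + a t ⬝ᵥ b') t := by
  have := HasDerivAt.fun_sum (u := Finset.univ)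
    (fun i _ => (hasDerivAt_pi.1 ha i).mul (hasDerivAt_pi.1 hb i))
  simp only [dotProduct, ← Finset.sum_add_distrib]
  exact this

theorem hasDerivAt_mulVec {A : ℝ → Mat7} {A' : Mat7} {t : ℝ}
    (hA : ∀ i j, HasDerivAt (fun s => A s i j) (A' i j) t) {b : ℝ → Fin 7 → ℝ} {b' : Fin 7 → ℝ}
    (hb : HasDerivAt b b' t) :
    HasDerivAt (fun s => (A s).mulVec (b s)) (A'.mulVec (b t) + (A t).mulVec b') t :=
  hasDerivAt_pi.2 fun i => hasDerivAt_dotProduct (hasDerivAt_pi.2 (hA i)) hb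

/-- The derivative of a curve of automorphisms is a tangent vector. -/
theorem IsAut.inv_mul_mem_of_hasDerivAt {A : ℝ → Mat7} {A' : Mat7} {t : ℝ}
    (h : ∀ᶠ s in nhds t, IsAut (A s))
    (hA : ∀ i j, HasDerivAt (fun s => A s i j) (A' i j) t) : (A t)⁻¹ * A' ∈ g2Lie := by
  have hv : ∀ v, HasDerivAt (fun s => (A s).mulVec v) (A'.mulVec v) t := fun v => by
    simpa using hasDerivAt_mulVec hA (hasDerivAt_const t v)
  refine h.self_of_nhds.inv_mul_mem (fun v w => ?_) fun v w => ?_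
  · have h1 := hasDerivAt_dotProduct (hv v) (hv w)
    -- The dot product of the images is constant near `t`, so its derivative by the product rule is
    -- zero.
    refine h1.unique ((hasDerivAt_const t (v ⬝ᵥ w)).congr_of_eventuallyEq ?_)
    filter_upwards [h] with s hs using hs.1 v w
  · refine (hv (cross v w)).unique ((hasDerivAt_cross (hv v) (hv w)).congr_of_eventuallyEq ?_)
    filter_upwards [h] with s hs using hs.2 v w

/-! ### Derivatives of exponentials and conjugation by them. -/

section

attribute [local instance] Matrix.linftyOpNormedRing Matrix.linftyOpNormedAlgebra

theorem hasDerivAt_exp_smul_left (X : Mat7) (t : ℝ) :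
    HasDerivAt (fun s : ℝ => NormedSpace.exp (s • X)) (X * NormedSpace.exp (t • X)) t :=
  hasDerivAt_exp_smul_const' X t

theorem hasDerivAt_matMul {A B : ℝ → Mat7} {A' B' : Mat7} {t : ℝ}
    (hA : HasDerivAt A A' t) (hB : HasDerivAt B B' t) :
    HasDerivAt (fun s => A s * B s) (A' * B t + A t * B') t :=
  hA.mul hB

/-- Links the derivative of the exponential, obtained in a Banach algebra norm, to the entrywise
derivatives used in `pderiv`. -/
theorem hasDerivAt_mat_iff {A : ℝ → Mat7} {A' : Mat7} {t : ℝ} :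
    HasDerivAt A A' t ↔ ∀ i j, HasDerivAt (fun s => A s i j) (A' i j) t := by
  refine Iff.trans ?_ (hasDerivAt_pi (φ := A) (φ' := A'))|>.trans (forall_congr' fun i => hasDerivAt_pi)
  rfl

theorem mat_eq_of_deriv_eq_zero {A : ℝ → Mat7} (h : ∀ t, HasDerivAt A 0 t) (s t : ℝ) :
    A s = A t :=
  is_const_of_deriv_eq_zero (fun t => (h t).differentiableAt) (fun t => (h t).deriv) s t

end

theorem exp_neg_mul_exp (X : Mat7) : NormedSpace.exp (-X) * NormedSpace.exp X = 1 := by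
  rw [← Matrix.exp_add_of_commute _ _ (Commute.neg_left (Commute.refl X)), neg_add_cancel,
    NormedSpace.exp_zero]

theorem exp_mul_exp_neg (X : Mat7) : NormedSpace.exp X * NormedSpace.exp (-X) = 1 := by
  simpa using exp_neg_mul_exp (-X)

theorem inv_exp (X : Mat7) : (NormedSpace.exp X)⁻¹ = NormedSpace.exp (-X) :=
  Matrix.inv_eq_left_inv (exp_neg_mul_exp X)

theorem exp_comm (X : Mat7) (t : ℝ) :
    X * NormedSpace.exp (t • X) = NormedSpace.exp (t • X) * X := by
  have : Commute X (t • X) := (Commute.refl X).smul_right t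
  exact this.exp_right

theorem hasDerivAt_exp_neg_smul (X : Mat7) (t : ℝ) :
    HasDerivAt (fun s : ℝ => NormedSpace.exp (-(s • X))) (-(NormedSpace.exp (-(t • X)) * X)) t := by
  have := hasDerivAt_exp_smul_left (-X) t
  simpa [exp_comm X (-t), ← neg_smul, neg_mul] using this

/-- A pair rotated by `ad H` is rotated by conjugation with `exp H`. -/
theorem conj_exp_of_lie {H Y V : Mat7} {m : ℝ} (hY : H * Y - Y * H = m • V)
    (hV : H * V - V * H = -(m • Y)) :
    NormedSpace.exp (-H) * Y * NormedSpace.exp H = Real.cos m • Y - Real.sin m • V := by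
  -- Rotating the pair by the angle `s m` and conjugating back with `exp (s H)` undo each other, so
  -- this curve is constant; its values at `0` and `1` give the claim.
  have h : ∀ t : ℝ, HasDerivAt (fun s : ℝ => NormedSpace.exp (s • H) *
      (Real.cos (s * m) • Y - Real.sin (s * m) • V) * NormedSpace.exp (-(s • H))) 0 t := by
    intro t
    have hc : HasDerivAt (fun s : ℝ => Real.cos (s * m) • Y - Real.sin (s * m) • V)
        ((-Real.sin (t * m) * m) • Y - (Real.cos (t * m) * m) • V) t := by
      have h1 : HasDerivAt (fun s : ℝ => s * m) m t := by simpa using (hasDerivAt_id t).mul_const m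
      rw [hasDerivAt_mat_iff]
      intro i j
      exact (h1.cos.mul_const (Y i j)).sub (h1.sin.mul_const (V i j))
    have := hasDerivAt_matMul (hasDerivAt_matMul (hasDerivAt_exp_smul_left H t) hc)
      (hasDerivAt_exp_neg_smul H t)
    convert this using 1
    rw [exp_comm]
    set E := NormedSpace.exp (t • H)
    set F := NormedSpace.exp (-(t • H))
    have e : E * H * (Real.cos (t * m) • Y - Real.sin (t * m) • V) +
        E * ((-Real.sin (t * m) * m) • Y - (Real.cos (t * m) * m) • V) =
        E * (Real.cos (t * m) • Y - Real.sin (t * m) • V) * H := by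
      have e1 : H * (Real.cos (t * m) • Y - Real.sin (t * m) • V) +
        ((-Real.sin (t * m) * m) • Y - (Real.cos (t * m) * m) • V) =
          (Real.cos (t * m) • Y - Real.sin (t * m) • V) * H := by
        have hY' : H * Y = Y * H + m • V := by rw [← hY]; abel
        have hV' : H * V = V * H - m • Y := by rw [sub_eq_add_neg, ← hV]; abel
        simp only [Matrix.mul_sub, Matrix.sub_mul, Matrix.mul_smul, Matrix.smul_mul, hY', hV']
        module
      rw [Matrix.mul_assoc, ← Matrix.mul_add, e1, Matrix.mul_assoc]
    rw [e, Matrix.mul_neg, ← Matrix.mul_assoc, ← sub_eq_add_neg, eq_comm, sub_eq_zero]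
    have : H * F = F * H := by
      simpa [E, F] using exp_comm H (-t)
    rw [Matrix.mul_assoc, this, Matrix.mul_assoc, Matrix.mul_assoc, Matrix.mul_assoc]
  have h2 := mat_eq_of_deriv_eq_zero h 0 1
  simp only [zero_smul, NormedSpace.exp_zero, zero_mul, Real.cos_zero, Real.sin_zero, one_smul,
    sub_zero, neg_zero, one_mul, mul_one] at h2
  conv_lhs => rw [h2]
  simp only [Matrix.mul_assoc]
  rw [exp_neg_mul_exp, ← Matrix.mul_assoc, exp_neg_mul_exp, Matrix.one_mul, Matrix.mul_one]

/-- Skewness makes the exponential orthogonal. For the cross product, the derivation property makes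
`exp(-sX)` applied to `exp(sX) v × exp(sX) w` constant in `s`. -/
theorem isAut_exp {X : Mat7} (h : X ∈ g2Lie) : IsAut (NormedSpace.exp X) := by
  have hX : X.transpose = -X := by
    ext i j
    exact skew_of_mem_g2Lie h j i
  refine ⟨fun v w => ?_, fun v w => ?_⟩
  · rw [Matrix.dotProduct_mulVec, Matrix.vecMul_mulVec, ← Matrix.exp_transpose, hX,
      exp_neg_mul_exp, Matrix.vecMul_one]
  · have hd : ∀ v t, HasDerivAt (fun s : ℝ => (NormedSpace.exp (s • X)).mulVec v)
        (X.mulVec ((NormedSpace.exp (t • X)).mulVec v)) t := by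
      intro v t
      simpa using hasDerivAt_mulVec (hasDerivAt_mat_iff.1 (hasDerivAt_exp_smul_left X t))
        (hasDerivAt_const t v)
    have hc : ∀ t : ℝ, HasDerivAt (fun s : ℝ => (NormedSpace.exp (-(s • X))).mulVec
        (cross ((NormedSpace.exp (s • X)).mulVec v) ((NormedSpace.exp (s • X)).mulVec w))) 0 t := by
      intro t
      convert hasDerivAt_mulVec (hasDerivAt_mat_iff.1 (hasDerivAt_exp_neg_smul X t))
        (hasDerivAt_cross (hd v t) (hd w t)) using 1
      rw [← (mem_g2Lie_iff.1 h).2, Matrix.neg_mulVec, Matrix.mulVec_mulVec, neg_add_cancel]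
    have h2 := is_const_of_deriv_eq_zero (fun t => (hc t).differentiableAt)
      (fun t => (hc t).deriv) 0 1
    simp only [zero_smul, neg_zero, NormedSpace.exp_zero, Matrix.one_mulVec, one_smul] at h2
    rw [h2, Matrix.mulVec_mulVec, exp_mul_exp_neg, Matrix.one_mulVec]

/-! ### Partial derivatives of products and currents of the Euler map. -/

/-- Matrix-valued maps with continuously differentiable entries. -/
def EntrywiseC1 {E : Type*} [NormedAddCommGroup E] [NormedSpace ℝ E] (φ : E → Mat7) : Prop :=
  ∀ i j, ContDiff ℝ 1 (fun v => φ v i j)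

section

variable {E F : Type*} [NormedAddCommGroup E] [NormedSpace ℝ E] [NormedAddCommGroup F]
  [NormedSpace ℝ F]

theorem EntrywiseC1.mul {φ ψ : E → Mat7} (hφ : EntrywiseC1 φ) (hψ : EntrywiseC1 ψ) :
    EntrywiseC1 (fun v => φ v * ψ v) := by
  intro i j
  simp only [Matrix.mul_apply]
  exact ContDiff.sum fun k _ => (hφ i k).mul (hψ k j)

theorem EntrywiseC1.comp {φ : E → Mat7} (hφ : EntrywiseC1 φ) {f : F → E} (hf : ContDiff ℝ 1 f) :
    EntrywiseC1 (fun v => φ (f v)) :=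
  fun i j => (hφ i j).comp hf

attribute [local instance] Matrix.linftyOpNormedRing Matrix.linftyOpNormedAlgebra in
theorem entrywiseC1_exp (X : Mat7) : EntrywiseC1 (fun t : ℝ => NormedSpace.exp (t • X)) := by
  intro i j
  have h : ContDiff ℝ 1 (fun A : Mat7 => NormedSpace.exp A) :=
    contDiff_iff_contDiffAt.2 fun A => (NormedSpace.exp_analytic (𝕂 := ℝ) A).contDiffAt
  have h2 : ContDiff ℝ 1 (fun t : ℝ => NormedSpace.exp (t • X)) :=
    h.comp (contDiff_id.smul contDiff_const)
  exact (LinearMap.toContinuousLinearMap (Matrix.entryLinearMap ℝ ℝ i j)).contDiff.comp h2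

theorem EntrywiseC1.exp {c : E → ℝ} (hc : ContDiff ℝ 1 c) (X : Mat7) :
    EntrywiseC1 (fun v => NormedSpace.exp (c v • X)) :=
  (entrywiseC1_exp X).comp hc

end

theorem pderiv_eq {n : ℕ} {φ : (Fin n → ℝ) → Mat7} {w : Fin n → ℝ} {K : Fin n} {M : Mat7}
    (hφ : ∀ i j, DifferentiableAt ℝ (fun v => φ v i j) w)
    (h : HasDerivAt (fun t => φ (Function.update w K t)) M (w K)) : pderiv φ K w = M := by
  ext i j
  rw [hasDerivAt_mat_iff] at h
  have h1 : HasFDerivAt (fun v => φ v i j) (fderiv ℝ (fun v => φ v i j) w)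
      (Function.update w K (w K)) := by
    rw [Function.update_eq_self]
    exact (hφ i j).hasFDerivAt
  exact (h1.comp_hasDerivAt (w K) (hasDerivAt_update w K (w K))).unique (h i j)

theorem hasDerivAt_pderiv {n : ℕ} {φ : (Fin n → ℝ) → Mat7} {w : Fin n → ℝ} (K : Fin n)
    (hφ : ∀ i j, DifferentiableAt ℝ (fun v => φ v i j) w) :
    HasDerivAt (fun t => φ (Function.update w K t)) (pderiv φ K w) (w K) := by
  rw [hasDerivAt_mat_iff]
  intro i j
  have h1 : HasFDerivAt (fun v => φ v i j) (fderiv ℝ (fun v => φ v i j) w)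
      (Function.update w K (w K)) := by
    rw [Function.update_eq_self]
    exact (hφ i j).hasFDerivAt
  exact h1.comp_hasDerivAt (w K) (hasDerivAt_update w K (w K))

theorem EntrywiseC1.differentiableAt {n : ℕ} {φ : (Fin n → ℝ) → Mat7} (hφ : EntrywiseC1 φ)
    (w : Fin n → ℝ) (i j : Fin 7) : DifferentiableAt ℝ (fun v => φ v i j) w :=
  (hφ i j).contDiffAt.differentiableAt one_ne_zero

attribute [local instance] Matrix.linftyOpNormedRing Matrix.linftyOpNormedAlgebra in
theorem hasDerivAt_mul_mul {A : ℝ → Mat7} {A' : Mat7} {t : ℝ} (h : HasDerivAt A A' t)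
    (L R : Mat7) : HasDerivAt (fun s => L * A s * R) (L * A' * R) t := by
  simpa using hasDerivAt_matMul (hasDerivAt_matMul (hasDerivAt_const t L) h) (hasDerivAt_const t R)

theorem pderiv_of_update_exp {n : ℕ} {φ : (Fin n → ℝ) → Mat7} (hφ : EntrywiseC1 φ)
    {w : Fin n → ℝ} {K : Fin n} {L X R : Mat7}
    (h : ∀ t : ℝ, φ (Function.update w K t) = L * NormedSpace.exp (t • X) * R) :
    pderiv φ K w = L * (X * NormedSpace.exp (w K • X)) * R := by
  refine pderiv_eq (hφ.differentiableAt w) ?_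
  simp only [h]
  exact hasDerivAt_mul_mul (hasDerivAt_exp_smul_left X (w K)) L R

/-- Used for every product map below: a coordinate occurs in a single factor, and the other factors
are constants `L` and `R` along its line. -/
theorem pderiv_of_update {n m : ℕ} {φ : (Fin n → ℝ) → Mat7} {ψ : (Fin m → ℝ) → Mat7}
    (hφ : EntrywiseC1 φ) (hψ : EntrywiseC1 ψ) {w : Fin n → ℝ} {w' : Fin m → ℝ} {K : Fin n}
    {K' : Fin m} {L R : Mat7} (hK : w K = w' K')
    (h : ∀ t : ℝ, φ (Function.update w K t) = L * ψ (Function.update w' K' t) * R) :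
    pderiv φ K w = L * pderiv ψ K' w' * R := by
  refine pderiv_eq (hφ.differentiableAt w) ?_
  simp only [h, hK]
  exact hasDerivAt_mul_mul (hasDerivAt_pderiv K' (hψ.differentiableAt w')) L R

/-- The left-invariant current of a map into `G₂` takes values in the Lie algebra. -/
theorem inv_mul_pderiv_mem {n : ℕ} {φ : (Fin n → ℝ) → Mat7} {w : Fin n → ℝ} (K : Fin n)
    (hφ : ∀ i j, DifferentiableAt ℝ (fun v => φ v i j) w) (h : ∀ᶠ v in nhds w, IsAut (φ v)) :
    (φ w)⁻¹ * pderiv φ K w ∈ g2Lie := by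
  have hc : Filter.Tendsto (fun t => Function.update w K t) (nhds (w K)) (nhds w) := by
    have : Continuous (fun t => Function.update w K t) := continuous_const.update K continuous_id
    simpa using this.tendsto (w K)
  have := IsAut.inv_mul_mem_of_hasDerivAt (hc.eventually h)
    (hasDerivAt_mat_iff.1 (hasDerivAt_pderiv K hφ))
  rwa [Function.update_eq_self] at this

theorem entrywiseC1_sMap : EntrywiseC1 sMap :=
  ((EntrywiseC1.exp (by fun_prop) _).mul (EntrywiseC1.exp (by fun_prop) _)).mul
    (EntrywiseC1.exp (by fun_prop) _)

theorem entrywiseC1_sigmaMap : EntrywiseC1 sigmaMap :=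
  ((EntrywiseC1.exp (by fun_prop) _).mul (EntrywiseC1.exp (by fun_prop) _)).mul
    (EntrywiseC1.exp (by fun_prop) _)

theorem contDiff_vec3 {E : Type*} [NormedAddCommGroup E] [NormedSpace ℝ E] {f g h : E → ℝ}
    (hf : ContDiff ℝ 1 f) (hg : ContDiff ℝ 1 g) (hh : ContDiff ℝ 1 h) :
    ContDiff ℝ 1 (fun v => ![f v, g v, h v]) := by
  rw [contDiff_pi]
  intro i
  fin_cases i <;> assumption

theorem entrywiseC1_hMap : EntrywiseC1 hMap :=
  (((entrywiseC1_sigmaMap.comp (contDiff_vec3 (by fun_prop) (by fun_prop) (by fun_prop))).mul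
    (entrywiseC1_sMap.comp (contDiff_vec3 (by fun_prop) (by fun_prop) (by fun_prop)))).mul
    (EntrywiseC1.exp (by fun_prop) _)).mul (EntrywiseC1.exp (by fun_prop) _)

theorem entrywiseC1_uMap : EntrywiseC1 uMap :=
  (entrywiseC1_sMap.comp (contDiff_vec3 (by fun_prop) (by fun_prop) (by fun_prop))).mul
    (entrywiseC1_sigmaMap.comp (contDiff_vec3 (by fun_prop) (by fun_prop) (by fun_prop)))

theorem entrywiseC1_eulerMap : EntrywiseC1 eulerMap := by
  refine (entrywiseC1_hMap.comp ?_).mul (entrywiseC1_uMap.comp ?_)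
  · rw [contDiff_pi]
    intro i
    fin_cases i <;> exact contDiff_apply ℝ ℝ _
  · rw [contDiff_pi]
    intro i
    fin_cases i <;> exact contDiff_apply ℝ ℝ _

theorem isAut_exp_gen (c : ℝ) (I : Fin 14) : IsAut (NormedSpace.exp (c • gen I)) :=
  isAut_exp (g2Lie.smul_mem _ (gen_mem_g2Lie I))

theorem isAut_sMap (x : Fin 3 → ℝ) : IsAut (sMap x) :=
  ((isAut_exp_gen _ _).mul (isAut_exp_gen _ _)).mul (isAut_exp_gen _ _)

theorem isAut_sigmaMap (x : Fin 3 → ℝ) : IsAut (sigmaMap x) :=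
  ((isAut_exp_gen _ _).mul (isAut_exp_gen _ _)).mul (isAut_exp_gen _ _)

theorem isAut_hMap (a : Fin 8 → ℝ) : IsAut (hMap a) :=
  (((isAut_sigmaMap _).mul (isAut_sMap _)).mul (isAut_exp_gen _ _)).mul (isAut_exp_gen _ _)

theorem isAut_uMap (c : Fin 6 → ℝ) : IsAut (uMap c) :=
  (isAut_sMap _).mul (isAut_sigmaMap _)

theorem isAut_eulerMap (a : Fin 14 → ℝ) : IsAut (eulerMap a) :=
  (isAut_hMap _).mul (isAut_uMap _)

theorem leftCurrent_eulerMap_spec (a : Fin 14 → ℝ) (K : Fin 14) :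
    (eulerMap a)⁻¹ * pderiv eulerMap K a = ∑ I, leftCurrent eulerMap a I K • gen I :=
  eq_sum_coord (inv_mul_pderiv_mem K (entrywiseC1_eulerMap.differentiableAt a)
    (Filter.Eventually.of_forall isAut_eulerMap))

theorem leftCurrent_hMap_spec (a : Fin 8 → ℝ) (K : Fin 8) :
    (hMap a)⁻¹ * pderiv hMap K a = ∑ I, leftCurrent hMap a I K • gen I :=
  eq_sum_coord (inv_mul_pderiv_mem K (entrywiseC1_hMap.differentiableAt a)
    (Filter.Eventually.of_forall isAut_hMap))

/-- The currents of `h u`, up to conjugation with `u`. -/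
theorem pderiv_eulerMap_base (a : Fin 14 → ℝ) (K : Fin 8) :
    pderiv eulerMap (Fin.castAdd 6 K) a =
      pderiv hMap K (baseCoords a) * uMap (fiberCoords a) := by
  have := pderiv_of_update entrywiseC1_eulerMap entrywiseC1_hMap (w := a)
    (w' := baseCoords a) (K := Fin.castAdd 6 K) (K' := K) (L := 1) (R := uMap (fiberCoords a))
    (by fin_cases K <;> rfl) (fun t => by
      rw [eulerMap, one_mul]
      congr 2
      · ext i
        fin_cases K <;> fin_cases i <;> rfl
      · ext i
        fin_cases K <;> fin_cases i <;> rfl)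
  rwa [one_mul] at this

theorem pderiv_eulerMap_fiber (a : Fin 14 → ℝ) (K : Fin 6) :
    pderiv eulerMap (Fin.natAdd 8 K) a =
      hMap (baseCoords a) * pderiv uMap K (fiberCoords a) := by
  have := pderiv_of_update entrywiseC1_eulerMap entrywiseC1_uMap (w := a)
    (w' := fiberCoords a) (K := Fin.natAdd 8 K) (K' := K) (L := hMap (baseCoords a)) (R := 1)
    (by fin_cases K <;> rfl) (fun t => by
      rw [eulerMap, mul_one]
      congr 2
      · ext i
        fin_cases K <;> fin_cases i <;> rfl
      · ext i
        fin_cases K <;> fin_cases i <;> rfl)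
  rwa [mul_one] at this

/-! ### Euler angles for a quaternion triple. -/

/-- The relations of the imaginary quaternions under the commutator. -/
structure IsQuatTriple (A B D : Mat7) : Prop where
  ab : A * B - B * A = (2 : ℝ) • D
  bd : B * D - D * B = (2 : ℝ) • A
  da : D * A - A * D = (2 : ℝ) • B

namespace IsQuatTriple

variable {A B D : Mat7}

theorem rotate (h : IsQuatTriple A B D) : IsQuatTriple B D A := ⟨h.bd, h.da, h.ab⟩

theorem conj_snd (h : IsQuatTriple A B D) (t : ℝ) :
    NormedSpace.exp (-(t • A)) * B * NormedSpace.exp (t • A) =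
      Real.cos (2 * t) • B - Real.sin (2 * t) • D := by
  refine conj_exp_of_lie ?_ ?_
  · rw [Matrix.smul_mul, Matrix.mul_smul, ← smul_sub, h.ab, smul_smul, mul_comm]
  · rw [Matrix.smul_mul, Matrix.mul_smul, ← smul_sub, ← neg_sub, h.da]
    module

theorem conj_trd (h : IsQuatTriple A B D) (t : ℝ) :
    NormedSpace.exp (-(t • A)) * D * NormedSpace.exp (t • A) =
      Real.cos (2 * t) • D + Real.sin (2 * t) • B := by
  have := conj_exp_of_lie (H := t • A) (Y := D) (V := -B) (m := 2 * t) ?_ ?_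
  · rw [this]
    module
  · rw [Matrix.smul_mul, Matrix.mul_smul, ← smul_sub, ← neg_sub, h.da]
    module
  · rw [Matrix.smul_mul, Matrix.mul_smul, ← smul_sub, Matrix.mul_neg, Matrix.neg_mul,
      sub_neg_eq_add, neg_add_eq_sub, ← neg_sub, h.ab]
    module

theorem conj_snd' (h : IsQuatTriple A B D) (t : ℝ) :
    NormedSpace.exp (t • A) * B * NormedSpace.exp (-(t • A)) =
      Real.cos (2 * t) • B + Real.sin (2 * t) • D := by
  simpa using h.conj_snd (-t)

theorem conj_trd' (h : IsQuatTriple A B D) (t : ℝ) :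
    NormedSpace.exp (t • A) * D * NormedSpace.exp (-(t • A)) =
      Real.cos (2 * t) • D - Real.sin (2 * t) • B := by
  simpa [sub_eq_add_neg] using h.conj_trd (-t)

end IsQuatTriple

/-- Euler angles for two one-parameter groups. -/
def eulerProd (A B : Mat7) (x : Fin 3 → ℝ) : Mat7 :=
  NormedSpace.exp (x 0 • A) * NormedSpace.exp (x 1 • B) * NormedSpace.exp (x 2 • A)

theorem entrywiseC1_eulerProd (A B : Mat7) : EntrywiseC1 (eulerProd A B) :=
  ((EntrywiseC1.exp (by fun_prop) _).mul (EntrywiseC1.exp (by fun_prop) _)).mul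
    (EntrywiseC1.exp (by fun_prop) _)

theorem eulerProd_inv (A B : Mat7) (x : Fin 3 → ℝ) : (eulerProd A B x)⁻¹ =
    NormedSpace.exp (-(x 2 • A)) * (NormedSpace.exp (-(x 1 • B)) *
      NormedSpace.exp (-(x 0 • A))) := by
  rw [eulerProd, Matrix.mul_inv_rev, Matrix.mul_inv_rev, inv_exp, inv_exp, inv_exp]

theorem exp_mul_exp_neg_assoc (X Y : Mat7) :
    NormedSpace.exp X * (NormedSpace.exp (-X) * Y) = Y := by
  rw [← Matrix.mul_assoc, exp_mul_exp_neg, Matrix.one_mul]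

theorem exp_neg_mul_exp_assoc (X Y : Mat7) :
    NormedSpace.exp (-X) * (NormedSpace.exp X * Y) = Y := by
  rw [← Matrix.mul_assoc, exp_neg_mul_exp, Matrix.one_mul]

theorem pderiv_eulerProd_zero (A B : Mat7) (x : Fin 3 → ℝ) : pderiv (eulerProd A B) 0 x =
    A * NormedSpace.exp (x 0 • A) * NormedSpace.exp (x 1 • B) * NormedSpace.exp (x 2 • A) := by
  rw [pderiv_of_update_exp (entrywiseC1_eulerProd A B) (L := 1) (X := A)
    (R := NormedSpace.exp (x 1 • B) * NormedSpace.exp (x 2 • A))]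
  · simp only [Matrix.one_mul, Matrix.mul_assoc]
  · intro t
    simp [eulerProd, Matrix.mul_assoc]

theorem pderiv_eulerProd_one (A B : Mat7) (x : Fin 3 → ℝ) : pderiv (eulerProd A B) 1 x =
    NormedSpace.exp (x 0 • A) * B * NormedSpace.exp (x 1 • B) * NormedSpace.exp (x 2 • A) := by
  rw [pderiv_of_update_exp (entrywiseC1_eulerProd A B) (L := NormedSpace.exp (x 0 • A)) (X := B)
    (R := NormedSpace.exp (x 2 • A))]
  · simp only [Matrix.mul_assoc]
  · intro t
    simp [eulerProd]

theorem pderiv_eulerProd_two (A B : Mat7) (x : Fin 3 → ℝ) : pderiv (eulerProd A B) 2 x =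
    NormedSpace.exp (x 0 • A) * NormedSpace.exp (x 1 • B) * A * NormedSpace.exp (x 2 • A) := by
  rw [pderiv_of_update_exp (entrywiseC1_eulerProd A B)
    (L := NormedSpace.exp (x 0 • A) * NormedSpace.exp (x 1 • B)) (X := A) (R := 1)]
  · simp only [Matrix.mul_assoc, Matrix.mul_one]
  · intro t
    simp [eulerProd]

theorem exp_smul_comm (X : Mat7) (t : ℝ) (Y : Mat7) :
    X * (NormedSpace.exp (t • X) * Y) = NormedSpace.exp (t • X) * (X * Y) := by
  rw [← Matrix.mul_assoc, exp_comm, Matrix.mul_assoc]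

/-- The coefficients of `dg g⁻¹` for Euler angles. -/
def eulerRight (x : Fin 3 → ℝ) : Matrix (Fin 3) (Fin 3) ℝ :=
  !![1, 0, Real.cos (2 * x 1);
     0, Real.cos (2 * x 0), Real.sin (2 * x 1) * Real.sin (2 * x 0);
     0, Real.sin (2 * x 0), -(Real.sin (2 * x 1) * Real.cos (2 * x 0))]

/-- The coefficients of `g⁻¹ dg` for Euler angles. -/
def eulerLeft (x : Fin 3 → ℝ) : Matrix (Fin 3) (Fin 3) ℝ :=
  !![Real.cos (2 * x 1), 0, 1;
     Real.sin (2 * x 1) * Real.sin (2 * x 2), Real.cos (2 * x 2), 0;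
     Real.sin (2 * x 1) * Real.cos (2 * x 2), -Real.sin (2 * x 2), 0]

theorem det_eulerRight (x : Fin 3 → ℝ) : (eulerRight x).det = -Real.sin (2 * x 1) := by
  simp only [eulerRight, Matrix.det_fin_three, Matrix.of_apply, Matrix.cons_val', Matrix.cons_val]
  linear_combination (-Real.sin (2 * x 1)) * Real.sin_sq_add_cos_sq (2 * x 0)

theorem det_eulerLeft (x : Fin 3 → ℝ) : (eulerLeft x).det = -Real.sin (2 * x 1) := by
  simp only [eulerLeft, Matrix.det_fin_three, Matrix.of_apply, Matrix.cons_val', Matrix.cons_val]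
  linear_combination (-Real.sin (2 * x 1)) * Real.sin_sq_add_cos_sq (2 * x 2)

/-- The three columns are `A`, `Ad(e^{x₀A}) B` and `Ad(e^{x₀A} e^{x₁B}) A`, and conjugation by
`e^{tA}` rotates the plane of `B` and `D` by the angle `2t`. -/
theorem IsQuatTriple.right {A B D : Mat7} (h : IsQuatTriple A B D) (x : Fin 3 → ℝ) (K : Fin 3) :
    pderiv (eulerProd A B) K x * (eulerProd A B x)⁻¹ =
      ∑ i, eulerRight x i K • ![A, B, D] i := by
  rw [eulerProd_inv]
  match K with
  | 0 =>
    rw [pderiv_eulerProd_zero]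
    simp only [Matrix.mul_assoc, exp_mul_exp_neg_assoc, exp_mul_exp_neg]
    simp [Fin.sum_univ_three, eulerRight]
  | 1 =>
    rw [pderiv_eulerProd_one]
    simp only [Matrix.mul_assoc, exp_mul_exp_neg_assoc]
    rw [← Matrix.mul_assoc, h.conj_snd']
    simp [Fin.sum_univ_three, eulerRight]
  | 2 =>
    rw [pderiv_eulerProd_two]
    simp only [Matrix.mul_assoc, exp_mul_exp_neg_assoc]
    have e := h.rotate.conj_trd' (x 1)
    have e1 := h.conj_trd' (x 0)
    calc _ = NormedSpace.exp (x 0 • A) * (NormedSpace.exp (x 1 • B) * A *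
          NormedSpace.exp (-(x 1 • B))) * NormedSpace.exp (-(x 0 • A)) := by
          simp only [Matrix.mul_assoc]
      _ = Real.cos (2 * x 1) • A - Real.sin (2 * x 1) •
          (NormedSpace.exp (x 0 • A) * D * NormedSpace.exp (-(x 0 • A))) := by
          rw [e, Matrix.mul_sub, Matrix.sub_mul, Matrix.mul_smul, Matrix.mul_smul,
            Matrix.smul_mul, Matrix.smul_mul, ← exp_comm, Matrix.mul_assoc A, exp_mul_exp_neg,
            Matrix.mul_one]
      _ = _ := by
          rw [e1]
          simp [Fin.sum_univ_three, eulerRight]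
          module

/-- The mirror image of `IsQuatTriple.right`: the columns are `A` conjugated by the two factors on
its right, `B` conjugated by the last factor, and `A` itself. -/
theorem IsQuatTriple.left {A B D : Mat7} (h : IsQuatTriple A B D) (x : Fin 3 → ℝ) (K : Fin 3) :
    (eulerProd A B x)⁻¹ * pderiv (eulerProd A B) K x =
      ∑ i, eulerLeft x i K • ![A, B, D] i := by
  rw [eulerProd_inv]
  match K with
  | 0 =>
    rw [pderiv_eulerProd_zero]
    simp only [Matrix.mul_assoc, exp_smul_comm, exp_neg_mul_exp_assoc]
    have e := h.rotate.conj_trd (x 1)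
    have e1 := h.conj_trd (x 2)
    calc _ = NormedSpace.exp (-(x 2 • A)) * (NormedSpace.exp (-(x 1 • B)) * A *
          NormedSpace.exp (x 1 • B)) * NormedSpace.exp (x 2 • A) := by
          simp only [Matrix.mul_assoc]
      _ = Real.cos (2 * x 1) • A + Real.sin (2 * x 1) •
          (NormedSpace.exp (-(x 2 • A)) * D * NormedSpace.exp (x 2 • A)) := by
          rw [e, Matrix.mul_add, Matrix.add_mul, Matrix.mul_smul, Matrix.mul_smul,
            Matrix.smul_mul, Matrix.smul_mul, Matrix.mul_assoc _ A, exp_comm,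
            exp_neg_mul_exp_assoc]
      _ = _ := by
          rw [e1]
          simp [Fin.sum_univ_three, eulerLeft]
          module
  | 1 =>
    rw [pderiv_eulerProd_one]
    simp only [Matrix.mul_assoc, exp_smul_comm, exp_neg_mul_exp_assoc]
    rw [← Matrix.mul_assoc, h.conj_snd]
    simp [Fin.sum_univ_three, eulerLeft, sub_eq_add_neg]
  | 2 =>
    rw [pderiv_eulerProd_two]
    simp only [Matrix.mul_assoc, exp_neg_mul_exp_assoc, exp_comm]
    simp [Fin.sum_univ_three, eulerLeft]

/-! ### The two commuting factors of the fiber and their Jacobians. -/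

theorem castMat_lie {P Q R : Matrix (Fin 7) (Fin 7) ℤ} {n : ℤ} (h : P * Q - Q * P = n • R) :
    castMat P * castMat Q - castMat Q * castMat P = (n : ℝ) • castMat R := by
  rw [← map_mul, ← map_mul, ← map_sub, h, map_zsmul, Int.cast_smul_eq_zsmul]

theorem isQuatTriple_castMat {A B D : Matrix (Fin 7) (Fin 7) ℤ}
    (h1 : A * B - B * A = (2 : ℤ) • D) (h2 : B * D - D * B = (2 : ℤ) • A)
    (h3 : D * A - A * D = (2 : ℤ) • B) :
    IsQuatTriple (castMat A) (castMat B) (castMat D) := by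
  refine ⟨?_, ?_, ?_⟩
  · simpa using castMat_lie h1
  · simpa using castMat_lie h2
  · simpa using castMat_lie h3

/-- The outer Euler generator `C₃` comes first; then `[C₃, C₂] = -2 C₁` forces the minus sign on the
third member. -/
theorem isQuatTriple_s : IsQuatTriple (castMat (zmat 2)) (castMat (zmat 1)) (castMat (-zmat 0)) :=
  isQuatTriple_castMat (by decide +kernel) (by decide +kernel) (by decide +kernel)

theorem isQuatTriple_sigma :
    IsQuatTriple (castMat (zmat 7)) (castMat (zmat 8)) (castMat (zmat 9)) :=
  isQuatTriple_castMat (by decide +kernel) (by decide +kernel) (by decide +kernel)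

theorem sMap_eq : sMap = eulerProd (castMat (zmat 2)) (castMat (zmat 1)) := by
  funext x
  simp [sMap, eulerProd, castMat_zmat, scal_of_lt (I := 2) (by decide),
    scal_of_lt (I := 1) (by decide)]

theorem sigmaMap_eq : sigmaMap = eulerProd (castMat (zmat 7)) (castMat (zmat 8)) := by
  funext x
  simp [sigmaMap, eulerProd, castMat_zmat, scal_of_ge (I := 7) (by decide),
    scal_of_ge (I := 8) (by decide), smul_smul, mul_comm]

theorem coord_sum_gen {m : ℕ} {rows : Fin m → Fin 14} (hr : Function.Injective rows)
    (c : Fin m → ℝ) (i : Fin m) : coord (rows i) (∑ j, c j • gen (rows j)) = c i := by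
  rw [coord_sum]
  simp [coord_smul, coord_gen, hr.eq_iff]

theorem coord_sum_gen_of_notMem {m : ℕ} {rows : Fin m → Fin 14} {I : Fin 14}
    (hI : ∀ j, I ≠ rows j) (c : Fin m → ℝ) : coord I (∑ j, c j • gen (rows j)) = 0 := by
  rw [coord_sum]
  simp [coord_smul, coord_gen, hI]

theorem sRows_injective : Function.Injective sRows := by decide

theorem sigmaRows_injective : Function.Injective sigmaRows := by decide

theorem fiberRows_injective : Function.Injective fiberRows := by decide

theorem rightCurrent_sMap (x : Fin 3 → ℝ) (K : Fin 3) :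
    pderiv sMap K x * (sMap x)⁻¹ = ∑ i, (![-eulerRight x 2, eulerRight x 1, eulerRight x 0] :
      Fin 3 → Fin 3 → ℝ) i K • gen (sRows i) := by
  rw [sMap_eq, isQuatTriple_s.right]
  simp [Fin.sum_univ_three, sRows, castMat_zmat, scal_of_lt (I := 2) (by decide),
    scal_of_lt (I := 1) (by decide), scal_of_lt (I := 0) (by decide)]
  abel

theorem sBein_eq (x : Fin 3 → ℝ) :
    sBein x = Matrix.of ![-eulerRight x 2, eulerRight x 1, eulerRight x 0] := by
  ext i K
  rw [sBein, Matrix.submatrix_apply, rightCurrent, Matrix.of_apply, id, rightCurrent_sMap,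
    coord_sum_gen sRows_injective]
  rfl

theorem sBein_spec (x : Fin 3 → ℝ) (K : Fin 3) :
    pderiv sMap K x * (sMap x)⁻¹ = ∑ i, sBein x i K • gen (sRows i) := by
  rw [rightCurrent_sMap, sBein_eq]
  rfl

/-- Relative to `eulerRight`, the rows are in reverse order and one of them is negated; the two
signs cancel. -/
theorem det_sBein (x : Fin 3 → ℝ) : (sBein x).det = -Real.sin (2 * x 1) := by
  rw [← det_eulerRight, sBein_eq, Matrix.det_fin_three, Matrix.det_fin_three]
  simp
  ring

theorem rightCurrent_sigmaMap (x : Fin 3 → ℝ) (K : Fin 3) :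
    pderiv sigmaMap K x * (sigmaMap x)⁻¹ = ∑ i, (√3 • eulerRight x) i K • gen (sigmaRows i) := by
  rw [sigmaMap_eq, isQuatTriple_sigma.right]
  simp [Fin.sum_univ_three, sigmaRows, castMat_zmat, scal_of_ge (I := 7) (by decide),
    scal_of_ge (I := 8) (by decide), scal_of_ge (I := 9) (by decide), smul_smul, mul_comm]

theorem sigmaBein_eq (x : Fin 3 → ℝ) : sigmaBein x = √3 • eulerRight x := by
  ext i K
  rw [sigmaBein, Matrix.submatrix_apply, rightCurrent, Matrix.of_apply, id, rightCurrent_sigmaMap,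
    coord_sum_gen sigmaRows_injective]

theorem sigmaBein_spec (x : Fin 3 → ℝ) (K : Fin 3) :
    pderiv sigmaMap K x * (sigmaMap x)⁻¹ = ∑ i, sigmaBein x i K • gen (sigmaRows i) := by
  rw [rightCurrent_sigmaMap, sigmaBein_eq]

theorem det_sigmaBein (x : Fin 3 → ℝ) :
    (sigmaBein x).det = -(3 * √3 * Real.sin (2 * x 1)) := by
  rw [sigmaBein_eq, Matrix.det_smul, det_eulerRight, Fintype.card_fin, pow_succ,
    Real.sq_sqrt (by norm_num)]
  ring

theorem commute_exp_gen {I J : Fin 14} (h : zmat I * zmat J = zmat J * zmat I) (t : ℝ) :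
    Commute (NormedSpace.exp (t • gen I)) (gen J) := by
  have : Commute (gen I) (gen J) := by
    rw [gen_eq_smul_castMat, gen_eq_smul_castMat]
    have h1 : Commute (castMat (zmat I)) (castMat (zmat J)) := Commute.map h castMat
    exact (h1.smul_left _).smul_right _
  exact (this.smul_left t).exp_left

theorem commute_sMap_gen (x : Fin 3 → ℝ) (i : Fin 3) : Commute (sMap x) (gen (sigmaRows i)) := by
  have h : ∀ i : Fin 3, zmat 2 * zmat (sigmaRows i) = zmat (sigmaRows i) * zmat 2 ∧
      zmat 1 * zmat (sigmaRows i) = zmat (sigmaRows i) * zmat 1 := by decide +kernel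
  exact ((commute_exp_gen (h i).1 _).mul_left (commute_exp_gen (h i).2 _)).mul_left
    (commute_exp_gen (h i).1 _)

theorem pderiv_uMap_s (c : Fin 6 → ℝ) (K : Fin 3) :
    pderiv uMap (Fin.castAdd 3 K) c =
      pderiv sMap K ![c 0, c 1, c 2] * sigmaMap ![c 3, c 4, c 5] := by
  have := pderiv_of_update entrywiseC1_uMap entrywiseC1_sMap (w := c)
    (w' := ![c 0, c 1, c 2]) (K := Fin.castAdd 3 K) (K' := K) (L := 1)
    (R := sigmaMap ![c 3, c 4, c 5])
    (by fin_cases K <;> rfl) (fun t => by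
      rw [uMap, one_mul]
      congr 2
      · ext i
        fin_cases K <;> fin_cases i <;> rfl
      · ext i
        fin_cases K <;> fin_cases i <;> rfl)
  rwa [one_mul] at this

theorem pderiv_uMap_sigma (c : Fin 6 → ℝ) (K : Fin 3) :
    pderiv uMap (Fin.natAdd 3 K) c =
      sMap ![c 0, c 1, c 2] * pderiv sigmaMap K ![c 3, c 4, c 5] := by
  have := pderiv_of_update entrywiseC1_uMap entrywiseC1_sigmaMap (w := c)
    (w' := ![c 3, c 4, c 5]) (K := Fin.natAdd 3 K) (K' := K) (L := sMap ![c 0, c 1, c 2])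
    (R := 1)
    (by fin_cases K <;> rfl) (fun t => by
      rw [uMap, mul_one]
      congr 2
      · ext i
        fin_cases K <;> fin_cases i <;> rfl
      · ext i
        fin_cases K <;> fin_cases i <;> rfl)
  rwa [mul_one] at this

theorem rightCurrent_uMap_s (c : Fin 6 → ℝ) (K : Fin 3) :
    pderiv uMap (Fin.castAdd 3 K) c * (uMap c)⁻¹ =
      ∑ i, sBein ![c 0, c 1, c 2] i K • gen (sRows i) := by
  rw [pderiv_uMap_s, uMap, Matrix.mul_inv_rev, Matrix.mul_assoc, ← Matrix.mul_assoc (sigmaMap _),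
    (isAut_sigmaMap _).mul_inv, Matrix.one_mul, sBein_spec]

theorem rightCurrent_uMap_sigma (c : Fin 6 → ℝ) (K : Fin 3) :
    pderiv uMap (Fin.natAdd 3 K) c * (uMap c)⁻¹ =
      ∑ i, sigmaBein ![c 3, c 4, c 5] i K • gen (sigmaRows i) := by
  rw [pderiv_uMap_sigma, uMap, Matrix.mul_inv_rev, Matrix.mul_assoc, ← Matrix.mul_assoc _ _⁻¹,
    sigmaBein_spec, ← Matrix.mul_assoc]
  have : Commute (sMap ![c 0, c 1, c 2])
      (∑ i, sigmaBein ![c 3, c 4, c 5] i K • gen (sigmaRows i)) :=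
    Commute.sum_right _ _ _ fun i _ => (commute_sMap_gen _ i).smul_right _
  rw [this.eq, Matrix.mul_assoc, (isAut_sMap _).mul_inv, Matrix.mul_one]

theorem fiberRows_castAdd (i : Fin 3) : fiberRows (Fin.castAdd 3 i) = sRows i := by
  fin_cases i <;> rfl

theorem fiberRows_natAdd (i : Fin 3) : fiberRows (Fin.natAdd 3 i) = sigmaRows i := by
  fin_cases i <;> rfl

theorem sRows_ne_sigmaRows (i j : Fin 3) : sRows i ≠ sigmaRows j := by
  revert i j
  decide

/-- `du u⁻¹ = ds s⁻¹ + s (dσ σ⁻¹) s⁻¹`, and `s` commutes with the span of `C₈, C₉, C₁₀`, so the two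
factors do not mix. -/
theorem fiberBein_reindex (c : Fin 6 → ℝ) :
    (fiberBein c).submatrix (finSumFinEquiv (m := 3) (n := 3)) (finSumFinEquiv (m := 3) (n := 3)) =
      Matrix.fromBlocks (sBein ![c 0, c 1, c 2]) 0 0 (sigmaBein ![c 3, c 4, c 5]) := by
  ext i K
  rw [Matrix.submatrix_apply, fiberBein, Matrix.submatrix_apply, rightCurrent, Matrix.of_apply, id]
  rcases i with i | i <;> rcases K with K | K
  · rw [finSumFinEquiv_apply_left, finSumFinEquiv_apply_left, fiberRows_castAdd,
      rightCurrent_uMap_s, coord_sum_gen sRows_injective]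
    rfl
  · rw [finSumFinEquiv_apply_left, finSumFinEquiv_apply_right, fiberRows_castAdd,
      rightCurrent_uMap_sigma, coord_sum_gen_of_notMem fun j => sRows_ne_sigmaRows i j]
    rfl
  · rw [finSumFinEquiv_apply_left, finSumFinEquiv_apply_right, fiberRows_natAdd,
      rightCurrent_uMap_s, coord_sum_gen_of_notMem fun j => (sRows_ne_sigmaRows j i).symm]
    rfl
  · rw [finSumFinEquiv_apply_right, finSumFinEquiv_apply_right, fiberRows_natAdd,
      rightCurrent_uMap_sigma, coord_sum_gen sigmaRows_injective]
    rfl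

theorem det_fiberBein (c : Fin 6 → ℝ) : (fiberBein c).det =
    (sBein ![c 0, c 1, c 2]).det * (sigmaBein ![c 3, c 4, c 5]).det := by
  rw [← Matrix.det_fromBlocks_zero₂₁ _ 0 _, ← fiberBein_reindex, Matrix.det_submatrix_equiv_self]

theorem fiberBein_spec (c : Fin 6 → ℝ) (K : Fin 6) :
    pderiv uMap K c * (uMap c)⁻¹ = ∑ i, fiberBein c i K • gen (fiberRows i) := by
  -- Some expansion along `fiberRows` is enough: its coefficients are then recovered by `coord`.
  have key : ∃ d : Fin 6 → ℝ, pderiv uMap K c * (uMap c)⁻¹ = ∑ i, d i • gen (fiberRows i) := by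
    obtain ⟨K, rfl⟩ := (finSumFinEquiv (m := 3) (n := 3)).surjective K
    rcases K with K | K
    · refine ⟨Fin.append (m := 3) (n := 3) (fun i => sBein ![c 0, c 1, c 2] i K) 0, ?_⟩
      rw [finSumFinEquiv_apply_left, rightCurrent_uMap_s, Fin.sum_univ_add (a := 3) (b := 3)]
      simp only [fiberRows_castAdd, Fin.append_left, Fin.append_right, Pi.zero_apply, zero_smul,
        Finset.sum_const_zero, add_zero]
    · refine ⟨Fin.append (m := 3) (n := 3) 0 (fun i => sigmaBein ![c 3, c 4, c 5] i K), ?_⟩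
      rw [finSumFinEquiv_apply_right, rightCurrent_uMap_sigma, Fin.sum_univ_add (a := 3) (b := 3)]
      simp only [fiberRows_natAdd, Fin.append_left, Fin.append_right, Pi.zero_apply, zero_smul,
        Finset.sum_const_zero, zero_add]
  obtain ⟨d, hd⟩ := key
  rw [hd]
  refine Finset.sum_congr rfl fun i _ => ?_
  rw [fiberBein, Matrix.submatrix_apply, rightCurrent, Matrix.of_apply, id, hd,
    coord_sum_gen fiberRows_injective]

/-! ### The adjoint action and the factorization of the Jacobian. -/

/-- The matrix of `X ↦ A⁻¹ X A` on the Lie algebra. -/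
def adInv (A : Mat7) : Matrix (Fin 14) (Fin 14) ℝ :=
  Matrix.of fun I J => coord I (A⁻¹ * gen J * A)

theorem coord_conj {A : Mat7} {X : Mat7} (hX : X ∈ g2Lie) (I : Fin 14) :
    coord I (A⁻¹ * X * A) = ∑ J, adInv A I J * coord J X := by
  conv_lhs => rw [eq_sum_coord hX, Finset.mul_sum, Finset.sum_mul, coord_sum]
  refine Finset.sum_congr rfl fun J _ => ?_
  rw [Matrix.mul_smul, Matrix.smul_mul, coord_smul, mul_comm]
  rfl

theorem adInv_mul {A B : Mat7} (hA : IsAut A) : adInv (A * B) = adInv B * adInv A := by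
  ext I J
  rw [Matrix.mul_apply]
  have := coord_conj (A := B) (hA.conj_mem (gen_mem_g2Lie J)) I
  rw [adInv, Matrix.of_apply, Matrix.mul_inv_rev]
  simp only [Matrix.mul_assoc] at this ⊢
  rw [this]
  simp only [adInv, Matrix.of_apply, Matrix.mul_assoc]

theorem adInv_one : adInv 1 = 1 := by
  ext I J
  simp [adInv, coord_gen, Matrix.one_apply]

/-- Cyclicity of the trace: conjugation preserves the trace form, for which the generators are
orthogonal of equal norm. -/
theorem adInv_inv {A : Mat7} (hA : IsAut A) : adInv A⁻¹ = (adInv A).transpose := by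
  ext I J
  rw [Matrix.transpose_apply, adInv, Matrix.of_apply, adInv, Matrix.of_apply, coord, coord,
    hA.inv_inv]
  congr 1
  rw [← Matrix.mul_assoc, ← Matrix.mul_assoc, Matrix.trace_mul_comm, Matrix.trace_mul_comm (gen J)]
  simp only [Matrix.mul_assoc]

theorem det_adInv_sq {A : Mat7} (hA : IsAut A) : (adInv A).det * (adInv A).det = 1 := by
  have h := adInv_mul (B := A⁻¹) hA
  rw [hA.mul_inv, adInv_one, adInv_inv hA] at h
  simpa using (congrArg Matrix.det h).symm

/-- Orthogonality gives only the sign `±1`; it is `+1` because `exp X` is the square of `exp (X/2)`.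
-/
theorem det_adInv_exp {X : Mat7} (hX : X ∈ g2Lie) : (adInv (NormedSpace.exp X)).det = 1 := by
  have hY : (1 / 2 : ℝ) • X ∈ g2Lie := g2Lie.smul_mem _ hX
  have h := isAut_exp hY
  have : X = (1 / 2 : ℝ) • X + (1 / 2 : ℝ) • X := by module
  rw [this, Matrix.exp_add_of_commute _ _ (Commute.refl _), adInv_mul h, Matrix.det_mul,
    det_adInv_sq h]

theorem det_adInv_sMap (x : Fin 3 → ℝ) : (adInv (sMap x)).det = 1 := by
  have h := fun (c : ℝ) I => det_adInv_exp (g2Lie.smul_mem c (gen_mem_g2Lie I))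
  rw [sMap, adInv_mul ((isAut_exp_gen _ _).mul (isAut_exp_gen _ _)), adInv_mul (isAut_exp_gen _ _),
    Matrix.det_mul, Matrix.det_mul, h, h, h]
  norm_num

theorem det_adInv_sigmaMap (x : Fin 3 → ℝ) : (adInv (sigmaMap x)).det = 1 := by
  have h := fun (c : ℝ) I => det_adInv_exp (g2Lie.smul_mem c (gen_mem_g2Lie I))
  rw [sigmaMap, adInv_mul ((isAut_exp_gen _ _).mul (isAut_exp_gen _ _)),
    adInv_mul (isAut_exp_gen _ _), Matrix.det_mul, Matrix.det_mul, h, h, h]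
  norm_num

theorem det_adInv_uMap (c : Fin 6 → ℝ) : (adInv (uMap c)).det = 1 := by
  rw [uMap, adInv_mul (isAut_sMap _), Matrix.det_mul, det_adInv_sMap, det_adInv_sigmaMap, mul_one]

/-- The coefficients of `u (g⁻¹ dg) u⁻¹` for `g = h u`. -/
def mixedCurrent (a : Fin 14 → ℝ) : Matrix (Fin 14) (Fin 8 ⊕ Fin 6) ℝ :=
  Matrix.of fun I => Sum.elim
    (fun K => coord I ((hMap (baseCoords a))⁻¹ * pderiv hMap K (baseCoords a)))
    (fun K => coord I (pderiv uMap K (fiberCoords a) * (uMap (fiberCoords a))⁻¹))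

/-- This is `g⁻¹ dg = u⁻¹ (h⁻¹ dh + du u⁻¹) u` in coordinates. -/
theorem leftCurrent_eulerMap (a : Fin 14 → ℝ) :
    (leftCurrent eulerMap a).submatrix id (finSumFinEquiv (m := 8) (n := 6)) =
      adInv (uMap (fiberCoords a)) * mixedCurrent a := by
  ext I K
  rw [Matrix.submatrix_apply, id, leftCurrent, Matrix.of_apply, Matrix.mul_apply]
  have hh := isAut_hMap (baseCoords a)
  have hu := isAut_uMap (fiberCoords a)
  rcases K with K | K
  · rw [finSumFinEquiv_apply_left, pderiv_eulerMap_base, eulerMap, Matrix.mul_inv_rev,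
      Matrix.mul_assoc, ← Matrix.mul_assoc _⁻¹ (pderiv _ _ _), ← Matrix.mul_assoc,
      coord_conj (inv_mul_pderiv_mem K (entrywiseC1_hMap.differentiableAt _)
        (Filter.Eventually.of_forall isAut_hMap))]
    rfl
  · have hX : pderiv uMap K (fiberCoords a) * (uMap (fiberCoords a))⁻¹ ∈ g2Lie := by
      rw [fiberBein_spec]
      exact sum_mem fun i _ => g2Lie.smul_mem _ (gen_mem_g2Lie _)
    have e := coord_conj (A := uMap (fiberCoords a)) hX I
    rw [finSumFinEquiv_apply_right, pderiv_eulerMap_fiber, eulerMap, Matrix.mul_inv_rev,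
      Matrix.mul_assoc, ← Matrix.mul_assoc _ (hMap _), hh.inv_mul, Matrix.one_mul]
    rw [← Matrix.mul_assoc, Matrix.mul_assoc _ _ (uMap _), hu.inv_mul, Matrix.mul_one] at e
    rw [e]
    rfl

/-- The rows of the base followed by those of the fiber. -/
def rowPerm : Equiv.Perm (Fin 14) where
  toFun := ![3, 4, 5, 6, 10, 11, 12, 13, 0, 1, 2, 7, 8, 9]
  invFun := ![8, 9, 10, 0, 1, 2, 3, 11, 12, 13, 4, 5, 6, 7]
  left_inv := by decide
  right_inv := by decide

/-- Only rows are permuted, since the coordinates already list the base before the fiber; so this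
sign enters the determinant. -/
theorem sign_rowPerm : Equiv.Perm.sign rowPerm = 1 := by
  decide +kernel

theorem baseRows_ne_fiberRows (i : Fin 8) (j : Fin 6) : baseRows i ≠ fiberRows j := by
  revert i j
  decide

/-- The upper right block vanishes because `du u⁻¹` has no component orthogonal to the fiber. The
lower left block, the fiber part of `h⁻¹ dh`, does not affect the determinant. -/
theorem mixedCurrent_reindex (a : Fin 14 → ℝ) :
    (mixedCurrent a).submatrix (rowPerm ∘ finSumFinEquiv (m := 8) (n := 6)) id =
      Matrix.fromBlocks (baseBein (baseCoords a)) 0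
        (Matrix.of fun i K => leftCurrent hMap (baseCoords a) (fiberRows i) K)
        (fiberBein (fiberCoords a)) := by
  have hl : ∀ i : Fin 8, rowPerm (Fin.castAdd 6 i) = baseRows i := by decide
  have hr : ∀ i : Fin 6, rowPerm (Fin.natAdd 8 i) = fiberRows i := by decide
  ext i K
  rw [Matrix.submatrix_apply, Function.comp_apply, id]
  rcases i with i | i <;> rcases K with K | K
  · rw [finSumFinEquiv_apply_left, hl]
    rfl
  · rw [finSumFinEquiv_apply_left, hl, mixedCurrent, Matrix.of_apply, Sum.elim_inr,
      fiberBein_spec, coord_sum_gen_of_notMem (baseRows_ne_fiberRows i)]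
    rfl
  · rw [finSumFinEquiv_apply_right, hr]
    rfl
  · rw [finSumFinEquiv_apply_right, hr]
    rfl

theorem det_leftCurrent_eulerMap (a : Fin 14 → ℝ) :
    (leftCurrent eulerMap a).det =
      (baseBein (baseCoords a)).det * (fiberBein (fiberCoords a)).det := by
  let e := finSumFinEquiv (m := 8) (n := 6)
  have h1 : leftCurrent eulerMap a =
      adInv (uMap (fiberCoords a)) * (mixedCurrent a).submatrix id e.symm := by
    have := congrArg (fun M => M.submatrix id e.symm) (leftCurrent_eulerMap a)
    simp only [Matrix.submatrix_submatrix] at this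
    rw [show (finSumFinEquiv (m := 8) (n := 6) : _ → _) ∘ e.symm = id from
      funext e.apply_symm_apply] at this
    simp only [Function.id_comp, Matrix.submatrix_id_id] at this
    exact this
  have h2 : (((mixedCurrent a).submatrix id e.symm).submatrix rowPerm id).submatrix e e =
      (mixedCurrent a).submatrix (rowPerm ∘ finSumFinEquiv (m := 8) (n := 6)) id := by
    ext i K
    simp [e]
  rw [h1, Matrix.det_mul, det_adInv_uMap, one_mul, ← Matrix.det_fromBlocks_zero₁₂ _
    (Matrix.of fun i K => leftCurrent hMap (baseCoords a) (fiberRows i) K), ← mixedCurrent_reindex,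
    ← h2, Matrix.det_submatrix_equiv_self, Matrix.det_permute, sign_rowPerm]
  simp

/-! ### Restricted roots and the Jacobian of the base. -/

/-- Root vectors in the Lie algebra of the fiber, in the coordinates of `zmat`. -/
def rootFiber : Fin 6 → Fin 14 → ℤ :=
  ![![0, 0, 1, 0, 0, 0, 0, 1, 0, 0, 0, 0, 0, 0], ![0, 0, 3, 0, 0, 0, 0, -1, 0, 0, 0, 0, 0, 0],
    ![3, 3, 0, 0, 0, 0, 0, 0, 1, 1, 0, 0, 0, 0], ![3, -3, 0, 0, 0, 0, 0, 0, 1, -1, 0, 0, 0, 0],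
    ![1, 1, 0, 0, 0, 0, 0, 0, -1, -1, 0, 0, 0, 0], ![1, -1, 0, 0, 0, 0, 0, 0, -1, 1, 0, 0, 0, 0]]

/-- The partners of `rootFiber` orthogonal to the fiber. -/
def rootBase : Fin 6 → Fin 14 → ℤ :=
  ![![0, 0, 0, 2, 0, 0, 0, 0, 0, 0, 0, 0, 0, 0], ![0, 0, 0, 0, 0, 0, 0, 0, 0, 0, 0, -2, 0, 0],
    ![0, 0, 0, 0, 0, -3, -3, 0, 0, 0, 0, 0, 1, -1], ![0, 0, 0, 0, 0, -3, 3, 0, 0, 0, 0, 0, 1, 1],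
    ![0, 0, 0, 0, 0, -1, -1, 0, 0, 0, 0, 0, -1, 1], ![0, 0, 0, 0, 0, -1, 1, 0, 0, 0, 0, 0, -1, -1]]

/-- The values of the positive restricted roots at `zmat 10`. -/
def rootA : Fin 6 → ℤ := ![0, 2, 1, -1, -3, 3]

/-- The values of the positive restricted roots at `zmat 4`. -/
def rootB : Fin 6 → ℤ := ![2, 0, 1, 1, 1, 1]

/-- The restricted root relations, on each of the two generators of the torus. As `zmat 10` has
three times the square norm of `zmat 4`, the roots with values `(0,2)` and `(±3,1)` are long, and
`(2,0)` and `(±1,1)` are short: a root system of type G₂. -/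
theorem zint_root (r : Fin 6) :
    zmat 10 * zint (rootFiber r) - zint (rootFiber r) * zmat 10 = rootA r • zint (rootBase r) ∧
    zmat 4 * zint (rootFiber r) - zint (rootFiber r) * zmat 4 = rootB r • zint (rootBase r) ∧
    zmat 10 * zint (rootBase r) - zint (rootBase r) * zmat 10 =
      (-rootA r) • zint (rootFiber r) ∧
    zmat 4 * zint (rootBase r) - zint (rootBase r) * zmat 4 = (-rootB r) • zint (rootFiber r) := by
  revert r
  decide +kernel

/-- The torus element whose exponential separates base and fiber. -/
def torusElt (a b : ℝ) : Mat7 := a • castMat (zmat 10) + b • castMat (zmat 4)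

/-- The value of a positive restricted root at `torusElt a b`. -/
def rootVal (a b : ℝ) (r : Fin 6) : ℝ := rootA r * a + rootB r * b

theorem conj_torusElt (a b : ℝ) (r : Fin 6) :
    NormedSpace.exp (-torusElt a b) * castMat (zint (rootFiber r)) *
        NormedSpace.exp (torusElt a b) =
      Real.cos (rootVal a b r) • castMat (zint (rootFiber r)) -
        Real.sin (rootVal a b r) • castMat (zint (rootBase r)) := by
  obtain ⟨h1, h2, h3, h4⟩ := zint_root r
  have e : ∀ X : Mat7, torusElt a b * X - X * torusElt a b =
      a • (castMat (zmat 10) * X - X * castMat (zmat 10)) +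
        b • (castMat (zmat 4) * X - X * castMat (zmat 4)) := by
    intro X
    simp only [torusElt, Matrix.add_mul, Matrix.mul_add, Matrix.smul_mul, Matrix.mul_smul]
    module
  refine conj_exp_of_lie ?_ ?_
  · rw [e, castMat_lie h1, castMat_lie h2, rootVal]
    module
  · rw [e, castMat_lie h3, castMat_lie h4, rootVal]
    push_cast
    module

theorem hMap_eq (a : Fin 8 → ℝ) : hMap a = sigmaMap ![a 0, a 1, a 2] * sMap ![a 3, a 4, a 5] *
    NormedSpace.exp (torusElt (a 6) (a 7)) := by
  have h : zmat 10 * zmat 4 = zmat 4 * zmat 10 := by decide +kernel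
  have hc : Commute (a 6 • castMat (zmat 10)) (a 7 • castMat (zmat 4)) :=
    ((Commute.map h castMat).smul_left _).smul_right _
  rw [torusElt, Matrix.exp_add_of_commute _ _ hc, hMap, ← Matrix.mul_assoc, castMat_zmat,
    castMat_zmat, scal_of_ge (I := 10) (by decide), scal_of_lt (I := 4) (by decide), smul_smul,
    one_smul, mul_comm √3]

theorem coord_castMat_zint (I : Fin 14) (p : Fin 14 → ℤ) :
    coord I (castMat (zint p)) = scal I * p I := by
  simp only [zint, map_sum, map_zsmul, coord_sum, ← Int.cast_smul_eq_zsmul ℝ, coord_smul,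
    castMat_zmat, coord_gen]
  simp [mul_comm]

theorem coord_castMat_zmat (I J : Fin 14) :
    coord I (castMat (zmat J)) = if I = J then scal J else 0 := by
  rw [castMat_zmat, coord_smul, coord_gen, mul_ite, mul_one, mul_zero]

/-- The frame of the fiber in which the currents of Euler angles have the coefficients
`eulerLeft`. -/
def fiberFrame : Fin 6 → Matrix (Fin 7) (Fin 7) ℤ :=
  ![zmat 7, zmat 8, zmat 9, zmat 2, zmat 1, -zmat 0]

/-- Eight times the coefficients of `fiberFrame` in `rootFiber`. -/
def frameCoeff : Matrix (Fin 6) (Fin 6) ℤ :=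
  !![6, 0, 0, 2, 0, 0; -2, 0, 0, 2, 0, 0; 0, 1, 1, 0, 1, -1; 0, 1, -1, 0, -1, -1;
    0, -3, -3, 0, 1, -1; 0, -3, 3, 0, -1, -1]

/-- The factor `8` clears the denominators of the change of basis. -/
theorem fiberFrame_eq (i : Fin 6) :
    (8 : ℤ) • fiberFrame i = ∑ r, frameCoeff r i • zint (rootFiber r) := by
  revert i
  decide +kernel

theorem det_frameCoeff : frameCoeff.det = 1024 := by
  simp [frameCoeff, Matrix.det_succ_row_zero, Fin.sum_univ_succ, Fin.succAbove]

theorem castMat_fiberFrame (i : Fin 6) : castMat (fiberFrame i) =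
    ∑ r, ((1 / 8 : ℝ) * frameCoeff r i) • castMat (zint (rootFiber r)) := by
  have h := congrArg castMat (fiberFrame_eq i)
  simp only [map_sum, map_zsmul, ← Int.cast_smul_eq_zsmul ℝ] at h
  simp only [← smul_smul, ← Finset.smul_sum, ← h]
  rw [smul_smul]
  norm_num

/-- The components of `g⁻¹ dg` along `fiberFrame`, for the product of the Euler angles of the two
factors of the fiber. -/
def frameCurrent (a : Fin 8 → ℝ) : Matrix (Fin 3 ⊕ Fin 3) (Fin 3 ⊕ Fin 3) ℝ :=
  Matrix.fromBlocks (eulerLeft ![a 0, a 1, a 2]) 0 0 (eulerLeft ![a 3, a 4, a 5])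

theorem det_frameCurrent (a : Fin 8 → ℝ) :
    (frameCurrent a).det = Real.sin (2 * a 1) * Real.sin (2 * a 4) := by
  rw [frameCurrent, Matrix.det_fromBlocks_zero₂₁, det_eulerLeft, det_eulerLeft]
  simp

theorem pderiv_hMap_sigma (a : Fin 8 → ℝ) (K : Fin 3) :
    pderiv hMap (Fin.castAdd 2 (Fin.castAdd 3 K)) a = pderiv sigmaMap K ![a 0, a 1, a 2] *
      (sMap ![a 3, a 4, a 5] * NormedSpace.exp (torusElt (a 6) (a 7))) := by
  have := pderiv_of_update entrywiseC1_hMap entrywiseC1_sigmaMap (w := a)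
    (w' := ![a 0, a 1, a 2]) (K := Fin.castAdd 2 (Fin.castAdd 3 K)) (K' := K) (L := 1)
    (R := sMap ![a 3, a 4, a 5] * NormedSpace.exp (torusElt (a 6) (a 7)))
    (by fin_cases K <;> rfl) (fun t => by
      rw [hMap_eq, one_mul, ← Matrix.mul_assoc]
      refine congr_arg₂ _ (congr_arg₂ _ (congrArg _ ?_) (congrArg _ ?_))
        (congrArg _ (congr_arg₂ _ ?_ ?_))
      · ext i
        fin_cases K <;> fin_cases i <;> rfl
      · ext i
        fin_cases K <;> fin_cases i <;> rfl
      · fin_cases K <;> rfl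
      · fin_cases K <;> rfl)
  rwa [one_mul] at this

theorem pderiv_hMap_s (a : Fin 8 → ℝ) (K : Fin 3) :
    pderiv hMap (Fin.castAdd 2 (Fin.natAdd 3 K)) a = sigmaMap ![a 0, a 1, a 2] *
      pderiv sMap K ![a 3, a 4, a 5] * NormedSpace.exp (torusElt (a 6) (a 7)) := by
  refine pderiv_of_update entrywiseC1_hMap entrywiseC1_sMap (w := a)
    (w' := ![a 3, a 4, a 5]) (K := Fin.castAdd 2 (Fin.natAdd 3 K)) (K' := K)
    (by fin_cases K <;> rfl) (fun t => ?_)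
  rw [hMap_eq]
  refine congr_arg₂ _ (congr_arg₂ _ (congrArg _ ?_) (congrArg _ ?_))
    (congrArg _ (congr_arg₂ _ ?_ ?_))
  · ext i
    fin_cases K <;> fin_cases i <;> rfl
  · ext i
    fin_cases K <;> fin_cases i <;> rfl
  · fin_cases K <;> rfl
  · fin_cases K <;> rfl

/-- The torus is abelian and stands at the right end of `h`, so its currents are its own generators,
independent of the point. -/
theorem current_hMap_torus (a : Fin 8 → ℝ) :
    (hMap a)⁻¹ * pderiv hMap 6 a = castMat (zmat 10) ∧
      (hMap a)⁻¹ * pderiv hMap 7 a = castMat (zmat 4) := by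
  have h : zmat 10 * zmat 4 = zmat 4 * zmat 10 := by decide +kernel
  have hc : Commute (castMat (zmat 10)) (castMat (zmat 4)) := Commute.map h castMat
  have hc' : ∀ s t : ℝ, NormedSpace.exp (torusElt s t) =
      NormedSpace.exp (s • castMat (zmat 10)) * NormedSpace.exp (t • castMat (zmat 4)) :=
    fun s t => Matrix.exp_add_of_commute _ _ ((hc.smul_left _).smul_right _)
  have h1 : ∀ s t : ℝ, Commute (castMat (zmat 10)) (NormedSpace.exp (torusElt s t)) :=
    fun s t => (((Commute.refl _).smul_right s).add_right (hc.smul_right t)).exp_right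
  have h2 : ∀ s t : ℝ, Commute (castMat (zmat 4)) (NormedSpace.exp (torusElt s t)) :=
    fun s t => ((hc.symm.smul_right s).add_right ((Commute.refl _).smul_right t)).exp_right
  have hh := isAut_hMap a
  set P := sigmaMap ![a 0, a 1, a 2] * sMap ![a 3, a 4, a 5] with hP
  set E := NormedSpace.exp (a 6 • castMat (zmat 10)) with hE
  set F := NormedSpace.exp (a 7 • castMat (zmat 4)) with hF
  have ha : P * (E * F) = hMap a := by rw [hMap_eq, hc']
  constructor
  · have e : pderiv hMap 6 a = P * (castMat (zmat 10) * E) * F := by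
      refine pderiv_of_update_exp entrywiseC1_hMap fun t => ?_
      rw [hMap_eq, hc', ← Matrix.mul_assoc]
      rfl
    have e' : P * (castMat (zmat 10) * E) * F = P * (castMat (zmat 10) * (E * F)) := by
      simp only [Matrix.mul_assoc]
    rw [e, e', ← hc', (h1 _ _).eq, hc', ← Matrix.mul_assoc P, ha, ← Matrix.mul_assoc, hh.inv_mul,
      Matrix.one_mul]
  · have e : pderiv hMap 7 a = P * E * (castMat (zmat 4) * F) * 1 := by
      refine pderiv_of_update_exp entrywiseC1_hMap fun t => ?_
      rw [hMap_eq, hc', ← Matrix.mul_assoc, Matrix.mul_one]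
      rfl
    have e' : P * E * (F * castMat (zmat 4)) = P * (E * F) * castMat (zmat 4) := by
      simp only [Matrix.mul_assoc]
    rw [e, Matrix.mul_one, exp_comm, e', ha, ← Matrix.mul_assoc, hh.inv_mul, Matrix.one_mul]

/-- With `h = σ s k`, the currents are `k⁻¹ (σ⁻¹ dσ) k`, where `s` has dropped out because it
commutes with `σ⁻¹ dσ`, and `k⁻¹ (s⁻¹ ds) k`. -/
theorem current_hMap_frame (a : Fin 8 → ℝ) (K : Fin 3 ⊕ Fin 3) :
    (hMap a)⁻¹ * pderiv hMap (Fin.castAdd 2 (finSumFinEquiv (m := 3) (n := 3) K)) a =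
      ∑ i, frameCurrent a i K • (NormedSpace.exp (-torusElt (a 6) (a 7)) *
        castMat (fiberFrame (finSumFinEquiv (m := 3) (n := 3) i)) *
          NormedSpace.exp (torusElt (a 6) (a 7))) := by
  rw [hMap_eq, Matrix.mul_inv_rev, Matrix.mul_inv_rev, inv_exp]
  have hA : ∀ i : Fin 3, castMat (fiberFrame (Fin.castAdd 3 i)) = (![castMat (zmat 7),
      castMat (zmat 8), castMat (zmat 9)] : Fin 3 → Mat7) i := by
    intro i
    fin_cases i <;> rfl
  have hB : ∀ i : Fin 3, castMat (fiberFrame (Fin.natAdd 3 i)) = (![castMat (zmat 2),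
      castMat (zmat 1), castMat (-zmat 0)] : Fin 3 → Mat7) i := by
    intro i
    fin_cases i <;> rfl
  set x := ![a 0, a 1, a 2] with hx
  set y := ![a 3, a 4, a 5] with hy
  set k := NormedSpace.exp (torusElt (a 6) (a 7))
  set k' := NormedSpace.exp (-torusElt (a 6) (a 7))
  have hs := isAut_sMap y
  have hsig := isAut_sigmaMap x
  rcases K with K | K
  · have hcomm : Commute (sMap y) ((sigmaMap x)⁻¹ * pderiv sigmaMap K x) := by
      rw [sigmaMap_eq, isQuatTriple_sigma.left]
      refine Commute.sum_right _ _ _ fun i _ => Commute.smul_right ?_ _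
      have h7 : ∀ j, castMat (zmat (sigmaRows j)) = (![castMat (zmat 7),
          castMat (zmat 8), castMat (zmat 9)] : Fin 3 → Mat7) j := by
        intro j
        fin_cases j <;> rfl
      rw [← h7, castMat_zmat]
      exact (commute_sMap_gen y i).smul_right _
    calc _ = k' * ((sMap y)⁻¹ * (((sigmaMap x)⁻¹ * pderiv sigmaMap K x) * sMap y)) * k := by
          rw [finSumFinEquiv_apply_left, pderiv_hMap_sigma]
          simp only [Matrix.mul_assoc]
          rfl
      _ = k' * ((sigmaMap x)⁻¹ * pderiv sigmaMap K x) * k := by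
          rw [← hcomm.eq, ← Matrix.mul_assoc _⁻¹ (sMap y), hs.inv_mul, Matrix.one_mul]
      _ = _ := by
          rw [sigmaMap_eq, isQuatTriple_sigma.left, Finset.mul_sum, Finset.sum_mul,
            Fintype.sum_sum_type]
          simp only [finSumFinEquiv_apply_right, finSumFinEquiv_apply_left, hA]
          simp [frameCurrent, hx]
  · calc _ = k' * ((sMap y)⁻¹ * ((sigmaMap x)⁻¹ * sigmaMap x) * pderiv sMap K y) * k := by
          rw [finSumFinEquiv_apply_right, pderiv_hMap_s]
          simp only [Matrix.mul_assoc]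
          rfl
      _ = k' * ((sMap y)⁻¹ * pderiv sMap K y) * k := by
          rw [hsig.inv_mul, Matrix.mul_one]
      _ = _ := by
          rw [sMap_eq, isQuatTriple_s.left, Finset.mul_sum, Finset.sum_mul,
            Fintype.sum_sum_type]
          simp only [finSumFinEquiv_apply_right, finSumFinEquiv_apply_left, hB]
          simp [frameCurrent, hy]

/-- An ordering of the rows of the base that separates the torus. -/
def baseOrd : Equiv.Perm (Fin 8) where
  toFun := ![0, 5, 2, 3, 6, 7, 4, 1]
  invFun := ![0, 7, 2, 3, 6, 1, 4, 5]
  left_inv := by decide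
  right_inv := by decide

/-- This odd permutation is the source of the minus sign in the final determinant; all other signs
cancel. -/
theorem sign_baseOrd : Equiv.Perm.sign baseOrd = -1 := by
  decide +kernel

/-- The rows of the base orthogonal to the torus. -/
def rootRows : Fin 6 → Fin 14 := ![3, 11, 5, 6, 12, 13]

/-- The coefficients of `rootBase`. -/
def rootCoeff : Matrix (Fin 6) (Fin 6) ℤ := Matrix.of fun i r => rootBase r (rootRows i)

theorem det_rootCoeff : rootCoeff.det = 256 := by
  have : rootCoeff = !![2, 0, 0, 0, 0, 0; 0, -2, 0, 0, 0, 0; 0, 0, -3, -3, -1, -1;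
      0, 0, -3, 3, -1, 1; 0, 0, 1, 1, -1, -1; 0, 0, -1, 1, 1, -1] := by decide
  rw [this]
  simp [Matrix.det_succ_row_zero, Fin.sum_univ_succ, Fin.succAbove]

/-- On a row that no `rootFiber` meets, the cosine part of `conj_torusElt` is invisible and only the
sine part survives. -/
theorem coord_conj_fiberFrame (a b : ℝ) (I : Fin 14) (i : Fin 6)
    (hI : ∀ r, rootFiber r I = 0) :
    coord I (NormedSpace.exp (-torusElt a b) * castMat (fiberFrame i) *
      NormedSpace.exp (torusElt a b)) =
      ∑ r, scal I * rootBase r I * -Real.sin (rootVal a b r) * ((1 / 8 : ℝ) * frameCoeff r i) := by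
  rw [castMat_fiberFrame, Finset.mul_sum, Finset.sum_mul, coord_sum]
  refine Finset.sum_congr rfl fun r _ => ?_
  rw [Matrix.mul_smul, Matrix.smul_mul, coord_smul, conj_torusElt, coord_sub, coord_smul,
    coord_smul, coord_castMat_zint, coord_castMat_zint, hI]
  simp
  ring

/-- The block of the base currents orthogonal to the torus. -/
def rootBlock (a : Fin 8 → ℝ) : Matrix (Fin 6) (Fin 6) ℝ :=
  Matrix.of fun i K => leftCurrent hMap a (rootRows i) (Fin.castAdd 2 K)

/-- A chain of frames, read from right to left: Euler angles to `fiberFrame`, `fiberFrame` to root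
vectors, rotation of each root vector towards its partner by the torus, and partners to the
generators. -/
theorem rootBlock_eq (a : Fin 8 → ℝ) :
    (rootBlock a).submatrix id (finSumFinEquiv (m := 3) (n := 3)) =
      ((Matrix.diagonal fun i => scal (rootRows i)) * rootCoeff.map (Int.castRingHom ℝ) *
        (Matrix.diagonal fun r => -Real.sin (rootVal (a 6) (a 7) r)) *
        ((1 / 8 : ℝ) • frameCoeff.map (Int.castRingHom ℝ))).submatrix id
          (finSumFinEquiv (m := 3) (n := 3)) * frameCurrent a := by
  have h0 : ∀ i r, rootFiber r (rootRows i) = 0 := by decide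
  ext i K
  rw [Matrix.submatrix_apply, id, rootBlock, Matrix.of_apply, leftCurrent, Matrix.of_apply,
    current_hMap_frame, coord_sum, Matrix.mul_apply]
  refine Finset.sum_congr rfl fun j _ => ?_
  rw [coord_smul, coord_conj_fiberFrame _ _ _ _ (h0 i), mul_comm, Matrix.submatrix_apply, id,
    Matrix.mul_apply]
  congr 1
  refine Finset.sum_congr rfl fun r _ => ?_
  rw [Matrix.mul_diagonal, Matrix.diagonal_mul, Matrix.smul_apply]
  rfl

theorem det_rootBlock (a : Fin 8 → ℝ) : (rootBlock a).det =
    3 * √3 * (∏ r, Real.sin (rootVal (a 6) (a 7) r)) *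
      (Real.sin (2 * a 1) * Real.sin (2 * a 4)) := by
  let e := finSumFinEquiv (m := 3) (n := 3)
  set S := (Matrix.diagonal fun i => scal (rootRows i)) * rootCoeff.map (Int.castRingHom ℝ) *
        (Matrix.diagonal fun r => -Real.sin (rootVal (a 6) (a 7) r)) *
        ((1 / 8 : ℝ) • frameCoeff.map (Int.castRingHom ℝ)) with hS
  have h1 : rootBlock a = S * (frameCurrent a).submatrix e.symm e.symm := by
    have h := congrArg (fun M => M.submatrix id e.symm) (rootBlock_eq a)
    simp only [Matrix.submatrix_submatrix] at h
    rw [show (finSumFinEquiv (m := 3) (n := 3) : _ → _) ∘ e.symm = id from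
      funext e.apply_symm_apply, ← Matrix.submatrix_mul_equiv _ _ _ e.symm _,
      Matrix.submatrix_submatrix, show (finSumFinEquiv (m := 3) (n := 3) : _ → _) ∘ e.symm = id from
      funext e.apply_symm_apply] at h
    simp only [Function.comp_id, Matrix.submatrix_id_id] at h
    exact h
  have h2 : ∏ i, scal (rootRows i) = 3 * √3 := by
    have h3 : √(3 : ℝ) * √3 = 3 := Real.mul_self_sqrt (by norm_num)
    simp [Fin.prod_univ_succ, rootRows, scal, zwt, h3, mul_comm]
  have h3 : ∀ M : Matrix (Fin 6) (Fin 6) ℤ, (M.map (Int.castRingHom ℝ)).det = M.det := fun M =>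
    ((Int.castRingHom ℝ).map_det M).symm
  -- The constants satisfy `256 · 1024 = 8⁶`, and the six signs in front of the sines cancel; what
  -- remains is the product `3√3` of the scales.
  rw [h1, Matrix.det_mul, Matrix.det_submatrix_equiv_self, det_frameCurrent, hS, Matrix.det_mul,
    Matrix.det_mul, Matrix.det_mul, Matrix.det_smul, Matrix.det_diagonal, Matrix.det_diagonal, h2,
    h3, h3, det_rootCoeff, det_frameCoeff, Finset.prod_neg]
  simp only [Finset.card_univ, Fintype.card_fin]
  push_cast
  ring

/-- The vectors `rootBase` have no component along the torus, and the torus currents have none along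
the root rows, so the torus splits off with the block `diag(√3, 1)`. -/
theorem baseBein_reindex (a : Fin 8 → ℝ) :
    (baseBein a).submatrix (baseOrd ∘ finSumFinEquiv (m := 6) (n := 2))
        (finSumFinEquiv (m := 6) (n := 2)) =
      Matrix.fromBlocks (rootBlock a) 0 0 (Matrix.diagonal ![√3, 1]) := by
  have hl : ∀ i : Fin 6, baseRows (baseOrd (Fin.castAdd 2 i)) = rootRows i := by decide
  have hr : ∀ i : Fin 2, baseRows (baseOrd (Fin.natAdd 6 i)) = (![10, 4] : Fin 2 → Fin 14) i := by
    decide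
  have hc := current_hMap_torus a
  have hc' : ∀ K : Fin 2, (hMap a)⁻¹ * pderiv hMap (Fin.natAdd 6 K) a =
      castMat (zmat ((![10, 4] : Fin 2 → Fin 14) K)) := by
    intro K
    fin_cases K
    · exact hc.1
    · exact hc.2
  have h0 : ∀ i r, rootFiber r ((![10, 4] : Fin 2 → Fin 14) i) = 0 ∧
      rootBase r ((![10, 4] : Fin 2 → Fin 14) i) = 0 := by decide
  ext i K
  rw [Matrix.submatrix_apply, baseBein, Matrix.submatrix_apply, Function.comp_apply, id]
  rcases i with i | i <;> rcases K with K | K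
  · rw [finSumFinEquiv_apply_left, finSumFinEquiv_apply_left, hl]
    rfl
  · rw [finSumFinEquiv_apply_left, finSumFinEquiv_apply_right, hl, leftCurrent, Matrix.of_apply,
      hc', coord_castMat_zmat, if_neg]
    · rfl
    · revert i K
      decide
  · obtain ⟨K, rfl⟩ := (finSumFinEquiv (m := 3) (n := 3)).surjective K
    rw [finSumFinEquiv_apply_right, finSumFinEquiv_apply_left, hr, leftCurrent, Matrix.of_apply,
      current_hMap_frame, coord_sum]
    refine Finset.sum_eq_zero fun j _ => ?_
    rw [coord_smul, coord_conj_fiberFrame _ _ _ _ fun r => (h0 i r).1]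
    simp [(h0 i _).2]
  · rw [finSumFinEquiv_apply_right, finSumFinEquiv_apply_right, hr, leftCurrent, Matrix.of_apply,
      hc', coord_castMat_zmat, Matrix.fromBlocks_apply₂₂]
    fin_cases i <;> fin_cases K <;> simp [scal, zwt]

theorem det_baseBein (a : Fin 8 → ℝ) : (baseBein a).det =
    -(9 * (∏ r, Real.sin (rootVal (a 6) (a 7) r)) *
      (Real.sin (2 * a 1) * Real.sin (2 * a 4))) := by
  have h : ((baseBein a).submatrix baseOrd id).submatrix (finSumFinEquiv (m := 6) (n := 2))
      (finSumFinEquiv (m := 6) (n := 2)) = _ := baseBein_reindex a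
  have h1 := congrArg Matrix.det h
  rw [Matrix.det_submatrix_equiv_self, Matrix.det_permute, sign_baseOrd,
    Matrix.det_fromBlocks_zero₂₁, det_rootBlock, Matrix.det_diagonal] at h1
  have h3 : √(3 : ℝ) * √3 = 3 := Real.mul_self_sqrt (by norm_num)
  simp only [Fin.prod_univ_two, Matrix.cons_val_zero, Matrix.cons_val_one] at h1
  push_cast at h1
  linear_combination (-1) * h1 - 3 * (∏ r, Real.sin (rootVal (a 6) (a 7) r)) *
      (Real.sin (2 * a 1) * Real.sin (2 * a 4)) * h3

theorem det_leftCurrent_eulerMap_eq (a : Fin 14 → ℝ) :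
    (leftCurrent eulerMap a).det = -eulerDensity a := by
  rw [det_leftCurrent_eulerMap, det_baseBein, det_fiberBein, det_sBein, det_sigmaBein]
  have e1 : (2 * a 7 - 2 * a 6) / 2 = rootVal (a 6) (a 7) 3 := by
    simp [rootVal, rootA, rootB]; ring
  have e2 : (2 * a 7 + 2 * a 6) / 2 = rootVal (a 6) (a 7) 2 := by
    simp [rootVal, rootA, rootB]; ring
  have e3 : (2 * a 7 - 3 * (2 * a 6)) / 2 = rootVal (a 6) (a 7) 4 := by
    simp [rootVal, rootA, rootB]; ring
  have e4 : (2 * a 7 + 3 * (2 * a 6)) / 2 = rootVal (a 6) (a 7) 5 := by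
    simp [rootVal, rootA, rootB]; ring
  have e5 : 2 * a 6 = rootVal (a 6) (a 7) 1 := by
    simp [rootVal, rootA, rootB]
  have e6 : 2 * a 7 = rootVal (a 6) (a 7) 0 := by
    simp [rootVal, rootA, rootB]
  rw [eulerDensity, fFun, e1, e2, e3, e4, e5, e6, Fin.prod_univ_six]
  simp only [baseCoords, fiberCoords, Matrix.cons_val]
  ring

theorem fFun_eq (α β : ℝ) : fFun α β =
    1 / 4 * (Real.cos α - Real.cos β) * (Real.cos (3 * α) - Real.cos β) *
      Real.sin α * Real.sin β := by
  rw [fFun, Real.cos_sub_cos, Real.cos_sub_cos]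
  have e1 : (α - β) / 2 = -((β - α) / 2) := by ring
  have e2 : (3 * α - β) / 2 = -((β - 3 * α) / 2) := by ring
  rw [e1, e2, Real.sin_neg, Real.sin_neg, add_comm α β, add_comm (3 * α) β]
  ring

/-! ### The fiber coordinates lie in SO(4). -/

/-- The involution of the imaginary octonions that fixes the imaginary quaternions. -/
def quatSign : Fin 7 → ℤ := ![1, 1, 1, -1, -1, -1, -1]

theorem commute_quatSign_exp (t : ℝ) (i : Fin 6) :
    Commute (castMat (Matrix.diagonal quatSign)) (NormedSpace.exp (t • gen (fiberRows i))) := by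
  have h : ∀ i : Fin 6, Matrix.diagonal quatSign * zmat (fiberRows i) =
      zmat (fiberRows i) * Matrix.diagonal quatSign := by decide +kernel
  have h1 : Commute (castMat (Matrix.diagonal quatSign)) (castMat (zmat (fiberRows i))) :=
    Commute.map (h i) castMat
  rw [gen_eq_smul_castMat]
  exact ((h1.smul_right _).smul_right _).exp_right

theorem commute_quatSign_uMap (c : Fin 6 → ℝ) :
    Commute (castMat (Matrix.diagonal quatSign)) (uMap c) :=
  (((commute_quatSign_exp _ 2).mul_right (commute_quatSign_exp _ 1)).mul_right
    (commute_quatSign_exp _ 2)).mul_right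
  (((commute_quatSign_exp _ 3).mul_right (commute_quatSign_exp _ 4)).mul_right
    (commute_quatSign_exp _ 3))

/-- A matrix that commutes with the involution preserves its fixed space, the imaginary quaternions.
-/
theorem uMap_mem_SO4 (c : Fin 6 → ℝ) : uMap c ∈ SO4 := by
  refine ⟨(isAut_uMap c).exists_mat, fun y hy => ?_⟩
  have hv : (castMat (Matrix.diagonal quatSign)).mulVec (octIm y) = octIm y := by
    have : castMat (Matrix.diagonal quatSign) = Matrix.diagonal fun i => (quatSign i : ℝ) :=
      Matrix.diagonal_map (map_zero _)
    rw [this]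
    ext i
    rw [Matrix.mulVec_diagonal]
    fin_cases i <;> simp [quatSign, octIm, hy]
  have h : ∀ i, (quatSign i : ℝ) * (uMap c).mulVec (octIm y) i =
      (uMap c).mulVec (octIm y) i := by
    intro i
    have h1 : (castMat (Matrix.diagonal quatSign)).mulVec ((uMap c).mulVec (octIm y)) =
        (uMap c).mulVec (octIm y) := by
      rw [Matrix.mulVec_mulVec, (commute_quatSign_uMap c).eq, ← Matrix.mulVec_mulVec, hv]
    have : castMat (Matrix.diagonal quatSign) = Matrix.diagonal fun i => (quatSign i : ℝ) :=
      Matrix.diagonal_map (map_zero _)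
    rw [this] at h1
    simpa [Matrix.mulVec_diagonal] using congrFun h1 i
  have h0 : ∀ i, quatSign i = -1 → (uMap c).mulVec (octIm y) i = 0 := by
    intro i hi
    have := h i
    rw [hi] at this
    push_cast at this
    linarith
  refine QuaternionAlgebra.ext ?_ ?_ ?_ ?_
  · exact h0 3 (by decide)
  · exact h0 4 (by decide)
  · exact h0 5 (by decide)
  · exact h0 6 (by decide)

-- Topology of G₂ and right invariance of Haar measure.

attribute [local instance] Matrix.linftyOpNormedRing Matrix.linftyOpNormedAlgebra in
theorem isEmbedding_units_val :
    Topology.IsEmbedding (fun A : GL (Fin 7) ℝ => (A : Mat7)) :=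
  Units.isOpenEmbedding_val.isEmbedding

theorem isEmbedding_mat : Topology.IsEmbedding G2.mat :=
  isEmbedding_units_val.comp Topology.IsEmbedding.subtypeVal

theorem continuous_mat : Continuous G2.mat := isEmbedding_mat.continuous

theorem mat_injective : Function.Injective G2.mat := isEmbedding_mat.injective

theorem mat_mul (x y : G2) : G2.mat (x * y) = G2.mat x * G2.mat y := rfl

theorem mat_one : G2.mat 1 = 1 := rfl

theorem mat_inv (x : G2) : G2.mat x⁻¹ = (G2.mat x)⁻¹ := by
  refine (Matrix.inv_eq_left_inv ?_).symm
  rw [← mat_mul, inv_mul_cancel, mat_one]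

theorem range_mat : Set.range G2.mat = {A | IsAut A} := by
  ext A
  exact IsAut.iff_exists.symm

theorem continuous_cross {X : Type*} [TopologicalSpace X] {v w : X → Fin 7 → ℝ}
    (hv : Continuous v) (hw : Continuous w) : Continuous fun x => cross (v x) (w x) :=
  (crossC.continuous.comp hv).clm_apply hw

theorem isClosed_isAut : IsClosed {A : Mat7 | IsAut A} := by
  simp only [IsAut, Set.ofPred_and, Set.ofPred_forall]
  refine (isClosed_iInter fun v => isClosed_iInter fun w => ?_).inter
    (isClosed_iInter fun v => isClosed_iInter fun w => ?_)
  · refine isClosed_eq ?_ continuous_const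
    exact Continuous.dotProduct (Continuous.matrix_mulVec continuous_id continuous_const)
      (Continuous.matrix_mulVec continuous_id continuous_const)
  · exact isClosed_eq (Continuous.matrix_mulVec continuous_id continuous_const)
      (continuous_cross (Continuous.matrix_mulVec continuous_id continuous_const)
      (Continuous.matrix_mulVec continuous_id continuous_const))

theorem IsAut.abs_le_one {A : Mat7} (h : IsAut A) (i j : Fin 7) : |A i j| ≤ 1 := by
  have h1 := congrFun (congrFun h.transpose_mul j) j
  rw [Matrix.mul_apply, Matrix.one_apply_eq] at h1
  have h2 : A i j * A i j ≤ ∑ k, A.transpose j k * A k j :=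
    Finset.single_le_sum (f := fun k => A.transpose j k * A k j)
      (fun k _ => mul_self_nonneg (A k j)) (Finset.mem_univ i)
  rw [h1] at h2
  exact abs_le_one_iff_mul_self_le_one.2 h2

theorem isCompact_isAut : IsCompact {A : Mat7 | IsAut A} := by
  have h : IsCompact (Set.pi Set.univ fun _ : Fin 7 => Set.pi Set.univ fun _ : Fin 7 =>
      Set.Icc (-1 : ℝ) 1) :=
    isCompact_univ_pi fun _ => isCompact_univ_pi fun _ => isCompact_Icc
  refine h.of_isClosed_subset isClosed_isAut fun A hA => ?_
  exact fun i _ j _ => abs_le.1 (IsAut.abs_le_one hA i j)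

theorem isClosedEmbedding_mat : Topology.IsClosedEmbedding G2.mat :=
  ⟨isEmbedding_mat, by rw [range_mat]; exact isClosed_isAut⟩

instance : CompactSpace G2 := by
  refine ⟨isEmbedding_mat.isCompact_iff.2 ?_⟩
  rw [Set.image_univ, range_mat]
  exact isCompact_isAut

instance : PolishSpace G2 := by
  have : PolishSpace Mat7 := inferInstanceAs (PolishSpace (Fin 7 → Fin 7 → ℝ))
  exact isClosedEmbedding_mat.polishSpace

open MeasureTheory

/-- A right translate of `ν` is again left-invariant, hence a multiple of `ν`; the total mass is
finite, nonzero and unchanged, so the multiple is `1`. -/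
theorem measure_preimage_mul_right' (ν : Measure G2) [ν.IsHaarMeasure] (g : G2) {A : Set G2}
    (hA : MeasurableSet A) : ν ((fun x => x * g) ⁻¹' A) = ν A := by
  have h := Measure.isMulLeftInvariant_eq_smul (ν.map (· * g)) ν
  set c := Measure.haarScalarFactor (ν.map (· * g)) ν
  have hm : Measurable (fun x : G2 => x * g) := (continuous_mul_const g).measurable
  have h1 := congrArg (fun m : Measure G2 => m Set.univ) h
  simp only [Measure.map_apply hm MeasurableSet.univ, Set.preimage_univ, Measure.smul_apply] at h1
  have hc : (c : ENNReal) = 1 := by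
    rw [ENNReal.smul_def, smul_eq_mul] at h1
    have : (1 : ENNReal) * ν Set.univ = c * ν Set.univ := by rw [one_mul, ← h1]
    exact ((ENNReal.mul_left_inj (NeZero.ne _) (measure_ne_top _ _)).1 this).symm
  have h2 := congrArg (fun m : Measure G2 => m A) h
  simp only [Measure.map_apply hm hA, Measure.smul_apply, ENNReal.smul_def, smul_eq_mul, hc,
    one_mul] at h2
  exact h2

/-- A continuously differentiable map with injective derivative is locally injective. -/
theorem exists_injOn_of_fderiv_injective {E F : Type*} [NormedAddCommGroup E] [NormedSpace ℝ E]
    [FiniteDimensional ℝ E] [NormedAddCommGroup F] [NormedSpace ℝ F] [FiniteDimensional ℝ F]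
    {f : E → F} {a : E} (hf : ContDiffAt ℝ 1 f a)
    (h : Function.Injective (fderiv ℝ f a)) : ∃ U ∈ nhds a, Set.InjOn f U := by
  have : CompleteSpace E := FiniteDimensional.complete ℝ E
  obtain ⟨S, hS⟩ := (fderiv ℝ f a).toLinearMap.exists_leftInverse_of_injective
    (LinearMap.ker_eq_bot.2 h)
  -- Composing `f` with a linear left inverse of its derivative gives derivative the identity, so
  -- the inverse function theorem applies.
  have hs : HasStrictFDerivAt (fun x => LinearMap.toContinuousLinearMap S (f x))
      ((ContinuousLinearEquiv.refl ℝ E : E ≃L[ℝ] E) : E →L[ℝ] E) a := by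
    have h1 := (LinearMap.toContinuousLinearMap S).hasStrictFDerivAt.comp a
      (hf.hasStrictFDerivAt one_ne_zero)
    convert h1 using 1
    ext v
    exact (LinearMap.congr_fun hS v).symm
  refine ⟨(hs.toOpenPartialHomeomorph _).source,
    (hs.toOpenPartialHomeomorph _).open_source.mem_nhds
      hs.mem_toOpenPartialHomeomorph_source, fun x hx y hy hxy => ?_⟩
  refine (hs.toOpenPartialHomeomorph _).injOn hx hy ?_
  rw [hs.toOpenPartialHomeomorph_coe]
  exact congrArg S hxy

/-! ### A chart at the identity. -/

/-- The coordinates of an element of `G₂` given by the generators. -/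
def chart (x : G2) : Fin 14 → ℝ := coordL (G2.mat x)

/-- The differential of `chart` in the left-invariant frame. -/
def chartJac (x : G2) : Matrix (Fin 14) (Fin 14) ℝ :=
  Matrix.of fun I J => coord I (G2.mat x * gen J)

theorem continuous_coordL : Continuous coordL := by
  refine continuous_pi fun I => ?_
  change Continuous fun X : Mat7 => -(1 / 4) * (gen I * X).trace
  fun_prop

theorem continuous_chart : Continuous chart := continuous_coordL.comp continuous_mat

theorem continuous_det_chartJac : Continuous fun x => (chartJac x).det := by
  refine Continuous.matrix_det (continuous_matrix fun I J => ?_)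
  change Continuous fun x => -(1 / 4) * (gen I * (G2.mat x * gen J)).trace
  have := continuous_mat
  fun_prop

theorem chartJac_one : chartJac 1 = 1 := by
  ext I J
  rw [chartJac, Matrix.of_apply, mat_one, Matrix.one_mul, coord_gen, Matrix.one_apply]

/-- The equations that cut out `G₂`, and the coordinates. -/
def autEqns (A : Mat7) :
    (Fin 7 → Fin 7 → Fin 7 → ℝ) × (Fin 7 → Fin 7 → ℝ) × (Fin 14 → ℝ) :=
  (fun a b => A.mulVec (cross (Pi.single a 1) (Pi.single b 1)) -
      cross (A.mulVec (Pi.single a 1)) (A.mulVec (Pi.single b 1)),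
    fun a b => A.mulVec (Pi.single a 1) ⬝ᵥ A.mulVec (Pi.single b 1), coordL A)

section

attribute [local instance] Matrix.linftyOpNormedRing Matrix.linftyOpNormedAlgebra

theorem contDiff_mulVec (v : Fin 7 → ℝ) : ContDiff ℝ 1 (fun A : Mat7 => A.mulVec v) :=
  (LinearMap.toContinuousLinearMap ((Matrix.mulVecBilin ℝ ℝ).flip v :
    Mat7 →ₗ[ℝ] (Fin 7 → ℝ))).contDiff

theorem contDiff_autEqns : ContDiff ℝ 1 autEqns := by
  refine ContDiff.prodMk ?_ (ContDiff.prodMk ?_ ?_)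
  · refine contDiff_pi.2 fun a => contDiff_pi.2 fun b => ContDiff.sub (contDiff_mulVec _) ?_
    exact (crossC.contDiff.comp (contDiff_mulVec _)).clm_apply (contDiff_mulVec _)
  · refine contDiff_pi.2 fun a => contDiff_pi.2 fun b => ?_
    exact ContDiff.sum fun i _ => (contDiff_pi.1 (contDiff_mulVec _) i).mul
      (contDiff_pi.1 (contDiff_mulVec _) i)
  · exact (LinearMap.toContinuousLinearMap coordL).contDiff

theorem mem_g2Lie_of_single {D : Mat7}
    (h1 : ∀ a b : Fin 7, D.mulVec (Pi.single a 1) ⬝ᵥ Pi.single b 1 +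
      Pi.single a 1 ⬝ᵥ D.mulVec (Pi.single b 1) = 0)
    (h2 : ∀ a b : Fin 7, D.mulVec (cross (Pi.single a 1) (Pi.single b 1)) =
      cross (D.mulVec (Pi.single a 1)) (Pi.single b 1) +
        cross (Pi.single a 1) (D.mulVec (Pi.single b 1))) : D ∈ g2Lie := by
  refine mem_g2Lie_iff.2 ⟨fun v w => ?_, fun v w => ?_⟩
  · have h : D.transpose = -D := by
      ext a b
      have := h1 a b
      simp at this
      simp
      linarith
    rw [Matrix.dotProduct_mulVec, ← Matrix.mulVec_transpose, h, Matrix.neg_mulVec,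
      neg_dotProduct, add_neg_cancel]
  · have h : crossL.compr₂ D.mulVecLin =
        crossL.comp D.mulVecLin + crossL.compl₂ D.mulVecLin :=
      LinearMap.pi_ext' fun a => LinearMap.ext_ring (LinearMap.pi_ext' fun b =>
        LinearMap.ext_ring (h2 a b))
    exact congrFun (congrArg DFunLike.coe (congrFun (congrArg DFunLike.coe h) v)) w

/-- The linearized equations at `1` say that `D` is a derivation, and the last component that its
coordinates vanish; then `D = 0`. -/
theorem fderiv_autEqns_injective : Function.Injective (fderiv ℝ autEqns 1) := by
  refine (injective_iff_map_eq_zero _).2 fun D hD => ?_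
  have hl : HasDerivAt (fun t : ℝ => (1 : Mat7) + t • D) D 0 := by
    have := ((hasDerivAt_id (0 : ℝ)).smul_const D).const_add (1 : Mat7)
    rwa [one_smul] at this
  have h0 : (1 : Mat7) + (0 : ℝ) • D = 1 := by simp
  have hA := hasDerivAt_mat_iff.1 hl
  have h : HasDerivAt (fun t : ℝ => autEqns (1 + t • D)) 0 0 := by
    rw [← hD]
    have : HasFDerivAt autEqns (fderiv ℝ autEqns 1) ((1 : Mat7) + (0 : ℝ) • D) := by
      rw [h0]
      exact (contDiff_autEqns.differentiable one_ne_zero 1).hasFDerivAt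
    exact this.comp_hasDerivAt (0 : ℝ) hl
  have hv : ∀ v, HasDerivAt (fun t : ℝ => ((1 : Mat7) + t • D).mulVec v) (D.mulVec v) 0 :=
    fun v => by simpa using hasDerivAt_mulVec hA (hasDerivAt_const 0 v)
  have e0 : ∀ v, ((1 : Mat7) + (0 : ℝ) • D).mulVec v = v := fun v => by
    rw [h0, Matrix.one_mulVec]
  have h1 := (ContinuousLinearMap.fst ℝ (Fin 7 → Fin 7 → Fin 7 → ℝ)
    ((Fin 7 → Fin 7 → ℝ) × (Fin 14 → ℝ))).hasFDerivAt.comp_hasDerivAt (0 : ℝ) h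
  have h2 := (ContinuousLinearMap.snd ℝ (Fin 7 → Fin 7 → Fin 7 → ℝ)
    ((Fin 7 → Fin 7 → ℝ) × (Fin 14 → ℝ))).hasFDerivAt.comp_hasDerivAt (0 : ℝ) h
  have h3 := (ContinuousLinearMap.fst ℝ (Fin 7 → Fin 7 → ℝ)
    (Fin 14 → ℝ)).hasFDerivAt.comp_hasDerivAt (0 : ℝ) h2
  have h4 := (ContinuousLinearMap.snd ℝ (Fin 7 → Fin 7 → ℝ)
    (Fin 14 → ℝ)).hasFDerivAt.comp_hasDerivAt (0 : ℝ) h2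
  refine eq_zero_of_coord_eq_zero (mem_g2Lie_of_single (fun a b => ?_) fun a b => ?_) fun I => ?_
  · have := hasDerivAt_pi.1 (hasDerivAt_pi.1 h3 a) b
    have h5 := hasDerivAt_dotProduct (hv (Pi.single a 1)) (hv (Pi.single b 1))
    rw [e0, e0] at h5
    exact h5.unique this
  · have := hasDerivAt_pi.1 (hasDerivAt_pi.1 h1 a) b
    have h5 := (hv (cross (Pi.single a 1) (Pi.single b 1))).sub
      (hasDerivAt_cross (hv (Pi.single a 1)) (hv (Pi.single b 1)))
    rw [e0, e0] at h5
    exact sub_eq_zero.1 (h5.unique this)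
  · have h5 := (LinearMap.toContinuousLinearMap coordL).hasFDerivAt.comp_hasDerivAt (0 : ℝ) hl
    exact congrFun (h5.unique h4) I

/-- On G₂ the equations take constant values, so local injectivity of `autEqns` is local injectivity
of `chart`. This avoids any submanifold structure. -/
theorem exists_injOn_chart : ∃ U ∈ nhds (1 : G2), Set.InjOn chart U := by
  obtain ⟨V, hV, hinj⟩ := exists_injOn_of_fderiv_injective
    (contDiff_autEqns.contDiffAt (x := 1)) fderiv_autEqns_injective
  refine ⟨G2.mat ⁻¹' V, continuous_mat.continuousAt.preimage_mem_nhds hV, fun x hx y hy hxy => ?_⟩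
  refine mat_injective (hinj hx hy ?_)
  have hx' := IsAut.mat x
  have hy' := IsAut.mat y
  refine Prod.ext ?_ (Prod.ext ?_ hxy)
  · funext a b
    simp only [autEqns, hx'.2, hy'.2, sub_self]
  · funext a b
    simp only [autEqns, hx'.1, hy'.1]

end

/-- A neighbourhood of `1` on which `chart` is a coordinate system. -/
theorem exists_chart_domain : ∃ W : Set G2, IsOpen W ∧ (1 : G2) ∈ W ∧ Set.InjOn chart W ∧
    ∀ x ∈ W, 1 / 2 < |(chartJac x).det| := by
  obtain ⟨U, hU, hinj⟩ := exists_injOn_chart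
  -- The determinant is `1` at the identity; any positive constant below `1` would serve.
  have h1 : ∀ᶠ x in nhds (1 : G2), 1 / 2 < |(chartJac x).det| := by
    refine continuous_det_chartJac.abs.continuousAt.eventually_const_lt ?_
    change 1 / 2 < |(chartJac 1).det|
    rw [chartJac_one, Matrix.det_one]
    norm_num
  obtain ⟨W, hW, hWo, h1W⟩ := mem_nhds_iff.1 (Filter.inter_mem hU h1)
  exact ⟨W, hWo, h1W, hinj.mono fun x hx => (hW hx).1, fun x hx => (hW hx).2⟩

theorem differentiableAt_coord_mul {n : ℕ} {φ : (Fin n → ℝ) → Mat7} {w : Fin n → ℝ}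
    (hφ : ∀ i j, DifferentiableAt ℝ (fun v => φ v i j) w) (M : Mat7) (I : Fin 14) :
    DifferentiableAt ℝ (fun v => coord I (M * φ v)) w := by
  simp only [coord, Matrix.trace, Matrix.diag_apply, Matrix.mul_apply]
  fun_prop

attribute [local instance] Matrix.linftyOpNormedRing Matrix.linftyOpNormedAlgebra in
theorem fderiv_coord_mul {n : ℕ} {φ : (Fin n → ℝ) → Mat7} {w : Fin n → ℝ}
    (hφ : ∀ i j, DifferentiableAt ℝ (fun v => φ v i j) w) (M : Mat7) (I : Fin 14) (K : Fin n) :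
    fderiv ℝ (fun v => coord I (M * φ v)) w (Pi.single K 1) = coord I (M * pderiv φ K w) := by
  have h1 : HasFDerivAt (fun v => coord I (M * φ v)) (fderiv ℝ (fun v => coord I (M * φ v)) w)
      (Function.update w K (w K)) := by
    rw [Function.update_eq_self]
    exact (differentiableAt_coord_mul hφ M I).hasFDerivAt
  refine (h1.comp_hasDerivAt (w K) (hasDerivAt_update w K (w K))).unique ?_
  have h2 := hasDerivAt_mul_mul (hasDerivAt_pderiv K hφ) M 1
  have h3 := (LinearMap.toContinuousLinearMap coordL).hasFDerivAt.comp_hasDerivAt (w K) h2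
  have h4 := hasDerivAt_pi.1 h3 I
  simp only [mul_one] at h4
  exact h4

/-- The differential of a patch in the coordinates `chart` around `x`. -/
theorem hasFDerivAt_coord_inv_mul {φ : (Fin 14 → ℝ) → Mat7} {w : Fin 14 → ℝ}
    (hφ : ∀ i j, DifferentiableAt ℝ (fun v => φ v i j) w) (h : ∀ᶠ v in nhds w, IsAut (φ v))
    (x : G2) {y : G2} (hy : G2.mat y = φ w) :
    HasFDerivAt (fun v => coordL ((G2.mat x)⁻¹ * φ v))
      (LinearMap.toContinuousLinearMap
        (Matrix.toLin' (chartJac (x⁻¹ * y) * leftCurrent φ w))) w := by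
  refine hasFDerivAt_pi'.2 fun I => ?_
  refine (differentiableAt_coord_mul hφ (G2.mat x)⁻¹ I).hasFDerivAt.congr_fderiv ?_
  apply ContinuousLinearMap.coe_injective
  refine (Pi.basisFun ℝ (Fin 14)).ext fun K => ?_
  rw [Pi.basisFun_apply]
  refine (fderiv_coord_mul hφ (G2.mat x)⁻¹ I K).trans ?_
  have h1 : (G2.mat x)⁻¹ * pderiv φ K w =
      ∑ J, leftCurrent φ w J K • (G2.mat (x⁻¹ * y) * gen J) := by
    have h2 := eq_sum_coord (inv_mul_pderiv_mem K hφ h)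
    have h3 : (G2.mat x)⁻¹ * pderiv φ K w =
        G2.mat (x⁻¹ * y) * ((φ w)⁻¹ * pderiv φ K w) := by
      rw [mat_mul, mat_inv, mul_assoc, ← mul_assoc (G2.mat y), hy, h.self_of_nhds.mul_inv, one_mul]
    rw [h3, h2, Finset.mul_sum]
    exact Finset.sum_congr rfl fun J _ => mul_smul_comm _ _ _
  rw [h1, coord_sum]
  simp [chartJac, coord_smul]
  exact Finset.sum_congr rfl fun J _ => mul_comm _ _

theorem continuousOn_det_leftCurrent {φ : (Fin 14 → ℝ) → Mat7} {U : Set (Fin 14 → ℝ)}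
    (hU : IsOpen U) (hφ : ∀ i j, ContDiffOn ℝ 1 (fun w => φ w i j) U)
    (h : ∀ w ∈ U, IsAut (φ w)) : ContinuousOn (fun w => (leftCurrent φ w).det) U := by
  have h1 : ContinuousOn φ U := continuousOn_pi.2 fun i => continuousOn_pi.2 fun j =>
    (hφ i j).continuousOn
  have h2 : ∀ K, ContinuousOn (fun w => pderiv φ K w) U := fun K =>
    continuousOn_pi.2 fun i => continuousOn_pi.2 fun j =>
      ((hφ i j).continuousOn_fderiv_of_isOpen hU le_rfl).clm_apply continuousOn_const
  have hm : ∀ I, Continuous fun p : Mat7 × Mat7 => coord I (p.1.transpose * p.2) := fun I =>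
    (continuous_apply I).comp
      (continuous_coordL.comp (continuous_fst.matrix_transpose.matrix_mul continuous_snd))
  have h3 : ContinuousOn (fun w => leftCurrent φ w) U :=
    continuousOn_pi.2 fun I => continuousOn_pi.2 fun K => by
      refine ((hm I).comp_continuousOn (h1.prodMk (h2 K))).congr fun w hw => ?_
      -- The inverse of an automorphism is its transpose, which is visibly continuous.
      change coord I ((φ w)⁻¹ * pderiv φ K w) = coord I ((φ w).transpose * pderiv φ K w)
      rw [(h w hw).inv_eq]
  have hd : Continuous fun M : Matrix (Fin 14) (Fin 14) ℝ => M.det := continuous_id.matrix_det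
  exact hd.comp_continuousOn h3

/-! ### The Haar measure of a patch. -/

open MeasureTheory

/-- The Lebesgue measure of the coordinates `chart` on `W`. -/
def chartMeasure (W : Set G2) : Measure G2 :=
  ((volume : Measure (Fin 14 → ℝ)).comap (W.domRestrict chart)).map Subtype.val

theorem measurableEmbedding_chart {W : Set G2} (hW : IsOpen W) (hinj : Set.InjOn chart W) :
    MeasurableEmbedding (W.domRestrict chart) :=
  continuous_chart.continuousOn.measurableEmbedding hW.measurableSet hinj

theorem chartMeasure_apply {W : Set G2} (hW : IsOpen W) (hinj : Set.InjOn chart W) {B : Set G2}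
    (hB : MeasurableSet B) : chartMeasure W B = volume (chart '' (W ∩ B)) := by
  rw [chartMeasure, Measure.map_apply measurable_subtype_coe hB,
    (measurableEmbedding_chart hW hinj).comap_apply]
  congr 1
  ext v
  constructor
  · rintro ⟨p, hp, rfl⟩
    exact ⟨p, ⟨p.2, hp⟩, rfl⟩
  · rintro ⟨p, hp, rfl⟩
    exact ⟨⟨p, hp.1⟩, hp.2, rfl⟩

theorem isFiniteMeasure_chartMeasure {W : Set G2} (hW : IsOpen W) (hinj : Set.InjOn chart W) :
    IsFiniteMeasure (chartMeasure W) := by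
  refine ⟨?_⟩
  rw [chartMeasure_apply hW hinj MeasurableSet.univ]
  exact (measure_mono (Set.image_subset_range _ _)).trans_lt
    (isCompact_range continuous_chart).measure_lt_top

/-- Tonelli for the set of `(x, p)` with `x p ∈ A`: for fixed `p` its slice has measure `ν A` by
right invariance. -/
theorem lintegral_chartMeasure_preimage {W : Set G2} (hW : IsOpen W) (hinj : Set.InjOn chart W)
    (ν : Measure G2) [ν.IsHaarMeasure] {A : Set G2} (hA : MeasurableSet A) :
    ∫⁻ x, chartMeasure W ((fun p => x * p) ⁻¹' A) ∂ν = chartMeasure W Set.univ * ν A := by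
  have := isFiniteMeasure_chartMeasure hW hinj
  have hm : MeasurableSet ((fun q : G2 × G2 => q.1 * q.2) ⁻¹' A) := measurable_mul hA
  refine (Measure.prod_apply (μ := ν) (ν := chartMeasure W) hm).symm.trans ?_
  rw [Measure.prod_apply_symm hm]
  have h : ∀ p : G2, ν ((fun x => (x, p)) ⁻¹' ((fun q : G2 × G2 => q.1 * q.2) ⁻¹' A)) = ν A :=
    fun p => measure_preimage_mul_right' ν p hA
  simp only [h, lintegral_const, mul_comm]

/-- A patch as a map to the group. -/
theorem exists_lift {φ : (Fin 14 → ℝ) → Mat7} {U : Set (Fin 14 → ℝ)} (hU : IsOpen U)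
    (hφ : ContinuousOn φ U) (h : ∀ w ∈ U, IsAut (φ w)) :
    ∃ Φ : (Fin 14 → ℝ) → G2, Measurable Φ ∧ ContinuousOn Φ U ∧ ∀ w ∈ U, G2.mat (Φ w) = φ w := by
  classical
  have h' : ∀ w, ∃ x : G2, w ∈ U → G2.mat x = φ w := fun w => by
    by_cases hw : w ∈ U
    · obtain ⟨x, hx⟩ := (h w hw).exists_mat
      exact ⟨x, fun _ => hx⟩
    · exact ⟨1, fun h => absurd h hw⟩
  choose Ψ hΨ using h'
  have hc : ContinuousOn Ψ U := isEmbedding_mat.continuousOn_iff.2 (hφ.congr hΨ)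
  have e : Set.EqOn (U.piecewise Ψ fun _ => 1) Ψ U := Set.piecewise_eqOn _ _ _
  -- The arbitrary value `1` outside `U` makes the lift measurable everywhere.
  exact ⟨U.piecewise Ψ fun _ => 1,
    hc.measurable_piecewise continuousOn_const hU.measurableSet, hc.congr e,
    fun w hw => by rw [e hw]; exact hΨ w hw⟩

/-- The density of a translate of the coordinates `chart`. -/
def chartDensity (W : Set G2) (x : G2) : ENNReal :=
  W.indicator (fun y => ENNReal.ofReal |(chartJac y).det|) x

theorem measurable_chartDensity {W : Set G2} (hW : IsOpen W) : Measurable (chartDensity W) :=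
  (continuous_det_chartJac.abs.measurable.ennreal_ofReal).indicator hW.measurableSet

/-- Change of variables for `w ↦ chart (x⁻¹ Φ(w))`, whose differential is `chartJac` times the
current; `chartDensity` vanishes where `x⁻¹ Φ(w)` leaves `W`. -/
theorem chartMeasure_preimage_patch {W : Set G2} (hW : IsOpen W) (hinj : Set.InjOn chart W)
    {φ : (Fin 14 → ℝ) → Mat7} {U E : Set (Fin 14 → ℝ)} (hU : IsOpen U)
    (hφ : ∀ i j, ContDiffOn ℝ 1 (fun w => φ w i j) U) (h : ∀ w ∈ U, IsAut (φ w))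
    (hEU : E ⊆ U) (hE : MeasurableSet E) {Φ : (Fin 14 → ℝ) → G2} (hΦm : Measurable Φ)
    (hΦ : ∀ w ∈ U, G2.mat (Φ w) = φ w) (hΦE : Set.InjOn Φ E)
    (hA : MeasurableSet (Φ '' E)) (x : G2) :
    chartMeasure W ((fun p => x * p) ⁻¹' (Φ '' E)) =
      ∫⁻ w in E, chartDensity W (x⁻¹ * Φ w) * ENNReal.ofReal |(leftCurrent φ w).det| := by
  have hx : Measurable fun p => x * p := measurable_const_mul x
  have hx' : Measurable fun w => x⁻¹ * Φ w := (measurable_const_mul x⁻¹).comp hΦm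
  rw [chartMeasure_apply hW hinj (hx hA)]
  set s : Set (Fin 14 → ℝ) := (fun w => x⁻¹ * Φ w) ⁻¹' W ∩ E with hs
  have hsm : MeasurableSet s := (hx' hW.measurableSet).inter hE
  have hf : ∀ w ∈ U, coordL ((G2.mat x)⁻¹ * φ w) = chart (x⁻¹ * Φ w) := fun w hw => by
    rw [chart, mat_mul, mat_inv, hΦ w hw]
  have himg : chart '' (W ∩ (fun p => x * p) ⁻¹' (Φ '' E)) =
      (fun w => coordL ((G2.mat x)⁻¹ * φ w)) '' s := by
    ext v
    constructor
    · rintro ⟨p, ⟨hp, w, hw, hwp⟩, rfl⟩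
      have e : x⁻¹ * Φ w = p := by rw [hwp, inv_mul_cancel_left]
      exact ⟨w, ⟨by rw [Set.mem_preimage, e]; exact hp, hw⟩, by
        change coordL _ = _
        rw [hf w (hEU hw), e]⟩
    · rintro ⟨w, ⟨hw, hwE⟩, rfl⟩
      exact ⟨x⁻¹ * Φ w, ⟨hw, w, hwE, (mul_inv_cancel_left x (Φ w)).symm⟩, (hf w (hEU hwE)).symm⟩
  have hd : ∀ w ∈ s, HasFDerivWithinAt (fun v => coordL ((G2.mat x)⁻¹ * φ v))
      (LinearMap.toContinuousLinearMap
        (Matrix.toLin' (chartJac (x⁻¹ * Φ w) * leftCurrent φ w))) s w := fun w hw => by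
    have hwU := hU.mem_nhds (hEU hw.2)
    exact (hasFDerivAt_coord_inv_mul
      (fun i j => ((hφ i j).contDiffAt hwU).differentiableAt one_ne_zero)
      (Filter.eventually_of_mem hwU h) x (hΦ w (hEU hw.2))).hasFDerivWithinAt
  have hsinj : Set.InjOn (fun w => coordL ((G2.mat x)⁻¹ * φ w)) s := fun v hv w hw hvw => by
    refine hΦE hv.2 hw.2 (mul_left_cancel (hinj hv.1 hw.1 ?_))
    rw [← hf v (hEU hv.2), ← hf w (hEU hw.2)]
    exact hvw
  rw [himg, ← lintegral_abs_det_fderiv_eq_addHaar_image volume hsm hd hsinj, hs,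
    ← Measure.restrict_restrict (hx' hW.measurableSet),
    ← lintegral_indicator (hx' hW.measurableSet)]
  refine lintegral_congr fun w => ?_
  by_cases hw : x⁻¹ * Φ w ∈ W
  · rw [Set.indicator_of_mem (by exact hw), chartDensity, Set.indicator_of_mem hw,
      ← ENNReal.ofReal_mul (abs_nonneg _), ← abs_mul, ← Matrix.det_mul, ContinuousLinearMap.det,
      LinearMap.coe_toContinuousLinearMap, LinearMap.det_toLin']
  · rw [Set.indicator_of_notMem (by exact hw), chartDensity, Set.indicator_of_notMem hw, zero_mul]

/-- The mass of the translates of the coordinates `chart`. -/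
def chartMass (W : Set G2) (ν : Measure G2) : ENNReal := ∫⁻ x, chartDensity W x⁻¹ ∂ν

theorem chartMass_ne_top (W : Set G2) (ν : Measure G2) [IsFiniteMeasure ν] :
    chartMass W ν ≠ ⊤ := by
  obtain ⟨C, hC⟩ := (isCompact_range continuous_det_chartJac.abs).bddAbove
  refine (lt_of_le_of_lt (lintegral_mono (g := fun _ => ENNReal.ofReal C) fun x => ?_) ?_).ne
  · refine (Set.indicator_le_self W _ _).trans (ENNReal.ofReal_le_ofReal (hC ⟨x⁻¹, rfl⟩))
  · rw [lintegral_const]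
    exact ENNReal.mul_lt_top ENNReal.ofReal_lt_top (measure_lt_top ν _)

theorem chartMass_ne_zero {W : Set G2} (hW : IsOpen W) (h1 : (1 : G2) ∈ W)
    (hdet : ∀ x ∈ W, 1 / 2 < |(chartJac x).det|) (ν : Measure G2) [ν.IsHaarMeasure] :
    chartMass W ν ≠ 0 := by
  intro h
  have hm : Measurable fun x : G2 => chartDensity W x⁻¹ :=
    (measurable_chartDensity hW).comp measurable_inv
  rw [chartMass, lintegral_eq_zero_iff hm] at h
  have ho : IsOpen ((fun x : G2 => x⁻¹) ⁻¹' W) := hW.preimage continuous_inv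
  refine (ho.measure_pos ν ⟨1, by simpa using h1⟩).ne' ?_
  refine measure_mono_null (fun x hx => ?_) h
  change ¬ chartDensity W x⁻¹ = 0
  rw [chartDensity, Set.indicator_of_mem (by exact hx), ENNReal.ofReal_eq_zero, not_le]
  exact lt_trans (by norm_num) (hdet _ hx)

theorem setOf_mat_mem_image {φ : (Fin 14 → ℝ) → Mat7} {E : Set (Fin 14 → ℝ)}
    {Φ : (Fin 14 → ℝ) → G2} (hΦ : ∀ w ∈ E, G2.mat (Φ w) = φ w) :
    {x : G2 | G2.mat x ∈ φ '' E} = Φ '' E := by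
  ext x
  constructor
  · rintro ⟨w, hw, hx⟩
    exact ⟨w, hw, mat_injective ((hΦ w hw).trans hx)⟩
  · rintro ⟨w, hw, rfl⟩
    exact ⟨w, hw, (hΦ w hw).symm⟩

/-- The Haar measure of a patch, up to a normalization that does not depend on the patch. -/
theorem haar_patch {W : Set G2} (hW : IsOpen W) (hinj : Set.InjOn chart W)
    (ν : Measure G2) [ν.IsHaarMeasure]
    {φ : (Fin 14 → ℝ) → Mat7} {U E : Set (Fin 14 → ℝ)} (hU : IsOpen U)
    (hφ : ∀ i j, ContDiffOn ℝ 1 (fun w => φ w i j) U) (h : ∀ w ∈ U, IsAut (φ w))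
    (hEU : E ⊆ U) (hE : MeasurableSet E) (hφE : Set.InjOn φ E) :
    chartMeasure W Set.univ * ν {x : G2 | G2.mat x ∈ φ '' E} =
      chartMass W ν * ∫⁻ w in E, ENNReal.ofReal |(leftCurrent φ w).det| := by
  have hc : ContinuousOn φ U := continuousOn_pi.2 fun i => continuousOn_pi.2 fun j =>
    (hφ i j).continuousOn
  obtain ⟨Φ, hΦm, hΦc, hΦ⟩ := exists_lift hU hc h
  have hΦE : Set.InjOn Φ E := fun v hv w hw hvw => hφE hv hw (by
    rw [← hΦ v (hEU hv), ← hΦ w (hEU hw), hvw])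
  have hA : MeasurableSet (Φ '' E) := hE.image_of_continuousOn_injOn (hΦc.mono hEU) hΦE
  have hJ : AEMeasurable (fun w => ENNReal.ofReal |(leftCurrent φ w).det|)
      (volume.restrict E) :=
    ((((continuousOn_det_leftCurrent hU hφ h).abs.aemeasurable hU.measurableSet).mono_measure
      (Measure.restrict_mono hEU le_rfl))).ennreal_ofReal
  rw [setOf_mat_mem_image fun w hw => hΦ w (hEU hw),
    ← lintegral_chartMeasure_preimage hW hinj ν hA]
  simp only [chartMeasure_preimage_patch hW hinj hU hφ h hEU hE hΦm hΦ hΦE hA]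
  have hF : Measurable fun q : G2 × (Fin 14 → ℝ) => chartDensity W (q.1⁻¹ * Φ q.2) :=
    (measurable_chartDensity hW).comp
      (measurable_fst.inv.mul (hΦm.comp measurable_snd))
  -- The averages over translates are integrated over the group first, for fixed `w`.
  rw [lintegral_lintegral_swap (hF.aemeasurable.mul hJ.comp_snd), ← lintegral_const_mul'' _ hJ]
  refine lintegral_congr fun w => ?_
  have hF' : Measurable fun x : G2 => chartDensity W (x⁻¹ * Φ w) :=
    (measurable_chartDensity hW).comp (measurable_inv.mul_const _)
  -- The substitution `x ↦ Φ(w) x` removes `w` from the density, by left invariance.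
  rw [lintegral_mul_const _ hF', chartMass,
    ← lintegral_mul_left_eq_self (fun x => chartDensity W (x⁻¹ * Φ w)) (Φ w)]
  simp

/-! ### Normalization on an Euler patch and the final formula. -/

open MeasureTheory

theorem continuous_eulerDensity : Continuous eulerDensity := by
  unfold eulerDensity fFun
  fun_prop

theorem exists_eulerDensity_ne_zero : ∃ a, eulerDensity a ≠ 0 := by
  -- The four angles in the sines make these equal to `1`. With `α = π/2` and `β = π/3` both `cos α`
  -- and `cos 3α` vanish while `cos β = 1/2`, so no factor of `f` is zero.
  refine ⟨![0, Real.pi / 4, 0, 0, Real.pi / 4, 0, Real.pi / 4, Real.pi / 6, 0, Real.pi / 4, 0, 0,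
    Real.pi / 4, 0], ?_⟩
  have e1 : 2 * (Real.pi / 4) = Real.pi / 2 := by ring
  have e2 : 2 * (Real.pi / 6) = Real.pi / 3 := by ring
  have e3 : Real.cos (3 * (Real.pi / 2)) = 0 := by
    rw [Real.cos_three_mul, Real.cos_pi_div_two]
    norm_num
  change 27 * √3 * fFun (2 * (Real.pi / 4)) (2 * (Real.pi / 6)) * Real.sin (2 * (Real.pi / 4)) *
    Real.sin (2 * (Real.pi / 4)) * Real.sin (2 * (Real.pi / 4)) * Real.sin (2 * (Real.pi / 4)) ≠ 0
  rw [fFun_eq, e1, e2, e3, Real.cos_pi_div_two, Real.sin_pi_div_two, Real.cos_pi_div_three,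
    Real.sin_pi_div_three]
  norm_num

/-- A patch of Euler coordinates. -/
theorem exists_eulerMap_patch : ∃ U : Set (Fin 14 → ℝ), IsOpen U ∧ U.Nonempty ∧
    Set.InjOn eulerMap U ∧ ∀ a ∈ U, eulerDensity a ≠ 0 := by
  obtain ⟨a, ha⟩ := exists_eulerDensity_ne_zero
  obtain ⟨x, hx⟩ := (isAut_eulerMap a).exists_mat
  have hd := hasFDerivAt_coord_inv_mul (entrywiseC1_eulerMap.differentiableAt a)
    (Filter.Eventually.of_forall isAut_eulerMap) x hx
  have hc : ContDiffAt ℝ 1 (fun v => coordL ((G2.mat x)⁻¹ * eulerMap v)) a := by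
    refine contDiffAt_pi.2 fun I => ?_
    change ContDiffAt ℝ 1 (fun v => coord I ((G2.mat x)⁻¹ * eulerMap v)) a
    simp only [coord, Matrix.trace, Matrix.diag_apply, Matrix.mul_apply]
    refine contDiffAt_const.mul (ContDiffAt.sum fun i _ => ContDiffAt.sum fun j _ =>
      contDiffAt_const.mul (ContDiffAt.sum fun k _ => contDiffAt_const.mul ?_))
    exact (entrywiseC1_eulerMap k i).contDiffAt
  have hinj : Function.Injective
      (fderiv ℝ (fun v => coordL ((G2.mat x)⁻¹ * eulerMap v)) a) := by
    -- In the chart centred at the point itself `chartJac` is the identity, so the derivative is the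
    -- current.
    rw [hd.fderiv, inv_mul_cancel, chartJac_one, one_mul]
    change Function.Injective (leftCurrent eulerMap a).mulVec
    rw [Matrix.mulVec_injective_iff_isUnit, Matrix.isUnit_iff_isUnit_det, isUnit_iff_ne_zero,
      det_leftCurrent_eulerMap_eq]
    exact neg_ne_zero.2 ha
  obtain ⟨V, hV, hVinj⟩ := exists_injOn_of_fderiv_injective hc hinj
  refine ⟨interior V ∩ {a | eulerDensity a ≠ 0},
    isOpen_interior.inter (isOpen_ne_fun continuous_eulerDensity continuous_const),
    ⟨a, mem_interior_iff_mem_nhds.2 hV, ha⟩, fun v hv w hw hvw => ?_, fun w hw => hw.2⟩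
  exact hVinj (interior_subset hv.1) (interior_subset hw.1) (by simp only [hvw])

theorem lintegral_eulerDensity_pos {U : Set (Fin 14 → ℝ)} (hU : IsOpen U) (hne : U.Nonempty)
    (h : ∀ a ∈ U, eulerDensity a ≠ 0) :
    0 < ∫⁻ a in U, ENNReal.ofReal |eulerDensity a| := by
  rw [setLIntegral_pos_iff continuous_eulerDensity.abs.measurable.ennreal_ofReal,
    Set.inter_eq_right.2]
  · exact hU.measure_pos volume hne
  · intro a ha
    exact (ENNReal.ofReal_pos.2 (abs_pos.2 (h a ha))).ne'

theorem haar_eulerMap {W : Set G2} (hW : IsOpen W) (hinj : Set.InjOn chart W)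
    (ν : Measure G2) [ν.IsHaarMeasure] {E : Set (Fin 14 → ℝ)} (hE : MeasurableSet E)
    (hE' : Set.InjOn eulerMap E) :
    chartMeasure W Set.univ * ν {x : G2 | G2.mat x ∈ eulerMap '' E} =
      chartMass W ν * ∫⁻ a in E, ENNReal.ofReal |eulerDensity a| := by
  have := haar_patch hW hinj ν isOpen_univ (fun i j => (entrywiseC1_eulerMap i j).contDiffOn)
    (fun w _ => isAut_eulerMap w) E.subset_univ hE hE'
  simpa only [det_leftCurrent_eulerMap_eq, abs_neg] using this

theorem IsBeinVolume.apply_patch {μ : Measure G2} (h : IsBeinVolume μ)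
    {U : Set (Fin 14 → ℝ)} (hU : IsOpen U) (hinj : Set.InjOn eulerMap U)
    (hd : ∀ a ∈ U, eulerDensity a ≠ 0) :
    μ {x : G2 | G2.mat x ∈ eulerMap '' U} = ∫⁻ a in U, ENNReal.ofReal |eulerDensity a| := by
  have := h U eulerMap hU (fun i j => (entrywiseC1_eulerMap i j).contDiffOn)
    (fun w _ => (isAut_eulerMap w).exists_mat) hinj
    (fun w hw => by rw [det_leftCurrent_eulerMap_eq]; exact neg_ne_zero.2 (hd w hw)) U le_rfl
    hU.measurableSet
  simpa only [det_leftCurrent_eulerMap_eq, abs_neg] using this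

theorem exists_beinVolume : ∃ μ : Measure G2, μ.IsHaarMeasure ∧ IsBeinVolume μ := by
  obtain ⟨W, hW, h1, hinj, hdet⟩ := exists_chart_domain
  obtain ⟨U, hU, hne, hUinj, hUd⟩ := exists_eulerMap_patch
  have hm0 := chartMass_ne_zero hW h1 hdet Measure.haar
  have hmt := chartMass_ne_top W Measure.haar
  have hct := (isFiniteMeasure_chartMeasure hW hinj).measure_univ_lt_top.ne
  -- If the chart had no mass, `haar_eulerMap` would give volume zero to a patch on which the
  -- density is positive.
  have hc0 : chartMeasure W Set.univ ≠ 0 := by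
    intro h0
    have h2 := haar_eulerMap hW hinj Measure.haar hU.measurableSet hUinj
    rw [h0, zero_mul] at h2
    exact mul_ne_zero hm0 (lintegral_eulerDensity_pos hU hne hUd).ne' h2.symm
  refine ⟨((chartMass W Measure.haar)⁻¹ * chartMeasure W Set.univ) • Measure.haar,
    Measure.IsHaarMeasure.smul _ (mul_ne_zero (ENNReal.inv_ne_zero.2 hmt) hc0)
      (ENNReal.mul_ne_top (ENNReal.inv_ne_top.2 hm0) hct), ?_⟩
  intro V φ hV hφ hmat hφinj _ E hEV hE
  rw [Measure.smul_apply, smul_eq_mul, mul_assoc,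
    haar_patch hW hinj Measure.haar hV hφ (fun w hw => IsAut.iff_exists.2 (hmat w hw)) hEV hE
      (hφinj.mono hEV), ← mul_assoc, ENNReal.inv_mul_cancel hm0 hmt, one_mul]

/-- Two Haar measures are proportional, and these two agree on an Euler patch of finite positive
volume. -/
theorem IsBeinVolume.unique {μ ν : Measure G2} [μ.IsHaarMeasure] [ν.IsHaarMeasure]
    (hμ : IsBeinVolume μ) (hν : IsBeinVolume ν) : μ = ν := by
  obtain ⟨U, hU, hne, hUinj, hUd⟩ := exists_eulerMap_patch
  have hI := lintegral_eulerDensity_pos hU hne hUd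
  have h := Measure.isMulLeftInvariant_eq_smul μ ν
  set c := Measure.haarScalarFactor μ ν
  have h1 := hν.apply_patch hU hUinj hUd
  have hI' := h1 ▸ measure_ne_top ν {x : G2 | G2.mat x ∈ eulerMap '' U}
  have h2 := hμ.apply_patch hU hUinj hUd
  rw [h, Measure.smul_apply, ENNReal.smul_def, smul_eq_mul, h1] at h2
  have hc : (c : ENNReal) = 1 :=
    (ENNReal.mul_left_inj hI.ne' hI').1 (h2.trans (one_mul _).symm)
  rw [h, ENNReal.coe_eq_one.1 hc, one_smul]

theorem existsUnique_beinVolume : ∃! μ : Measure G2, μ.IsHaarMeasure ∧ IsBeinVolume μ := by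
  obtain ⟨μ, h1, h2⟩ := exists_beinVolume
  refine ⟨μ, ⟨h1, h2⟩, ?_⟩
  rintro ν ⟨h3, h4⟩
  exact IsBeinVolume.unique h4 h2

/-- The volume measure in Euler coordinates. -/
theorem IsBeinVolume.apply_eulerMap_image {μ : Measure G2} [μ.IsHaarMeasure]
    (hμ : IsBeinVolume μ) {E : Set (Fin 14 → ℝ)} (hE : MeasurableSet E)
    (hinj : Set.InjOn eulerMap E) :
    μ {x : G2 | G2.mat x ∈ eulerMap '' E} = ∫⁻ a in E, ENNReal.ofReal |eulerDensity a| := by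
  obtain ⟨W, hW, h1, hWinj, hdet⟩ := exists_chart_domain
  obtain ⟨U, hU, hne, hUinj, hUd⟩ := exists_eulerMap_patch
  have hI := lintegral_eulerDensity_pos hU hne hUd
  have h2 := hμ.apply_patch hU hUinj hUd
  have hI' := h2 ▸ measure_ne_top μ {x : G2 | G2.mat x ∈ eulerMap '' U}
  have h3 := haar_eulerMap hW hWinj μ hU.measurableSet hUinj
  rw [h2] at h3
  -- The patch `U` shows that the two normalizing constants coincide. They then cancel for any `E`,
  -- including sets that meet the zeros of the density.
  have h4 := (ENNReal.mul_left_inj hI.ne' hI').1 h3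
  have h5 := haar_eulerMap hW hWinj μ hE hinj
  rw [h4] at h5
  exact (ENNReal.mul_right_inj (chartMass_ne_zero hW h1 hdet μ) (chartMass_ne_top W μ)).1 h5

end G2Euler

end

/-- The Haar measure of `G₂` in Euler coordinates. -/
theorem mainTheorem3 :
    -- the generators are a basis of the Lie algebra, orthonormal for the normalized Killing form
    (∃ B : Module.Basis (Fin 14) ℝ G2Euler.g2Lie,
      (∀ I, (B I : G2Euler.Mat7) = G2Euler.gen I) ∧
      ∀ I J, -(1 / 16 : ℝ) * killingForm ℝ G2Euler.g2Lie (B I) (B J) = if I = J then 1 else 0) ∧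
    -- the coordinates take values in `G₂`, those of the fiber in `SO(4)`
    (∀ a : Fin 14 → ℝ, ∃ x : G2Euler.G2, G2Euler.G2.mat x = G2Euler.eulerMap a) ∧
    (∀ c : Fin 6 → ℝ, G2Euler.uMap c ∈ G2Euler.SO4) ∧
    -- the currents are combinations of the generators with the stated coefficients
    (∀ (a : Fin 14 → ℝ) (K : Fin 14),
      (G2Euler.eulerMap a)⁻¹ * G2Euler.pderiv G2Euler.eulerMap K a =
        ∑ I, G2Euler.leftCurrent G2Euler.eulerMap a I K • G2Euler.gen I) ∧
    (∀ (a : Fin 8 → ℝ) (K : Fin 8),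
      (G2Euler.hMap a)⁻¹ * G2Euler.pderiv G2Euler.hMap K a =
        ∑ I, G2Euler.leftCurrent G2Euler.hMap a I K • G2Euler.gen I) ∧
    (∀ (c : Fin 6 → ℝ) (K : Fin 6),
      G2Euler.pderiv G2Euler.uMap K c * (G2Euler.uMap c)⁻¹ =
        ∑ i, G2Euler.fiberBein c i K • G2Euler.gen (G2Euler.fiberRows i)) ∧
    (∀ (x : Fin 3 → ℝ) (K : Fin 3),
      G2Euler.pderiv G2Euler.sMap K x * (G2Euler.sMap x)⁻¹ =
        ∑ i, G2Euler.sBein x i K • G2Euler.gen (G2Euler.sRows i)) ∧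
    (∀ (x : Fin 3 → ℝ) (K : Fin 3),
      G2Euler.pderiv G2Euler.sigmaMap K x * (G2Euler.sigmaMap x)⁻¹ =
        ∑ i, G2Euler.sigmaBein x i K • G2Euler.gen (G2Euler.sigmaRows i)) ∧
    -- the Jacobian determinant factors into the base part and the fiber part
    (∀ a : Fin 14 → ℝ,
      (G2Euler.leftCurrent G2Euler.eulerMap a).det =
        (G2Euler.baseBein (G2Euler.baseCoords a)).det *
          (G2Euler.fiberBein (G2Euler.fiberCoords a)).det) ∧
    (∀ c : Fin 6 → ℝ,
      (G2Euler.fiberBein c).det =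
        (G2Euler.sBein ![c 0, c 1, c 2]).det * (G2Euler.sigmaBein ![c 3, c 4, c 5]).det) ∧
    -- its value; the sign is that of the order in which the coordinates are taken
    (∀ a : Fin 14 → ℝ,
      (G2Euler.leftCurrent G2Euler.eulerMap a).det = -G2Euler.eulerDensity a) ∧
    (∀ α β : ℝ, G2Euler.fFun α β =
      1 / 4 * (Real.cos α - Real.cos β) * (Real.cos (3 * α) - Real.cos β) *
        Real.sin α * Real.sin β) ∧
    -- the `14`-bein defines a unique Haar measure, and this is its form in the coordinates
    (∃! μ : MeasureTheory.Measure G2Euler.G2,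
      μ.IsHaarMeasure ∧ G2Euler.IsBeinVolume μ) ∧
    (∀ μ : MeasureTheory.Measure G2Euler.G2,
      μ.IsHaarMeasure → G2Euler.IsBeinVolume μ →
        ∀ E : Set (Fin 14 → ℝ), MeasurableSet E → Set.InjOn G2Euler.eulerMap E →
          μ {x : G2Euler.G2 | G2Euler.G2.mat x ∈ G2Euler.eulerMap '' E} =
            ∫⁻ a in E, ENNReal.ofReal |G2Euler.eulerDensity a|) := by
  refine ⟨⟨G2Euler.genBasis, G2Euler.genBasis_coe, G2Euler.killingForm_genBasis⟩,
    fun a => (G2Euler.isAut_eulerMap a).exists_mat, G2Euler.uMap_mem_SO4,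
    G2Euler.leftCurrent_eulerMap_spec, G2Euler.leftCurrent_hMap_spec, G2Euler.fiberBein_spec,
    G2Euler.sBein_spec, G2Euler.sigmaBein_spec, G2Euler.det_leftCurrent_eulerMap,
    G2Euler.det_fiberBein, G2Euler.det_leftCurrent_eulerMap_eq, G2Euler.fFun_eq,
    G2Euler.existsUnique_beinVolume, fun μ hμ h E hE hinj => ?_⟩
  exact h.apply_eulerMap_image hE hinj
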